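/- Let $\mathbb J$ be $\{1,\dots,J\}$ with $J\ge 1$ or $\mathbb N$ (or any nonempty countable index set), let $\boldsymbol\gamma$ be the product of standard Gaussian measures on $Y=\mathbb R^{\mathbb J}$, let $\mathcal S$ be a real Banach space, and let $\mathcal F$ be the set of finitely supported multi-indices $\nu\in\mathbb N_0^{\mathbb J}$. **Quadrature.** Let $H_n=He_n/\sqrt{n!}$ be the Hermite polynomials orthonormal with respect to the standard Gaussian density. For $l\ge 0$ put $m_l=l+1$ and let $\mathcal Q_l(g)=\sum_{k=0}^{m_l-1} w_k^l\, g(y_k^l)$ be the Gauss–Hermite rule: $y_k^l$ are the roots of $H_{m_l}$ and $w_k^l = 1/\bigl(m_l\,H_{m_l-1}(y_k^l)^2\bigr)$. Put $\mathcal Q_{-1}=0$ and $\triangle_l=\mathcal Q_l-\mathcal Q_{l-1}$. For $\nu\in\mathcal F$ let $\triangle_\nu=\bigotimes_{j\in \operatorname{supp}\nu}\triangle_{\nu_j}$, the coordinates $y_j$ with $j\notin\operatorname{supp}\nu$ being set to $0$. Let $G_\nu$ be the set of points $y\in Y$ such that $y_j$ is a root of $H_{m_{\nu_j}}$ for $j\in\operatorname{supp}\nu$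 and $y_j=0$ otherwise. For a finite $\Lambda\subset\mathcal F$ put $\mathcal Q_\Lambda(f)=\sum_{\nu\in\Lambda}\triangle_\nu(f)$ and $N_p(\Lambda)=\bigl|\bigcup_{\nu\in\Lambda}G_\nu\bigr|$. Call $\Lambda$ admissible if $\nu\in\Lambda$ and $\mu\le\nu$ coordinatewise imply $\mu\in\Lambda$. **Assumptions.** Let $0<q<2$, let $(\tau_j)_{j\in\mathbb J}$ be positive with $\sum_j\tau_j^{-q}<\infty$, and let $r$ be the smallest integer with $r>14/q$. Let $f:Y\to\mathcal S$ have mixed weak partial derivatives $\partial^\mu f\in L^2_{\boldsymbol\gamma}(Y,\mathcal S)$ for all $\mu\in\mathcal F$ with $|\mu|_\infty\le r$ (in particular $f\in L^2_{\boldsymbol\gamma}(Y,\mathcal S)$), with $$\sum_{|\mu|_\infty\le r}\frac{\tau^{2\mu}}{\mu!}\int_Y\|\partial^\mu f(y)\|_{\mathcal S}^2\,d\boldsymbol\gamma(y)<\infty .$$ Here $g$ is the weak derivative $\partial_j h$ if $\int\varphi g\,d\boldsymbol\gamma=\int(y_j\varphi-\partial_j\varphi)\,h\,d\boldsymbol\gamma$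 for every $\varphi$ that is a $C_c^\infty$ function of finitely many coordinates. So that the point values of $f$ used by the quadrature are meaningful, let $f$ be continuous at each finitely supported point $y^0\in Y$ in the following sense: for each $\varepsilon>0$ there are $w_j>0$ $(j\in\mathbb J)$ such that the box $B=\{y: |y_j-y^0_j|\le w_j\ \forall j\}$ has $\boldsymbol\gamma(B)>0$ and $\|f(y)-f(y^0)\|_{\mathcal S}\le\varepsilon$ for all $y\in B$. (For finite $\mathbb J$ this is ordinary continuity; in general it follows from continuity in the product topology.) **Conclusion.** For $\nu\in\mathcal F$ let $$b_\nu=\sum_{|\mu|_\infty\le r}\binom{\nu}{\mu}\tau^{2\mu},\qquad \binom{\nu}{\mu}=\prod_j\binom{\nu_j}{\mu_j}.$$ For every $N\ge 0$ there is an admissible set $\Lambda_N\subset\mathcal F$ with $|\Lambda_N|=N$ that consists of indices with the $N$ smallest values of $b_\nu$ (that is, $b_\mu\le b_\nu$ for all $\mu\in\Lambda_N$ and $\nu\notin\Lambda_N$). Moreover, there is a constant $C$, independent of $N$ and of the choice of $\Lambda_N$, such that for every $N\ge1$ and every such $\Lambda_N$, with $N_p=N_p(\Lambda_N)$, $$\Bigl\|\int_Y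 f\,d\boldsymbol\gamma-\mathcal Q_{\Lambda_N}(f)\Bigr\|_{\mathcal S}\le C\,N_p^{-s/2},\qquad s=\frac1q-\frac12 .$$ -/

import Mathlib

open MeasureTheory ProbabilityTheory

noncomputable section

namespace SparseQuad

/-! ### Univariate Gauss-Hermite quadrature with `l + 1` points at level `l` -/

/-- The orthonormal (with respect to the standard Gaussian measure) Hermite polynomial
`H_n = He_n / √(n!)`, with `He_n` the probabilists' Hermite polynomial, as a real function. -/
def hermiteFn (n : ℕ) (y : ℝ) : ℝ :=
  Polynomial.aeval y (Polynomial.hermite n) / Real.sqrt (n.factorial : ℝ)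

open Classical in
/-- The Gauss-Hermite nodes at level `l`: the real roots of `H_{l+1}`. -/
def nodes (l : ℕ) : Finset ℝ :=
  ((Polynomial.hermite (l + 1)).aroots ℝ).toFinset

/-- The Gauss-Hermite weight at level `l` of the node `y`, `1 / (m H_{m-1}(y)^2)` with
`m = l + 1`. -/
def weight (l : ℕ) (y : ℝ) : ℝ :=
  1 / (((l : ℝ) + 1) * hermiteFn l y ^ 2)

/-- The quadrature operator at level `l`, as the finite signed combination `∑ w_k δ_{y_k}` of
point evaluations. -/
def quad (l : ℕ) : ℝ →₀ ℝ :=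
  ∑ y ∈ nodes l, Finsupp.single y (weight l y)

/-- The difference operators `Q_l - Q_{l-1}`, with the convention `Q_{-1} = 0`. -/
def diffQuad : ℕ → (ℝ →₀ ℝ)
  | 0 => quad 0
  | l + 1 => quad (l + 1) - quad l

section Multivariate

variable {ι : Type*} {S : Type*} [NormedAddCommGroup S] [NormedSpace ℝ S]

open Classical in
/-- The point of `ℝ^ι` with coordinates `k j` for `j ∈ J` and `0` elsewhere. -/
def extendZero (J : Finset ι) (k : J → ℝ) : ι → ℝ :=
  fun j => if h : j ∈ J then k ⟨j, h⟩ else 0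

open Classical in
/-- The tensor product over `j ∈ J` of the finite combinations of point evaluations `q j`,
applied to `f`; the coordinates outside `J` are set to `0`. -/
def tensorApply (J : Finset ι) (q : ι → (ℝ →₀ ℝ)) (f : (ι → ℝ) → S) : S :=
  ∑ k ∈ Fintype.piFinset (fun j : J => (q j).support),
    (∏ j : J, q j (k j)) • f (extendZero J k)

/-- The tensorized difference operator `⊗_{j ∈ supp ν} (Q_{ν_j} - Q_{ν_j - 1})`. -/
def tensorDiff (ν : ι →₀ ℕ) (f : (ι → ℝ) → S) : S :=
  tensorApply ν.support (fun j => diffQuad (ν j)) f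

/-- The sparse quadrature operator `Q_Λ = ∑_{ν ∈ Λ} Δ_ν`. -/
def sparseQuad (Λ : Finset (ι →₀ ℕ)) (f : (ι → ℝ) → S) : S :=
  ∑ ν ∈ Λ, tensorDiff ν f

open Classical in
/-- The tensor grid `G_ν`. -/
def grid (ν : ι →₀ ℕ) : Finset (ι → ℝ) :=
  (Fintype.piFinset (fun j : ν.support => nodes (ν j))).image (extendZero ν.support)

open Classical in
/-- The number of (distinct) quadrature points in the sparse grid `G_Λ = ⋃_{ν ∈ Λ} G_ν`. -/
def numPoints (Λ : Finset (ι →₀ ℕ)) : ℕ :=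
  (Λ.biUnion grid).card

/-- A set of multi-indices is admissible if it is downward closed. -/
def Admissible (Λ : Finset (ι →₀ ℕ)) : Prop :=
  ∀ ν ∈ Λ, ∀ μ : ι →₀ ℕ, μ ≤ ν → μ ∈ Λ

open Classical in
/-- `b_ν = ∑_{|μ|_∞ ≤ r} binom(ν, μ) τ^{2μ}`; the terms with `μ ≰ ν` vanish and are left out. -/
def bWeight (τ : ι → ℝ) (r : ℕ) (ν : ι →₀ ℕ) : ℝ :=
  ∑ μ ∈ (Finset.Iic ν).filter (fun μ => ∀ j, μ j ≤ r),
    ∏ j ∈ ν.support, ((ν j).choose (μ j) : ℝ) * τ j ^ (2 * μ j)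

/-- `Λ` consists of `N` multi-indices with the `N` smallest values of `b_ν`. -/
def IsSmallest (τ : ι → ℝ) (r N : ℕ) (Λ : Finset (ι →₀ ℕ)) : Prop :=
  Λ.card = N ∧ ∀ μ ∈ Λ, ∀ ν, ν ∉ Λ → bWeight τ r μ ≤ bWeight τ r ν

/-! ### The Gaussian measure, weak derivatives, and continuity -/

/-- The product of standard Gaussian measures on `ℝ^ι`. -/
def gauss (ι : Type*) : Measure (ι → ℝ) :=
  Measure.infinitePi (fun _ : ι => gaussianReal 0 1)

/-- Smooth cylindrical test functions: `C_c^∞` functions of finitely many coordinates. -/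
def IsTest (φ : (ι → ℝ) → ℝ) : Prop :=
  ∃ (s : Finset ι) (ψ : (s → ℝ) → ℝ), ContDiff ℝ (⊤ : ℕ∞) ψ ∧ HasCompactSupport ψ ∧
    φ = fun y => ψ (fun j : s => y j)

open Classical in
/-- The classical partial derivative of `φ` with respect to the coordinate `j`. -/
def partialDeriv (j : ι) (φ : (ι → ℝ) → ℝ) (y : ι → ℝ) : ℝ :=
  deriv (fun t => φ (Function.update y j t)) (y j)

/-- `g` is the weak partial derivative `∂_j f` with respect to the Gaussian measure:
`∫ φ g dγ = ∫ (y_j φ - ∂_j φ) f dγ` for all test functions `φ`. -/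
def IsWeakPartial (j : ι) (f g : (ι → ℝ) → S) : Prop :=
  ∀ φ : (ι → ℝ) → ℝ, IsTest φ →
    ∫ y, φ y • g y ∂(gauss ι) = ∫ y, (y j * φ y - partialDeriv j φ y) • f y ∂(gauss ι)

/-- The functions `D μ`, `|μ|_∞ ≤ r`, are the mixed weak derivatives `∂^μ f`, and all of them
lie in `L^2(γ; S)`. -/
structure IsMixedDerivs (r : ℕ) (f : (ι → ℝ) → S) (D : (ι →₀ ℕ) → (ι → ℝ) → S) : Prop where
  zero : D 0 = f
  memLp : ∀ μ : ι →₀ ℕ, (∀ j, μ j ≤ r) → MemLp (D μ) 2 (gauss ι)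
  succ : ∀ (μ : ι →₀ ℕ) (j : ι), (∀ i, (μ + Finsupp.single j 1 : ι →₀ ℕ) i ≤ r) →
    IsWeakPartial j (D μ) (D (μ + Finsupp.single j 1))

/-- Continuity of `f` at `y₀` along boxes: for each `ε > 0` there is a centred closed box
`∏_j [y₀_j - w_j, y₀_j + w_j]`, `w_j > 0`, of positive Gaussian measure on which `f` differs from
`f y₀` by at most `ε`. This follows from continuity at `y₀` in the product topology (the `w_j` may
be as large as one likes for all but finitely many `j`), and is ordinary continuity at `y₀` if
`ι` is finite. -/
def BoxContinuousAt (f : (ι → ℝ) → S) (y₀ : ι → ℝ) : Prop :=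
  ∀ ε : ℝ, 0 < ε → ∃ w : ι → ℝ, (∀ j, 0 < w j) ∧
    0 < gauss ι {y | ∀ j, |y j - y₀ j| ≤ w j} ∧
    ∀ y : ι → ℝ, (∀ j, |y j - y₀ j| ≤ w j) → ‖f y - f y₀‖ ≤ ε

end Multivariate

end SparseQuad

end

namespace SparseQuad

open Polynomial

/-! ### Hermite polynomials -/

/-! Everything is read off from Hermite expansions. For a continuous linear functional L on S, write
c_ν for the Hermite coefficients of L ∘ f. The error, tested with L, is ∑ c_ν (δ_{ν0} − Q_Λ H_ν),
and three facts control this series.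

(1) Decay of c_ν. Integration by parts turns the coefficients of ∂^μ f into those of f, and Bessel's
inequality applied to each derivative, weighted by τ^{2μ}/μ!, produces exactly the weight b_ν: ∑ b_ν
c_ν² ≤ ‖L‖² M, where M is the assumed finite sum (`sum_bWeight_mul_sq_le`). Bessel is used only for
scalar functions, so S need not be a Hilbert space; the norm is recovered at the end by Hahn–Banach.

(2) Size of Q_Λ H_ν. If ν ∈ Λ, admissibility makes the differences telescope in each coordinate and
the rule is exact. In general |Q_Λ H_ν| ≤ ∏ 16 ν_j³ independently of Λ
(`abs_sparseQuad_hermiteProd_le`). In one variable this comes from two energies of the oscillator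
u'' + (n + 1/2 − y²/4) u = 0 satisfied by u = H_n e^{-y²/4}: one decreases and bounds H_n above, the
other increases and bounds the Gauss weights above.

(3) Summability. b_ν is a product of univariate factors of size at least a constant times ν_j^r
θ(τ_j), so V = ∑ b_ν^{-q/2} ∏ 256 ν_j⁶ is finite when rq/2 > 7 (`summable_bWeight_rpow`). If Λ holds
the N smallest weights, a Stechkin argument gives b_ν^{-1} ≤ b_ν^{-q/2} (V/N)^{2s} outside Λ
(`inv_bWeight_le`).

Cauchy–Schwarz combines the three into an error of order N^{-s}. For admissible Λ every tensor grid
has at most N points, so N_p ≤ N² and N^{-s} ≤ N_p^{-s/2}.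

The delicate point is that f is only an L² function with box continuity, while quadrature needs
point values. `hasSum_hermiteProd_of_boxContinuousAt` shows that the Hermite series converges to the
right value at finitely supported points. It averages over shrinking boxes, expands the averages by
Parseval (hence the completeness of the Hermite system in infinitely many variables), and passes to
the limit by dominated convergence. -/

theorem derivative_hermite_succ (n : ℕ) :
    derivative (hermite (n + 1)) = ((n : ℤ[X]) + 1) * hermite n := by
  induction n with
  | zero => simp [hermite_zero]
  | succ n ih =>
    rw [hermite_succ (n + 1), derivative_sub, derivative_mul, derivative_X, ih]
    have h : derivative (((n : ℤ[X]) + 1) * hermite n)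
        = ((n : ℤ[X]) + 1) * derivative (hermite n) := by
      rw [derivative_mul]; simp
    rw [h, hermite_succ n]
    push_cast
    ring

theorem hermite_succ_succ (n : ℕ) :
    hermite (n + 2) = X * hermite (n + 1) - ((n : ℤ[X]) + 1) * hermite n := by
  rw [hermite_succ (n + 1), derivative_hermite_succ]

/-- The value at `x` of the probabilists' Hermite polynomial `He_n`. -/
noncomputable def he {R : Type*} [CommRing R] (n : ℕ) (x : R) : R := aeval x (hermite n)

section he

variable {R : Type*} [CommRing R]

@[simp] theorem he_zero (x : R) : he 0 x = 1 := by simp [he, hermite_zero]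

@[simp] theorem he_one (x : R) : he 1 x = x := by simp [he]

theorem he_succ_succ (n : ℕ) (x : R) :
    he (n + 2) x = x * he (n + 1) x - ((n : R) + 1) * he n x := by
  rw [he, hermite_succ_succ]; simp [he, -hermite_succ]

theorem map_he {R' : Type*} [CommRing R'] (φ : R →+* R') (n : ℕ) (x : R) :
    φ (he n x) = he n (φ x) := by
  induction n using Nat.twoStepInduction with
  | zero => simp
  | one => simp
  | more n h0 h1 => simp [he_succ_succ, h0, h1]

theorem he_neg (n : ℕ) (x : R) : he n (-x) = (-1) ^ n * he n x := by
  induction n using Nat.twoStepInduction with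
  | zero => simp
  | one => simp
  | more n h0 h1 => rw [he_succ_succ, he_succ_succ, h0, h1]; ring

end he

theorem hasDerivAt_he (n : ℕ) (x : ℝ) :
    HasDerivAt (fun x : ℝ => he (n + 1) x) (((n : ℝ) + 1) * he n x) x := by
  have h := ((hermite (n + 1)).map (algebraMap ℤ ℝ)).hasDerivAt x
  rw [derivative_map, derivative_hermite_succ] at h
  simpa [he, aeval_def, eval₂_eq_eval_map, Polynomial.map_mul] using h

/-- The Christoffel-Darboux formula. -/
theorem christoffel_darboux {K : Type*} [Field K] [CharZero K] (m : ℕ) (x y : K) :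
    (∑ i ∈ Finset.range (m + 1), he i x * he i y / (i.factorial : K)) * (x - y) =
      (he (m + 1) x * he m y - he m x * he (m + 1) y) / (m.factorial : K) := by
  induction m with
  | zero => simp
  | succ m ih =>
    rw [Finset.sum_range_succ, add_mul, ih, Nat.factorial_succ, he_succ_succ m x,
      he_succ_succ m y]
    have h1 : (m.factorial : K) ≠ 0 := by exact_mod_cast m.factorial_ne_zero
    have h2 : (m : K) + 1 ≠ 0 := by exact_mod_cast m.succ_ne_zero
    push_cast
    field_simp
    ring

/-- The confluent Christoffel-Darboux formula. -/
theorem christoffel_darboux_self {K : Type*} [Field K] [CharZero K] (m : ℕ) (x : K) :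
    ∑ i ∈ Finset.range (m + 2), he i x * he i x / (i.factorial : K) =
      (((m : K) + 2) * he (m + 1) x ^ 2 - ((m : K) + 1) * he m x * he (m + 2) x) /
        ((m + 1).factorial : K) := by
  induction m with
  | zero => simp [Finset.sum_range_succ, he_succ_succ]; ring
  | succ m ih =>
    rw [Finset.sum_range_succ, ih, Nat.factorial_succ (m + 1), he_succ_succ (m + 1) x,
      he_succ_succ m x]
    have h1 : ((m + 1).factorial : K) ≠ 0 := by exact_mod_cast (m + 1).factorial_ne_zero
    have h2 : (m : K) + 1 + 1 ≠ 0 := by exact_mod_cast (m + 1).succ_ne_zero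
    push_cast
    field_simp
    ring

/-! ### Zeros of the Hermite polynomials: real and simple. -/

/-- Two consecutive Hermite polynomials have no common zero. -/
theorem he_ne_zero_of_succ_eq_zero {K : Type*} [Field K] [CharZero K] (n : ℕ) (x : K)
    (h : he (n + 1) x = 0) : he n x ≠ 0 := by
  induction n with
  | zero => simp
  | succ n ih =>
    intro h0
    apply ih h0
    rw [he_succ_succ, h0] at h
    have h2 : (n : K) + 1 ≠ 0 := by exact_mod_cast n.succ_ne_zero
    simpa [h2] using h

/-- In Christoffel–Darboux at the points z and its conjugate the right side vanishes, while the sum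
on the left is ∑ |He_i(z)|²/i!, which is positive because its term i = 0 is 1. -/
theorem conj_eq_of_he_eq_zero (m : ℕ) (z : ℂ) (h : he (m + 1) z = 0) :
    (starRingEnd ℂ) z = z := by
  have hc := christoffel_darboux m z ((starRingEnd ℂ) z)
  rw [← map_he, h, ← map_he, h] at hc
  simp only [map_zero, mul_zero, zero_mul, sub_zero, zero_div, mul_eq_zero] at hc
  rcases hc with hc | hc
  · exfalso
    have e : ∀ i ∈ Finset.range (m + 1),
        he i z * he i ((starRingEnd ℂ) z) / (i.factorial : ℂ)
          = ((Complex.normSq (he i z) / (i.factorial : ℝ) : ℝ) : ℂ) := by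
      intro i _
      rw [← map_he, Complex.mul_conj]
      push_cast
      ring
    rw [Finset.sum_congr rfl e, ← Complex.ofReal_sum, Complex.ofReal_eq_zero,
      Finset.sum_eq_zero_iff_of_nonneg
        (fun i _ => div_nonneg (Complex.normSq_nonneg _) (Nat.cast_nonneg _))] at hc
    simpa using hc 0 (by simp)
  · exact (sub_eq_zero.1 hc).symm

theorem mem_nodes {l : ℕ} {y : ℝ} : y ∈ nodes l ↔ he (l + 1) y = 0 := by
  rw [nodes, Multiset.mem_toFinset, mem_aroots]
  exact and_iff_right (hermite_monic (l + 1)).ne_zero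

/-- Over ℂ there are l + 1 roots with multiplicity. They are distinct because He_{l+1} and its
derivative (l+1) He_l have no common zero, and they are all real. -/
theorem card_nodes (l : ℕ) : (nodes l).card = l + 1 := by
  classical
  apply le_antisymm
  · have h := card_roots' ((hermite (l + 1)).map (algebraMap ℤ ℝ))
    rw [(hermite_monic (l + 1)).natDegree_map, natDegree_hermite] at h
    exact (Multiset.toFinset_card_le _).trans h
  · set p : ℂ[X] := (hermite (l + 1)).map (algebraMap ℤ ℂ) with hp
    have hroot : ∀ z, z ∈ p.roots ↔ he (l + 1) z = 0 := by
      intro z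
      exact (mem_aroots (p := hermite (l + 1)) (a := z)).trans
        (and_iff_right (hermite_monic (l + 1)).ne_zero)
    have hcard : Multiset.card p.roots = l + 1 := by
      rw [← (IsAlgClosed.splits p).natDegree_eq_card_roots,
        (hermite_monic (l + 1)).natDegree_map, natDegree_hermite]
    have hnd : p.roots.Nodup := by
      apply nodup_roots
      rw [separable_def]
      refine isCoprime_of_dvd _ _ ?_ ?_
      · rintro ⟨h, -⟩
        exact ((hermite_monic (l + 1)).map _).ne_zero h
      · intro d hd hd0 h1 h2
        have hdeg : d.degree ≠ 0 := by
          intro h; exact hd (isUnit_iff_degree_eq_zero.2 h)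
        obtain ⟨z, hz⟩ := IsAlgClosed.exists_root d hdeg
        have e1 : he (l + 1) z = 0 := by
          have := hz.dvd h1
          simpa [p, IsRoot, he, aeval_def, eval₂_eq_eval_map] using this
        have e2 : he l z = 0 := by
          have h3 := hz.dvd h2
          rw [hp, derivative_map, derivative_hermite_succ] at h3
          have h4 : (l : ℂ) + 1 ≠ 0 := by exact_mod_cast l.succ_ne_zero
          simpa [IsRoot, he, aeval_def, eval₂_eq_eval_map, Polynomial.map_mul, h4] using h3
        exact he_ne_zero_of_succ_eq_zero l z e1 e2
    rw [← hcard, ← Multiset.toFinset_card_of_nodup hnd]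
    calc p.roots.toFinset.card ≤ ((nodes l).image (fun x : ℝ => (x : ℂ))).card := by
          apply Finset.card_le_card
          intro z hz
          rw [Multiset.mem_toFinset, hroot] at hz
          obtain ⟨x, rfl⟩ := Complex.conj_eq_iff_real.1 (conj_eq_of_he_eq_zero l z hz)
          refine Finset.mem_image.2 ⟨x, mem_nodes.2 ?_, rfl⟩
          have := map_he Complex.ofRealHom (l + 1) x
          simp only [Complex.ofRealHom_eq_coe, hz] at this
          exact_mod_cast this
      _ ≤ (nodes l).card := Finset.card_image_le

/-! ### Normalized Hermite polynomials -/

theorem hermiteFn_eq (n : ℕ) (y : ℝ) : hermiteFn n y = he n y / √(n.factorial : ℝ) := rfl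

@[simp] theorem hermiteFn_zero (y : ℝ) : hermiteFn 0 y = 1 := by simp [hermiteFn_eq]

@[simp] theorem hermiteFn_one (y : ℝ) : hermiteFn 1 y = y := by simp [hermiteFn_eq]

theorem sqrt_factorial_succ (n : ℕ) :
    √((n + 1).factorial : ℝ) = √((n : ℝ) + 1) * √(n.factorial : ℝ) := by
  rw [Nat.factorial_succ, Nat.cast_mul, Real.sqrt_mul (Nat.cast_nonneg _)]
  push_cast; rfl

theorem sqrt_factorial_ne_zero (n : ℕ) : √(n.factorial : ℝ) ≠ 0 :=
  Real.sqrt_ne_zero'.2 (by exact_mod_cast n.factorial_pos)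

theorem he_eq (n : ℕ) (y : ℝ) : he n y = √(n.factorial : ℝ) * hermiteFn n y := by
  rw [hermiteFn_eq, mul_div_cancel₀ _ (sqrt_factorial_ne_zero n)]

theorem hermiteFn_succ_succ (n : ℕ) (y : ℝ) :
    √((n : ℝ) + 2) * hermiteFn (n + 2) y =
      y * hermiteFn (n + 1) y - √((n : ℝ) + 1) * hermiteFn n y := by
  have h := he_succ_succ n y
  rw [he_eq, he_eq, he_eq, sqrt_factorial_succ (n + 1), sqrt_factorial_succ n] at h
  have h0 := sqrt_factorial_ne_zero n
  have h1 : √((n : ℝ) + 1) ≠ 0 := Real.sqrt_ne_zero'.2 (by positivity)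
  have h2 : √((n : ℝ) + 1) ^ 2 = n + 1 := Real.sq_sqrt (by positivity)
  have e : ((n + 1 : ℕ) : ℝ) + 1 = n + 2 := by push_cast; ring
  rw [e] at h
  have : (√((n : ℝ) + 1) * √(n.factorial : ℝ)) * (√((n : ℝ) + 2) * hermiteFn (n + 2) y) =
      (√((n : ℝ) + 1) * √(n.factorial : ℝ)) * (y * hermiteFn (n + 1) y -
        √((n : ℝ) + 1) * hermiteFn n y) := by
    linear_combination h + (√(n.factorial : ℝ) * hermiteFn n y) * h2
  exact mul_left_cancel₀ (mul_ne_zero h1 h0) this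

theorem hasDerivAt_hermiteFn_succ (n : ℕ) (y : ℝ) :
    HasDerivAt (hermiteFn (n + 1)) (√((n : ℝ) + 1) * hermiteFn n y) y := by
  have h := (hasDerivAt_he n y).div_const √((n + 1).factorial : ℝ)
  suffices e : √((n : ℝ) + 1) * hermiteFn n y =
      ((n : ℝ) + 1) * he n y / √((n + 1).factorial : ℝ) by
    rw [e]; exact h
  rw [he_eq, sqrt_factorial_succ]
  have h0 := sqrt_factorial_ne_zero n
  have h1 : √((n : ℝ) + 1) ≠ 0 := Real.sqrt_ne_zero'.2 (by positivity)
  have h2 : √((n : ℝ) + 1) ^ 2 = n + 1 := Real.sq_sqrt (by positivity)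
  field_simp
  rw [h2]

theorem hermiteFn_neg_sq (n : ℕ) (y : ℝ) : hermiteFn n (-y) ^ 2 = hermiteFn n y ^ 2 := by
  rw [hermiteFn_eq, hermiteFn_eq, he_neg, div_pow, div_pow, mul_pow, ← pow_mul, mul_comm n 2,
    pow_mul]
  simp

theorem contDiff_hermiteFn (n : ℕ) {k : WithTop ℕ∞} : ContDiff ℝ k (hermiteFn n) := by
  have : hermiteFn n = fun y => aeval y (hermite n) / √(n.factorial : ℝ) := rfl
  rw [this]
  exact (Polynomial.contDiff_aeval (hermite n) k).div_const _

theorem continuous_hermiteFn (n : ℕ) : Continuous (hermiteFn n) :=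
  (contDiff_hermiteFn n (k := 0)).continuous

/-! ### Gauss-Hermite quadrature -/

theorem he_mul_he_div (i : ℕ) (x y : ℝ) :
    he i x * he i y / (i.factorial : ℝ) = hermiteFn i x * hermiteFn i y := by
  rw [hermiteFn_eq, hermiteFn_eq, div_mul_div_comm, Real.mul_self_sqrt (Nat.cast_nonneg _)]

theorem hermiteFn_ne_zero_of_mem_nodes {l : ℕ} {y : ℝ} (h : y ∈ nodes l) :
    hermiteFn l y ≠ 0 := by
  rw [hermiteFn_eq]
  exact div_ne_zero (he_ne_zero_of_succ_eq_zero l y (mem_nodes.1 h)) (sqrt_factorial_ne_zero l)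

theorem hermiteFn_eq_zero_of_mem_nodes {l : ℕ} {y : ℝ} (h : y ∈ nodes l) :
    hermiteFn (l + 1) y = 0 := by
  rw [hermiteFn_eq, mem_nodes.1 h, zero_div]

/-- Together with the diagonal case that follows, this is the dual orthogonality relation: the
kernel ∑ H_i(x) H_i(y) is diagonal on the nodes, with the inverse weights as entries. -/
theorem sum_hermiteFn_mul_of_mem_nodes {l : ℕ} {x y : ℝ} (hx : x ∈ nodes l) (hy : y ∈ nodes l)
    (hxy : x ≠ y) : ∑ i ∈ Finset.range (l + 1), hermiteFn i x * hermiteFn i y = 0 := by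
  have h := christoffel_darboux l x y
  rw [mem_nodes.1 hx, mem_nodes.1 hy] at h
  simp only [he_mul_he_div] at h
  simpa [sub_ne_zero.2 hxy] using h

theorem sum_hermiteFn_sq_of_mem_nodes {l : ℕ} {x : ℝ} (hx : x ∈ nodes l) :
    ∑ i ∈ Finset.range (l + 1), hermiteFn i x * hermiteFn i x = (weight l x)⁻¹ := by
  rw [weight, one_div, inv_inv]
  cases l with
  | zero => simp
  | succ l =>
    have h := christoffel_darboux_self l x
    rw [mem_nodes.1 hx] at h
    simp only [he_mul_he_div] at h
    rw [h, hermiteFn_eq, div_pow, Real.sq_sqrt (Nat.cast_nonneg _)]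
    push_cast
    ring

theorem weight_pos {l : ℕ} {x : ℝ} (hx : x ∈ nodes l) : 0 < weight l x := by
  have := hermiteFn_ne_zero_of_mem_nodes hx
  unfold weight
  positivity

/-- The Gauss-Hermite rule integrates `H_i H_j` exactly if both degrees are at most `l`. -/
theorem sum_weight_hermiteFn_mul (l : ℕ) {i j : ℕ} (hi : i ≤ l) (hj : j ≤ l) :
    ∑ y ∈ nodes l, weight l y * (hermiteFn i y * hermiteFn j y) = if i = j then 1 else 0 := by
  classical
  -- Dual orthogonality says that the rows of this matrix are orthonormal. The matrix is square,
  -- since there are l + 1 nodes, so its columns are orthonormal too, which is the claim.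
  let A : Matrix (nodes l) (Fin (l + 1)) ℝ :=
    Matrix.of fun x i => √(weight l x) * hermiteFn i x
  have hA : A * A.transpose = 1 := by
    ext x y
    rw [Matrix.mul_apply, Matrix.one_apply]
    have e : ∀ i : Fin (l + 1), A x i * A.transpose i y =
        (√(weight l x) * √(weight l y)) * (hermiteFn i x * hermiteFn i y) := by
      intro i; simp only [A, Matrix.transpose_apply, Matrix.of_apply]; ring
    simp only [e]
    rw [← Finset.mul_sum,
      Fin.sum_univ_eq_sum_range (fun i => hermiteFn i (x : ℝ) * hermiteFn i (y : ℝ))]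
    split_ifs with h
    · subst h
      rw [sum_hermiteFn_sq_of_mem_nodes x.2, Real.mul_self_sqrt (weight_pos x.2).le,
        mul_inv_cancel₀ (weight_pos x.2).ne']
    · rw [sum_hermiteFn_mul_of_mem_nodes x.2 y.2 (fun h' => h (Subtype.ext h')), mul_zero]
  have hA' : A.transpose * A = 1 :=
    (Matrix.mul_eq_one_comm_of_card_eq _ _ _ (by simp [card_nodes])).1 hA
  have h := congrFun (congrFun hA' ⟨i, by omega⟩) ⟨j, by omega⟩
  rw [Matrix.mul_apply, Matrix.one_apply] at h
  simp only [Fin.mk.injEq] at h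
  have e : ∑ y ∈ nodes l, √(weight l y) * hermiteFn i y * (√(weight l y) * hermiteFn j y) =
      if i = j then 1 else 0 := by
    rw [← h, ← Finset.sum_coe_sort (nodes l)]
    rfl
  rw [← e]
  refine Finset.sum_congr rfl fun y hy => ?_
  nth_rw 1 [← Real.mul_self_sqrt (weight_pos hy).le]
  ring

end SparseQuad
namespace SparseQuad

/-! ### Pointwise bounds for Hermite polynomials -/

theorem add_two_mul_hermiteFn_zero_sq (n : ℕ) :
    ((n : ℝ) + 2) * hermiteFn (n + 2) 0 ^ 2 = ((n : ℝ) + 1) * hermiteFn n 0 ^ 2 := by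
  have h := congrArg (· ^ 2) (hermiteFn_succ_succ n 0)
  simp only [zero_mul, zero_sub, neg_sq, mul_pow] at h
  rwa [Real.sq_sqrt (by positivity), Real.sq_sqrt (by positivity)] at h

theorem hermiteFn_zero_sq_le_one (n : ℕ) : hermiteFn n 0 ^ 2 ≤ 1 := by
  induction n using Nat.twoStepInduction with
  | zero => simp
  | one => simp
  | more n h0 _ =>
    have h := add_two_mul_hermiteFn_zero_sq n
    nlinarith [Nat.cast_nonneg (α := ℝ) n]

/-- This is the initial value at y = 0 for the increasing energy. By parity one of two consecutive
Hermite polynomials vanishes at 0, so only the sum of both squares has a lower bound. -/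
theorem one_le_mul_hermiteFn_zero_sq_add (n : ℕ) :
    1 ≤ ((n : ℝ) + 1) * (hermiteFn n 0 ^ 2 + hermiteFn (n + 1) 0 ^ 2) := by
  induction n with
  | zero => simp
  | succ n ih =>
    have h := add_two_mul_hermiteFn_zero_sq n
    push_cast
    nlinarith [sq_nonneg (hermiteFn (n + 1) 0)]

/-- `V = H' - (y/2) H`, so that `V e^{-y²/4}` is the derivative of `H e^{-y²/4}`,
`H = H_{n+1}`. -/
noncomputable def hermiteV (n : ℕ) (y : ℝ) : ℝ :=
  √((n : ℝ) + 1) * hermiteFn n y - y / 2 * hermiteFn (n + 1) y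

theorem hasDerivAt_hermiteFn_succ' (n : ℕ) (y : ℝ) :
    HasDerivAt (hermiteFn (n + 1)) (hermiteV n y + y / 2 * hermiteFn (n + 1) y) y := by
  convert hasDerivAt_hermiteFn_succ n y using 1
  simp [hermiteV]

theorem hasDerivAt_sqrt_mul_hermiteFn (n : ℕ) (y : ℝ) :
    HasDerivAt (fun y => √((n : ℝ) + 1) * hermiteFn n y)
      (y * (√((n : ℝ) + 1) * hermiteFn n y) - ((n : ℝ) + 1) * hermiteFn (n + 1) y) y := by
  cases n with
  | zero => simpa using hasDerivAt_const y (1 : ℝ)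
  | succ n =>
    refine ((hasDerivAt_hermiteFn_succ n y).const_mul √(((n + 1 : ℕ) : ℝ) + 1)).congr_deriv ?_
    have h := hermiteFn_succ_succ n y
    have e : ((n + 1 : ℕ) : ℝ) + 1 = n + 2 := by push_cast; ring
    rw [e]
    have h2 : √((n : ℝ) + 2) ^ 2 = n + 2 := Real.sq_sqrt (by positivity)
    linear_combination √((n : ℝ) + 2) * h - hermiteFn (n + 2) y * h2

/-- This is Hermite's equation for index n + 1 in first-order form: u = H_{n+1} e^{-y²/4} satisfies
u'' + φ u = 0 with φ = n + 3/2 − y²/4. -/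
theorem hasDerivAt_hermiteV (n : ℕ) (y : ℝ) :
    HasDerivAt (hermiteV n)
      (y / 2 * hermiteV n y + (y ^ 2 / 4 - ((n : ℝ) + 3 / 2)) * hermiteFn (n + 1) y) y := by
  have h := (hasDerivAt_sqrt_mul_hermiteFn n y).sub
    (((hasDerivAt_id y).div_const 2).mul (hasDerivAt_hermiteFn_succ n y))
  refine h.congr_deriv ?_
  simp only [hermiteV, id]
  ring

theorem hasDerivAt_exp_neg_sq_div_two (y : ℝ) :
    HasDerivAt (fun y : ℝ => Real.exp (-(y ^ 2 / 2))) (-y * Real.exp (-(y ^ 2 / 2))) y := by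
  have h := (((hasDerivAt_pow 2 y).div_const 2).neg).exp
  refine h.congr_deriv ?_
  simp
  ring

/-- The energy `V² + (n + 1/2 - y²/4) H²` (times `e^{-y²/2}`) of `H = H_n` decreases on
`y ≥ 0`. -/
theorem antitoneOn_energy (n : ℕ) :
    AntitoneOn (fun y => (hermiteV n y ^ 2 + ((n : ℝ) + 3 / 2 - y ^ 2 / 4) *
      hermiteFn (n + 1) y ^ 2) * Real.exp (-(y ^ 2 / 2))) (Set.Ici 0) := by
  -- The derivative of u'² + φ u² is φ' u², since u'' = −φ u, and here φ' = −y/2.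
  have hd : ∀ y : ℝ, HasDerivAt (fun y => (hermiteV n y ^ 2 + ((n : ℝ) + 3 / 2 - y ^ 2 / 4) *
      hermiteFn (n + 1) y ^ 2) * Real.exp (-(y ^ 2 / 2)))
      (-(y / 2 * hermiteFn (n + 1) y ^ 2 * Real.exp (-(y ^ 2 / 2)))) y := by
    intro y
    have h := ((((hasDerivAt_hermiteV n y).pow 2).add
      ((((hasDerivAt_pow 2 y).div_const 4).const_sub ((n : ℝ) + 3 / 2)).mul
        ((hasDerivAt_hermiteFn_succ' n y).pow 2))).mul (hasDerivAt_exp_neg_sq_div_two y))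
    refine h.congr_deriv ?_
    simp only [Pi.add_apply, Pi.mul_apply, Pi.pow_apply]
    push_cast
    ring
  refine antitoneOn_of_deriv_nonpos (convex_Ici 0)
    (fun y _ => (hd y).continuousAt.continuousWithinAt)
    (fun y _ => (hd y).differentiableAt.differentiableWithinAt) fun y hy => ?_
  rw [interior_Ici, Set.mem_Ioi] at hy
  rw [(hd y).deriv, neg_nonpos]
  positivity

/-- The energy `V² / (n + 1/2 - y²/4) + H²` (times `e^{-y²/2}`) of `H = H_n` increases on
`0 ≤ y < √(4n+2)`. -/
theorem monotoneOn_energy (n : ℕ) :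
    MonotoneOn (fun y => (hermiteV n y ^ 2 / ((n : ℝ) + 3 / 2 - y ^ 2 / 4) +
      hermiteFn (n + 1) y ^ 2) * Real.exp (-(y ^ 2 / 2)))
      (Set.Ico 0 (2 * √((n : ℝ) + 3 / 2))) := by
  have hpos : ∀ y ∈ Set.Ico 0 (2 * √((n : ℝ) + 3 / 2)), 0 < (n : ℝ) + 3 / 2 - y ^ 2 / 4 := by
    rintro y ⟨h0, h1⟩
    have h2 : √((n : ℝ) + 3 / 2) ^ 2 = n + 3 / 2 := Real.sq_sqrt (by positivity)
    nlinarith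
  -- The derivative of u'²/φ + u² is −φ' u'²/φ², which is nonnegative for y ≥ 0 as long as φ > 0.
  have hd : ∀ y ∈ Set.Ico 0 (2 * √((n : ℝ) + 3 / 2)),
      HasDerivAt (fun y => (hermiteV n y ^ 2 / ((n : ℝ) + 3 / 2 - y ^ 2 / 4) +
      hermiteFn (n + 1) y ^ 2) * Real.exp (-(y ^ 2 / 2)))
      (y / 2 * hermiteV n y ^ 2 / ((n : ℝ) + 3 / 2 - y ^ 2 / 4) ^ 2 *
        Real.exp (-(y ^ 2 / 2))) y := by
    intro y hy
    have h0 := (hpos y hy).ne'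
    have h := (((((hasDerivAt_hermiteV n y).pow 2).div
      (((hasDerivAt_pow 2 y).div_const 4).const_sub ((n : ℝ) + 3 / 2)) h0).add
        ((hasDerivAt_hermiteFn_succ' n y).pow 2)).mul (hasDerivAt_exp_neg_sq_div_two y))
    refine h.congr_deriv ?_
    simp only [Pi.add_apply, Pi.div_apply, Pi.pow_apply]
    push_cast
    generalize hc : (n : ℝ) + 3 / 2 - y ^ 2 / 4 = c at *
    have hn : (n : ℝ) = c - 3 / 2 + y ^ 2 / 4 := by linarith
    rw [hn]
    field_simp
    ring
  refine monotoneOn_of_deriv_nonneg (convex_Ico _ _)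
    (fun y hy => (hd y hy).continuousAt.continuousWithinAt)
    (fun y hy => (hd y (interior_subset hy)).differentiableAt.differentiableWithinAt)
    fun y hy => ?_
  have hy' := interior_subset hy
  rw [(hd y hy').deriv]
  have := hpos y hy'
  have := hy'.1
  positivity

theorem hermiteFn_abs_sq (n : ℕ) (y : ℝ) : hermiteFn n |y| ^ 2 = hermiteFn n y ^ 2 := by
  rcases abs_choice y with h | h <;> rw [h]
  exact hermiteFn_neg_sq n y

/-- Compare the decreasing energy at |y| with its value at 0, which is explicit. For positive n the
condition on y keeps the coefficient n + 1/2 − y²/4 of H_n² at least 1/2. -/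
theorem hermiteFn_sq_le (n : ℕ) {y : ℝ} (hy : y ^ 2 / 4 ≤ n) :
    hermiteFn n y ^ 2 ≤ (4 * n + 1) * Real.exp (y ^ 2 / 2) := by
  cases n with
  | zero =>
    simp only [hermiteFn_zero, Nat.cast_zero]
    have := Real.one_le_exp (x := y ^ 2 / 2) (by positivity)
    linarith
  | succ n =>
    have h := antitoneOn_energy n (a := 0) (b := |y|) (by simp) (by simp) (abs_nonneg y)
    simp only [sq_abs, hermiteFn_abs_sq] at h
    have h0 : hermiteV n 0 ^ 2 ≤ n + 1 := by
      simp only [hermiteV, zero_div, zero_mul, sub_zero, mul_pow]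
      rw [Real.sq_sqrt (by positivity)]
      have := hermiteFn_zero_sq_le_one n
      nlinarith [Nat.cast_nonneg (α := ℝ) n]
    have h1 := hermiteFn_zero_sq_le_one (n + 1)
    push_cast at hy ⊢
    rw [Real.exp_neg, ← div_eq_mul_inv, div_le_iff₀ (Real.exp_pos _)] at h
    have h2 : (hermiteV n 0 ^ 2 + ((n : ℝ) + 3 / 2 - 0 ^ 2 / 4) * hermiteFn (n + 1) 0 ^ 2) *
        Real.exp (-(0 ^ 2 / 2)) ≤ 2 * n + 5 / 2 := by
      simp
      nlinarith [Nat.cast_nonneg (α := ℝ) n]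
    have h3 := mul_le_mul_of_nonneg_right h2 (Real.exp_pos (y ^ 2 / 2)).le
    have h4 : 1 / 2 * hermiteFn (n + 1) y ^ 2 ≤
        ((n : ℝ) + 3 / 2 - y ^ 2 / 4) * hermiteFn (n + 1) y ^ 2 :=
      mul_le_mul_of_nonneg_right (by linarith) (sq_nonneg _)
    nlinarith [sq_nonneg (hermiteV n |y|), Real.exp_pos (y ^ 2 / 2)]

/-- The growth He_{n+1} ≥ √m He_n reproduces itself in the recurrence: (n+1) He_n ≤ m He_n ≤ √m
He_{n+1}, so y He_{n+1} − (n+1) He_n ≥ (2√m − √m) He_{n+1}. Hence no zero of He_m lies beyond 2√m.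
-/
theorem he_pos_of_le {m : ℕ} (hm : 0 < m) {y : ℝ} (hy : 2 * √(m : ℝ) ≤ y) (n : ℕ) (hn : n ≤ m) :
    0 < he n y ∧ (n < m → √(m : ℝ) * he n y ≤ he (n + 1) y) := by
  have h0 : 0 < √(m : ℝ) := Real.sqrt_pos.2 (by exact_mod_cast hm)
  have h2 : √(m : ℝ) ^ 2 = m := Real.sq_sqrt (Nat.cast_nonneg _)
  induction n with
  | zero => simp; intro _; linarith
  | succ n ih =>
    obtain ⟨h3, h4⟩ := ih (by omega)
    have h4 := h4 (by omega)
    have h5 : 0 < he (n + 1) y := (mul_pos h0 h3).trans_le h4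
    refine ⟨h5, fun h => ?_⟩
    have h6 : (n : ℝ) + 1 ≤ m := by exact_mod_cast hn
    rw [he_succ_succ]
    have h7 : ((n : ℝ) + 1) * he n y ≤ √(m : ℝ) * he (n + 1) y := by
      calc ((n : ℝ) + 1) * he n y ≤ m * he n y := by gcongr
        _ = √(m : ℝ) * (√(m : ℝ) * he n y) := by rw [← mul_assoc, ← sq, h2]
        _ ≤ _ := by gcongr
    nlinarith

theorem sq_lt_of_mem_nodes {l : ℕ} {y : ℝ} (hy : y ∈ nodes l) :
    y ^ 2 < 4 * ((l : ℝ) + 1) := by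
  by_contra! h
  have h1 : 2 * √((l + 1 : ℕ) : ℝ) ≤ |y| := by
    rw [← Real.sqrt_sq_eq_abs]
    apply Real.le_sqrt_of_sq_le
    rw [mul_pow, Real.sq_sqrt (Nat.cast_nonneg _)]
    push_cast
    linarith
  have h2 := (he_pos_of_le (Nat.succ_pos l) h1 (l + 1) le_rfl).1
  have h3 := hermiteFn_abs_sq (l + 1) y
  rw [hermiteFn_eq_zero_of_mem_nodes hy, hermiteFn_eq] at h3
  have h4 : he (l + 1) |y| / √((l + 1).factorial : ℝ) = 0 := by simpa using h3
  rw [div_eq_zero_iff] at h4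
  rcases h4 with h4 | h4
  · exact h2.ne' h4
  · exact sqrt_factorial_ne_zero _ h4

/-- At a node H_{l+1} vanishes, so V² = (l+1) H_l(y)² is the inverse weight. The increasing energy
there is V²/φ times e^{-y²/2}, with φ ≥ 1/2 by the location of the nodes, and it is at least its
value at 0, which exceeds (2/3)/(l+1). -/
theorem weight_le {l : ℕ} {y : ℝ} (hy : y ∈ nodes l) :
    weight l y ≤ 3 * ((l : ℝ) + 1) * Real.exp (-(y ^ 2 / 2)) := by
  have hlt := sq_lt_of_mem_nodes hy
  have hmem : |y| ∈ Set.Ico 0 (2 * √((l : ℝ) + 3 / 2)) := by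
    refine ⟨abs_nonneg y, ?_⟩
    have : |y| < √(4 * ((l : ℝ) + 3 / 2)) := by
      rw [← Real.sqrt_sq_eq_abs]
      exact Real.sqrt_lt_sqrt (sq_nonneg y) (by linarith)
    rwa [Real.sqrt_mul (by norm_num), show (4 : ℝ) = 2 ^ 2 by norm_num,
      Real.sqrt_sq (by norm_num)] at this
  have h := monotoneOn_energy l (a := 0) (b := |y|) ⟨le_rfl, by positivity⟩ hmem (abs_nonneg y)
  have hV : hermiteV l |y| ^ 2 = ((l : ℝ) + 1) * hermiteFn l y ^ 2 := by
    have h0 : hermiteFn (l + 1) |y| = 0 := by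
      have := hermiteFn_abs_sq (l + 1) y
      rw [hermiteFn_eq_zero_of_mem_nodes hy] at this
      simpa using this
    rw [hermiteV, h0, mul_zero, sub_zero, mul_pow, hermiteFn_abs_sq, Real.sq_sqrt (by positivity)]
  have hV0 : hermiteV l 0 ^ 2 = ((l : ℝ) + 1) * hermiteFn l 0 ^ 2 := by
    simp only [hermiteV, zero_div, zero_mul, sub_zero, mul_pow]
    rw [Real.sq_sqrt (by positivity)]
  simp only [sq_abs, hermiteFn_abs_sq, hV, hV0, hermiteFn_eq_zero_of_mem_nodes hy] at h
  have h1 := one_le_mul_hermiteFn_zero_sq_add l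
  have hl : (0 : ℝ) ≤ l := Nat.cast_nonneg l
  have h2 : 2 / 3 / ((l : ℝ) + 1) ≤ (((l : ℝ) + 1) * hermiteFn l 0 ^ 2 /
      ((l : ℝ) + 3 / 2 - 0 ^ 2 / 4) + hermiteFn (l + 1) 0 ^ 2) * Real.exp (-(0 ^ 2 / 2)) := by
    have e1 : 2 / 3 * hermiteFn l 0 ^ 2 ≤ ((l : ℝ) + 1) * hermiteFn l 0 ^ 2 /
        ((l : ℝ) + 3 / 2 - 0 ^ 2 / 4) := by
      rw [le_div_iff₀ (by norm_num; positivity)]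
      nlinarith [sq_nonneg (hermiteFn l 0)]
    rw [div_le_iff₀ (by positivity)]
    simp only [ne_eq, OfNat.ofNat_ne_zero, not_false_eq_true, zero_pow, zero_div, neg_zero,
      Real.exp_zero, mul_one] at e1 ⊢
    nlinarith [sq_nonneg (hermiteFn (l + 1) 0)]
  have h3 := h2.trans h
  set X := ((l : ℝ) + 1) * hermiteFn l y ^ 2 with hX
  have h4 : 2 / 3 / ((l : ℝ) + 1) ≤ X * 2 * Real.exp (-(y ^ 2 / 2)) := by
    refine h3.trans ?_
    have hXn : 0 ≤ X := by positivity
    simp only [ne_eq, OfNat.ofNat_ne_zero, not_false_eq_true, zero_pow, add_zero]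
    gcongr
    rw [div_le_iff₀ (by linarith)]
    nlinarith
  have hXpos : 0 < X := by
    have := hermiteFn_ne_zero_of_mem_nodes hy
    positivity
  rw [weight, ← hX, div_le_iff₀ hXpos]
  rw [div_le_iff₀ (by positivity)] at h4
  linarith

/-! ### Action of the quadrature rules on Hermite polynomials -/

theorem linearCombination_quad (l : ℕ) (g : ℝ → ℝ) :
    Finsupp.linearCombination ℝ g (quad l) = ∑ y ∈ nodes l, weight l y * g y := by
  simp [quad, map_sum]

theorem quad_hermiteFn {l n : ℕ} (h : n ≤ l) :
    Finsupp.linearCombination ℝ (hermiteFn n) (quad l) = if n = 0 then 1 else 0 := by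
  rw [linearCombination_quad, ← sum_weight_hermiteFn_mul l h (Nat.zero_le l)]
  simp

/-- For n ≤ l the rule is exact and gives 0. For n > l all nodes satisfy y² < 4n, so the exponential
factors in the bounds for the weight and for H_n² cancel. Cauchy–Schwarz with weights of total mass
1 finishes. -/
theorem abs_quad_hermiteFn_le (l n : ℕ) (hn : n ≠ 0) :
    |Finsupp.linearCombination ℝ (hermiteFn n) (quad l)| ≤ 4 * (n : ℝ) ^ 2 := by
  rcases le_or_gt n l with h | h
  · rw [quad_hermiteFn h, if_neg hn, abs_zero]
    positivity
  rw [linearCombination_quad]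
  have hl : (l : ℝ) + 1 ≤ n := by exact_mod_cast h
  have hn1 : (1 : ℝ) ≤ n := by exact_mod_cast Nat.one_le_iff_ne_zero.2 hn
  have h1 : ∑ y ∈ nodes l, weight l y = 1 := by
    simpa using sum_weight_hermiteFn_mul l (Nat.zero_le l) (Nat.zero_le l)
  have hterm : ∀ y ∈ nodes l, weight l y * hermiteFn n y ^ 2 ≤ 15 * (n : ℝ) ^ 2 := by
    intro y hy
    have hy2 := sq_lt_of_mem_nodes hy
    calc weight l y * hermiteFn n y ^ 2
        ≤ (3 * ((l : ℝ) + 1) * Real.exp (-(y ^ 2 / 2))) *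
            ((4 * n + 1) * Real.exp (y ^ 2 / 2)) := by
          have := weight_le hy
          have := hermiteFn_sq_le n (y := y) (by linarith)
          gcongr
      _ = 3 * ((l : ℝ) + 1) * (4 * n + 1) := by
          rw [Real.exp_neg]
          field_simp
      _ ≤ 15 * (n : ℝ) ^ 2 := by nlinarith
  have hsum : ∑ y ∈ nodes l, weight l y * hermiteFn n y ^ 2 ≤ 15 * (n : ℝ) ^ 3 := by
    calc _ ≤ ∑ y ∈ nodes l, 15 * (n : ℝ) ^ 2 := Finset.sum_le_sum hterm
      _ = ((l : ℝ) + 1) * (15 * (n : ℝ) ^ 2) := by simp [card_nodes]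
      _ ≤ n * (15 * (n : ℝ) ^ 2) := by gcongr
      _ = _ := by ring
  have hcs : (∑ y ∈ nodes l, weight l y * hermiteFn n y) ^ 2 ≤
      (∑ y ∈ nodes l, weight l y) * ∑ y ∈ nodes l, weight l y * hermiteFn n y ^ 2 := by
    apply Finset.sum_sq_le_sum_mul_sum_of_sq_le_mul
    · exact fun y hy => (weight_pos hy).le
    · exact fun y hy => mul_nonneg (weight_pos hy).le (sq_nonneg _)
    · intro y _; exact le_of_eq (by ring)
  rw [h1, one_mul] at hcs
  apply abs_le_of_sq_le_sq _ (by positivity)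
  refine (hcs.trans hsum).trans ?_
  have : (n : ℝ) ^ 3 ≤ (n : ℝ) ^ 4 := pow_le_pow_right₀ hn1 (by norm_num)
  nlinarith [pow_nonneg (zero_le_one.trans hn1) 3]

theorem diffQuad_hermiteFn_of_lt {l n : ℕ} (h : n < l) :
    Finsupp.linearCombination ℝ (hermiteFn n) (diffQuad l) = 0 := by
  cases l with
  | zero => omega
  | succ l =>
    rw [diffQuad, map_sub, quad_hermiteFn (by omega), quad_hermiteFn (by omega), sub_self]

theorem sum_diffQuad (l : ℕ) : ∑ k ∈ Finset.range (l + 1), diffQuad k = quad l := by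
  induction l with
  | zero => simp [diffQuad]
  | succ l ih => rw [Finset.sum_range_succ, ih, diffQuad, add_sub_cancel]

theorem sum_diffQuad_hermiteFn (n : ℕ) :
    ∑ l ∈ Finset.range (n + 1), Finsupp.linearCombination ℝ (hermiteFn n) (diffQuad l) =
      if n = 0 then 1 else 0 := by
  rw [← map_sum, sum_diffQuad, quad_hermiteFn le_rfl]

theorem nodes_zero : nodes 0 = {0} := by
  ext y; simp [mem_nodes]

theorem diffQuad_zero : diffQuad 0 = Finsupp.single 0 1 := by
  simp [diffQuad, quad, nodes_zero, weight]

/-- Each difference is at most 2 · 4n², and there are n + 1 ≤ 2n levels. Levels above n contribute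
nothing by exactness, so this is the full sum over levels. -/
theorem sum_abs_diffQuad_hermiteFn_le (n : ℕ) (hn : n ≠ 0) :
    ∑ l ∈ Finset.range (n + 1), |Finsupp.linearCombination ℝ (hermiteFn n) (diffQuad l)| ≤
      16 * (n : ℝ) ^ 3 := by
  have hn1 : (1 : ℝ) ≤ n := by exact_mod_cast Nat.one_le_iff_ne_zero.2 hn
  have h : ∀ l ∈ Finset.range (n + 1),
      |Finsupp.linearCombination ℝ (hermiteFn n) (diffQuad l)| ≤ 8 * (n : ℝ) ^ 2 := by
    intro l _
    cases l with
    | zero => 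
      have := abs_quad_hermiteFn_le 0 n hn
      rw [diffQuad]
      nlinarith
    | succ l =>
      rw [diffQuad, map_sub]
      have h1 := abs_quad_hermiteFn_le l n hn
      have h2 := abs_quad_hermiteFn_le (l + 1) n hn
      exact (abs_sub _ _).trans (by linarith)
  refine (Finset.sum_le_sum h).trans ?_
  simp only [Finset.sum_const, Finset.card_range, nsmul_eq_mul]
  push_cast
  nlinarith [pow_nonneg (zero_le_one.trans hn1) 2]

/-- Locally uniform bound for Hermite polynomials. -/
theorem exists_hermiteFn_sq_le (Y : ℝ) :
    ∃ K : ℝ, 1 ≤ K ∧ ∀ n : ℕ, ∀ y : ℝ, |y| ≤ Y → hermiteFn n y ^ 2 ≤ K * ((n : ℝ) + 1) := by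
  have h1 : ∀ n : ℕ, ∃ k : ℝ, 0 ≤ k ∧ ∀ y : ℝ, |y| ≤ Y → hermiteFn n y ^ 2 ≤ k := by
    intro n
    obtain ⟨k, hk⟩ := (isCompact_Icc (a := -Y) (b := Y)).exists_bound_of_continuousOn
      ((continuous_hermiteFn n).pow 2).continuousOn
    refine ⟨max k 0, le_max_right _ _, fun y hy => ?_⟩
    have := hk y (abs_le.1 hy)
    exact (le_abs_self _).trans (this.trans (le_max_left _ _))
  choose k hk0 hk using h1
  -- From this degree on the energy bound applies on the whole interval; the finitely many smaller
  -- degrees are handled by compactness.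
  set n₀ := ⌈Y ^ 2 / 4⌉₊
  have hnn : 0 ≤ ∑ i ∈ Finset.range n₀, k i := Finset.sum_nonneg fun i _ => hk0 i
  have he : 0 < Real.exp (Y ^ 2 / 2) := Real.exp_pos _
  refine ⟨1 + 4 * Real.exp (Y ^ 2 / 2) + ∑ i ∈ Finset.range n₀, k i, by linarith, ?_⟩
  intro n y hy
  have hn : (0 : ℝ) ≤ n := Nat.cast_nonneg n
  have hy2 : y ^ 2 ≤ Y ^ 2 := by
    rw [← sq_abs y]; gcongr
  rcases lt_or_ge n n₀ with h | h
  · have := Finset.single_le_sum (f := k) (fun i _ => hk0 i) (Finset.mem_range.2 h)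
    have := hk n y hy
    nlinarith
  · have h2 := hermiteFn_sq_le n (y := y) (by
      have := Nat.ceil_le.1 h
      linarith)
    have h3 : Real.exp (y ^ 2 / 2) ≤ Real.exp (Y ^ 2 / 2) := by gcongr
    have : (4 * (n : ℝ) + 1) * Real.exp (y ^ 2 / 2) ≤ (4 * n + 4) * Real.exp (Y ^ 2 / 2) := by
      gcongr; norm_num
    nlinarith

end SparseQuad
namespace SparseQuad

open Polynomial

/-! ### The Gaussian measure on the line -/

theorem integrable_polynomial (P : ℝ[X]) :
    Integrable (fun y => P.eval y) (gaussianReal 0 1) := by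
  induction P using Polynomial.induction_on' with
  | add p q hp hq => simpa using! hp.add hq
  | monomial n a =>
    simp only [eval_monomial]
    refine Integrable.const_mul ?_ a
    exact integrable_pow_of_mem_interior_integrableExpSet (X := id)
      (by simp [integrableExpSet_id_gaussianReal]) n

theorem memLp_polynomial (P : ℝ[X]) :
    MemLp (fun y => P.eval y) 2 (gaussianReal 0 1) := by
  rw [memLp_two_iff_integrable_sq (integrable_polynomial P).aestronglyMeasurable]
  exact (integrable_polynomial (P ^ 2)).congr (Filter.Eventually.of_forall fun y => eval_pow 2)

theorem gaussianPDFReal_zero_one (y : ℝ) :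
    gaussianPDFReal 0 1 y = (√(2 * Real.pi))⁻¹ * Real.exp (-(y ^ 2 / 2)) := by
  simp [gaussianPDFReal, neg_div]

/-- Integration by parts for polynomials with respect to the Gaussian measure. -/
theorem integral_mul_sub_derivative (P : ℝ[X]) :
    ∫ y, (y * P.eval y - (derivative P).eval y) ∂(gaussianReal 0 1) = 0 := by
  have hint : ∀ Q : ℝ[X], Integrable (fun y => gaussianPDFReal 0 1 y • Q.eval y) := by
    intro Q
    have h := integrable_polynomial Q
    rw [gaussianReal_of_var_ne_zero 0 one_ne_zero,
      integrable_withDensity_iff_integrable_smul' (measurable_gaussianPDF 0 1)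
        (Filter.Eventually.of_forall fun _ => gaussianPDF_lt_top)] at h
    simpa [toReal_gaussianPDF] using h
  rw [integral_gaussianReal_eq_integral_smul one_ne_zero]
  have hd : ∀ y : ℝ, HasDerivAt (fun y => -(gaussianPDFReal 0 1 y • P.eval y))
      (gaussianPDFReal 0 1 y • (y * P.eval y - (derivative P).eval y)) y := by
    intro y
    simp only [gaussianPDFReal_zero_one, smul_eq_mul]
    have h := (((hasDerivAt_exp_neg_sq_div_two y).const_mul (√(2 * Real.pi))⁻¹).mul
      (P.hasDerivAt y)).neg
    refine h.congr_deriv ?_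
    ring
  refine integral_eq_zero_of_hasDerivAt_of_integrable hd ?_ (hint P).neg
  have := hint (X * P - derivative P)
  simpa using this

/-- The polynomial underlying `hermiteFn`. -/
noncomputable def hermitePoly (n : ℕ) : ℝ[X] :=
  C (√(n.factorial : ℝ))⁻¹ * (hermite n).map (Int.castRingHom ℝ)

theorem eval_hermitePoly (n : ℕ) (y : ℝ) : (hermitePoly n).eval y = hermiteFn n y := by
  rw [hermitePoly, eval_mul, eval_C, hermiteFn, aeval_def, eval₂_eq_eval_map, div_eq_inv_mul]
  rfl

theorem memLp_hermiteFn (n : ℕ) : MemLp (hermiteFn n) 2 (gaussianReal 0 1) := by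
  simpa only [eval_hermitePoly] using memLp_polynomial (hermitePoly n)

theorem eval_derivative_hermitePoly_succ (n : ℕ) (y : ℝ) :
    (derivative (hermitePoly (n + 1))).eval y = √((n : ℝ) + 1) * hermiteFn n y := by
  have h := (hermitePoly (n + 1)).hasDerivAt y
  simp only [eval_hermitePoly] at h
  exact h.unique (hasDerivAt_hermiteFn_succ n y)

theorem derivative_hermitePoly_zero : derivative (hermitePoly 0) = 0 := by
  simp [hermitePoly, hermite_zero]

theorem mul_hermiteFn_sub (n : ℕ) (y : ℝ) :
    y * hermiteFn n y - (derivative (hermitePoly n)).eval y =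
      √((n : ℝ) + 1) * hermiteFn (n + 1) y := by
  cases n with
  | zero => simp [derivative_hermitePoly_zero]
  | succ n =>
    rw [eval_derivative_hermitePoly_succ, ← hermiteFn_succ_succ]
    push_cast
    ring_nf

/-- The raising operator y − d/dy, which sends H_n to √(n+1) H_{n+1}, is adjoint to differentiation.
Taking Q to be a Hermite polynomial lowers both indices at once, which proves orthonormality by
induction. -/
theorem sqrt_mul_integral_hermiteFn_succ_mul (n : ℕ) (Q : ℝ[X]) :
    √((n : ℝ) + 1) * ∫ y, hermiteFn (n + 1) y * Q.eval y ∂(gaussianReal 0 1) =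
      ∫ y, hermiteFn n y * (derivative Q).eval y ∂(gaussianReal 0 1) := by
  have h := integral_mul_sub_derivative (hermitePoly n * Q)
  have e : ∀ y : ℝ, y * (hermitePoly n * Q).eval y - (derivative (hermitePoly n * Q)).eval y =
      √((n : ℝ) + 1) * (hermiteFn (n + 1) y * Q.eval y) -
        hermiteFn n y * (derivative Q).eval y := by
    intro y
    rw [derivative_mul, eval_add, eval_mul, eval_mul, eval_mul, eval_hermitePoly]
    linear_combination Q.eval y * mul_hermiteFn_sub n y
  simp only [e] at h
  rw [integral_sub, integral_const_mul, sub_eq_zero] at h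
  · exact h
  · refine Integrable.const_mul ?_ _
    simpa [eval_hermitePoly] using integrable_polynomial (hermitePoly (n + 1) * Q)
  · simpa [eval_hermitePoly] using integrable_polynomial (hermitePoly n * derivative Q)

/-- Orthonormality of the Hermite polynomials. -/
theorem integral_hermiteFn_mul (n m : ℕ) :
    ∫ y, hermiteFn n y * hermiteFn m y ∂(gaussianReal 0 1) = if n = m then 1 else 0 := by
  have hz : ∀ n : ℕ, ∫ y, hermiteFn (n + 1) y * hermiteFn 0 y ∂(gaussianReal 0 1) = 0 := by
    intro n
    have h := sqrt_mul_integral_hermiteFn_succ_mul n (hermitePoly 0)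
    rw [derivative_hermitePoly_zero] at h
    simp only [eval_hermitePoly, eval_zero, mul_zero, integral_zero, mul_eq_zero] at h
    exact h.resolve_left (Real.sqrt_ne_zero'.2 (by positivity))
  induction n generalizing m with
  | zero =>
    cases m with
    | zero => simp
    | succ m =>
      simpa [mul_comm] using hz m
  | succ n ih =>
    cases m with
    | zero => simpa using hz n
    | succ m =>
      have h := sqrt_mul_integral_hermiteFn_succ_mul n (hermitePoly (m + 1))
      simp only [eval_hermitePoly, eval_derivative_hermitePoly_succ] at h
      have e : ∀ y, hermiteFn n y * (√((m : ℝ) + 1) * hermiteFn m y) =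
        √((m : ℝ) + 1) * (hermiteFn n y * hermiteFn m y) := fun y => by ring
      simp only [e] at h
      rw [integral_const_mul, ih m] at h
      have h0 : √((n : ℝ) + 1) ≠ 0 := Real.sqrt_ne_zero'.2 (by positivity)
      by_cases hnm : n = m
      · subst hnm
        simpa [h0] using h
      · simpa [hnm, h0] using h

/-! ### Determinacy of moments -/

section Moments

variable {Ω : Type*} [MeasurableSpace Ω] {P : Measure Ω}

/-- Two finite measures under which `X` has all exponential moments and the same moments
give the same law to `X`. -/
theorem map_eq_map_of_moments {μ ν : Measure Ω} [IsFiniteMeasure μ] [IsFiniteMeasure ν]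
    {X : Ω → ℝ} (hX : Measurable X)
    (hμ : ∀ t, Integrable (fun ω => Real.exp (t * X ω)) μ)
    (hν : ∀ t, Integrable (fun ω => Real.exp (t * X ω)) ν)
    (hmom : ∀ n : ℕ, ∫ ω, X ω ^ n ∂μ = ∫ ω, X ω ^ n ∂ν) : μ.map X = ν.map X := by
  have hμu : integrableExpSet X μ = Set.univ := Set.eq_univ_of_forall hμ
  have hνu : integrableExpSet X ν = Set.univ := Set.eq_univ_of_forall hν
  have h1 := analyticOnNhd_mgf (X := X) (μ := μ)
  have h2 := analyticOnNhd_mgf (X := X) (μ := ν)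
  rw [hμu, interior_univ] at h1
  rw [hνu, interior_univ] at h2
  have p1 := hasFPowerSeriesAt_mgf (X := X) (μ := μ) (v := 0) (by simp [hμu])
  have p2 := hasFPowerSeriesAt_mgf (X := X) (μ := ν) (v := 0) (by simp [hνu])
  -- Both moment generating functions are analytic on all of ℝ and have the same Taylor coefficients
  -- at 0, so they agree everywhere. Their complex extensions then agree and determine the law.
  have hmgf : mgf X μ = mgf X ν := by
    refine h1.eq_of_eventuallyEq h2 (z₀ := 0) ?_
    simp only [zero_mul, Real.exp_zero, mul_one, hmom] at p1 p2
    filter_upwards [p1.eventually_hasSum_sub, p2.eventually_hasSum_sub] with t ht1 ht2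
    exact ht1.unique ht2
  have h0 : μ = 0 ↔ ν = 0 := by
    have := hmom 0
    simp only [pow_zero, integral_const, smul_eq_mul, mul_one, measureReal_def] at this
    rw [ENNReal.toReal_eq_toReal_iff' (measure_ne_top _ _) (measure_ne_top _ _)] at this
    rw [← Measure.measure_univ_eq_zero, ← Measure.measure_univ_eq_zero, this]
  have h3 := eqOn_complexMGF_of_mgf' hmgf h0
  rw [hμu, interior_univ] at h3
  exact Measure.ext_of_complexMGF_eq hX.aemeasurable hX.aemeasurable
    (funext fun z => h3 (Set.mem_univ _))

theorem integral_withDensity_ofReal {g h : Ω → ℝ} (hg : Integrable g P) :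
    ∫ ω, h ω ∂(P.withDensity fun ω => ENNReal.ofReal (g ω)) = ∫ ω, max (g ω) 0 * h ω ∂P := by
  rw [integral_withDensity_eq_integral_toReal_smul₀ hg.aemeasurable.ennreal_ofReal
    (Filter.Eventually.of_forall fun _ => ENNReal.ofReal_lt_top)]
  simp [ENNReal.toReal_ofReal']

/-- If `g` is orthogonal to all powers of `X`, it is orthogonal to all functions of `X`. -/
theorem integral_indicator_mul_eq_zero {X g : Ω → ℝ} (hX : Measurable X)
    (hg : Integrable g P) (hexp : ∀ t, Integrable (fun ω => Real.exp (t * X ω) * g ω) P)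
    (hmom : ∀ n : ℕ, ∫ ω, X ω ^ n * g ω ∂P = 0) {A : Set ℝ} (hA : MeasurableSet A) :
    ∫ ω, A.indicator 1 (X ω) * g ω ∂P = 0 := by
  have hpos : ∀ {f : Ω → ℝ}, Measurable f → Integrable (fun ω => f ω * g ω) P →
      ∀ c : ℝ, |c| = 1 → Integrable (fun ω => max (c * g ω) 0 * f ω) P := by
    intro f hf h c hc
    refine h.mono (((hg.const_mul c).aestronglyMeasurable.sup
      aestronglyMeasurable_const).mul hf.aestronglyMeasurable)
      (Filter.Eventually.of_forall fun ω => ?_)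
    rw [norm_mul, norm_mul, mul_comm]
    gcongr
    rw [Real.norm_eq_abs, Real.norm_eq_abs, abs_of_nonneg (le_max_right _ _)]
    have : |c * g ω| = |g ω| := by rw [abs_mul, hc, one_mul]
    rw [← this]
    exact max_le (le_abs_self _) (abs_nonneg _)
  -- The signed measure g P is split into the finite positive measures g⁺ P and g⁻ P. Vanishing
  -- moments of g mean that these two have the same moments of X.
  have key : ∀ {f : Ω → ℝ}, Measurable f → Integrable (fun ω => f ω * g ω) P →
      ∫ ω, f ω * g ω ∂P = ∫ ω, f ω ∂(P.withDensity fun ω => ENNReal.ofReal (g ω)) -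
        ∫ ω, f ω ∂(P.withDensity fun ω => ENNReal.ofReal (-g ω)) := by
    intro f hf h
    rw [integral_withDensity_ofReal hg, integral_withDensity_ofReal (g := fun ω => -g ω) hg.neg,
      ← integral_sub]
    · congr 1 with ω
      rw [← sub_mul, mul_comm, max_zero_sub_eq_self]
    · simpa using hpos hf h 1 (by simp)
    · simpa using hpos hf h (-1) (by simp)
  have hi : ∀ (f : Ω → ℝ), Measurable f → Integrable (fun ω => f ω * g ω) P → ∀ c : ℝ, |c| = 1 →
      Integrable f (P.withDensity fun ω => ENNReal.ofReal (c * g ω)) := by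
    intro f hf h c hc
    rw [integrable_withDensity_iff_integrable_smul₀' (hg.const_mul c).aemeasurable.ennreal_ofReal
      (Filter.Eventually.of_forall fun _ => ENNReal.ofReal_lt_top)]
    simpa [ENNReal.toReal_ofReal'] using hpos hf h c hc
  have hm : ∀ t, Measurable fun ω => Real.exp (t * X ω) := fun t => by fun_prop
  have f1 : IsFiniteMeasure (P.withDensity fun ω => ENNReal.ofReal (g ω)) :=
    isFiniteMeasure_withDensity_ofReal hg.2
  have f2 : IsFiniteMeasure (P.withDensity fun ω => ENNReal.ofReal (-g ω)) :=
    isFiniteMeasure_withDensity_ofReal hg.neg.2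
  have i1 : ∀ t, Integrable (fun ω => Real.exp (t * X ω))
      (P.withDensity fun ω => ENNReal.ofReal (g ω)) := fun t => by
    simpa using hi _ (hm t) (hexp t) 1 (by simp)
  have i2 : ∀ t, Integrable (fun ω => Real.exp (t * X ω))
      (P.withDensity fun ω => ENNReal.ofReal (-g ω)) := fun t => by
    simpa using hi _ (hm t) (hexp t) (-1) (by simp)
  have hpow : ∀ n : ℕ, Integrable (fun ω => X ω ^ n * g ω) P := by
    intro n
    have u1 : integrableExpSet X (P.withDensity fun ω => ENNReal.ofReal (g ω)) = Set.univ :=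
      Set.eq_univ_of_forall i1
    have u2 : integrableExpSet X (P.withDensity fun ω => ENNReal.ofReal (-g ω)) = Set.univ :=
      Set.eq_univ_of_forall i2
    have j1 := integrable_pow_of_mem_interior_integrableExpSet
      (show (0 : ℝ) ∈ interior (integrableExpSet X _) by rw [u1]; simp) n
    have j2 := integrable_pow_of_mem_interior_integrableExpSet
      (show (0 : ℝ) ∈ interior (integrableExpSet X _) by rw [u2]; simp) n
    rw [integrable_withDensity_iff_integrable_smul₀' hg.aemeasurable.ennreal_ofReal
      (Filter.Eventually.of_forall fun _ => ENNReal.ofReal_lt_top)] at j1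
    rw [integrable_withDensity_iff_integrable_smul₀'
      (f := fun ω => ENNReal.ofReal (-g ω)) hg.neg.aemeasurable.ennreal_ofReal
      (Filter.Eventually.of_forall fun _ => ENNReal.ofReal_lt_top)] at j2
    refine (j1.sub j2).congr (Filter.Eventually.of_forall fun ω => ?_)
    change (ENNReal.ofReal (g ω)).toReal * X ω ^ n - (ENNReal.ofReal (-g ω)).toReal * X ω ^ n =
      X ω ^ n * g ω
    rw [ENNReal.toReal_ofReal', ENNReal.toReal_ofReal']
    rw [← sub_mul, mul_comm, max_zero_sub_eq_self]
  have hmap := map_eq_map_of_moments hX i1 i2 fun n => by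
    have := key (hX.pow_const n) (hpow n)
    rw [hmom n] at this
    linarith
  have hAm : Measurable (A.indicator (1 : ℝ → ℝ)) := measurable_one.indicator hA
  rw [key (f := fun ω => A.indicator 1 (X ω)) (hAm.comp hX) ?_]
  · rw [← integral_map hX.aemeasurable hAm.aestronglyMeasurable, hmap,
      integral_map hX.aemeasurable hAm.aestronglyMeasurable, sub_self]
  · refine hg.mono (((hAm.comp hX).aestronglyMeasurable).mul hg.aestronglyMeasurable)
      (Filter.Eventually.of_forall fun ω => ?_)
    rw [norm_mul]
    refine mul_le_of_le_one_left (norm_nonneg _) ?_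
    by_cases h : X ω ∈ A <;> simp [h]

end Moments

end SparseQuad
namespace SparseQuad

open Filter Topology

section ProductMeasure

variable {ι : Type*} {S : Type*} [NormedAddCommGroup S] [NormedSpace ℝ S]

instance : IsProbabilityMeasure (gauss ι) := by
  unfold gauss; infer_instance

/-! ### Products of functions of one coordinate -/

theorem measurePreserving_restrict_gauss (J : Finset ι) :
    MeasurePreserving J.restrict (gauss ι) (Measure.pi fun _ : J => gaussianReal 0 1) :=
  ⟨Finset.measurable_restrict J, Measure.infinitePi_map_restrict _⟩

theorem integrable_prod_gauss (J : Finset ι) {u : ι → ℝ → ℝ}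
    (hu : ∀ j, Integrable (u j) (gaussianReal 0 1)) :
    Integrable (fun y : ι → ℝ => ∏ j ∈ J, u j (y j)) (gauss ι) := by
  have h := Integrable.fintype_prod (ι := J) (f := fun j => u j)
    (μ := fun _ => gaussianReal 0 1) (fun j => hu j)
  have h2 := (measurePreserving_restrict_gauss J).integrable_comp_of_integrable h
  refine h2.congr (Eventually.of_forall fun y => ?_)
  exact Finset.prod_coe_sort J fun j => u j (y j)

theorem integral_prod_gauss (J : Finset ι) {u : ι → ℝ → ℝ}
    (hu : ∀ j, Integrable (u j) (gaussianReal 0 1)) :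
    ∫ y, ∏ j ∈ J, u j (y j) ∂(gauss ι) = ∏ j ∈ J, ∫ t, u j t ∂(gaussianReal 0 1) := by
  have h := Integrable.fintype_prod (ι := J) (f := fun j => u j)
    (μ := fun _ => gaussianReal 0 1) (fun j => hu j)
  have h2 := integral_restrict_infinitePi (μ := fun _ : ι => gaussianReal 0 1)
    h.aestronglyMeasurable
  rw [integral_fintype_prod_eq_prod,
    Finset.prod_coe_sort J fun j => ∫ t, u j t ∂(gaussianReal 0 1)] at h2
  rw [← h2]
  refine integral_congr_ae (Eventually.of_forall fun y => ?_)
  exact (Finset.prod_coe_sort J fun j => u j (y j)).symm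

theorem memLp_prod_gauss (J : Finset ι) {u : ι → ℝ → ℝ}
    (hu : ∀ j, MemLp (u j) 2 (gaussianReal 0 1)) :
    MemLp (fun y : ι → ℝ => ∏ j ∈ J, u j (y j)) 2 (gauss ι) := by
  have h1 := integrable_prod_gauss J fun j => (hu j).integrable one_le_two
  rw [memLp_two_iff_integrable_sq h1.aestronglyMeasurable]
  simp_rw [← Finset.prod_pow]
  exact integrable_prod_gauss J (u := fun j t => u j t ^ 2) fun j => (hu j).integrable_sq

/-- The tensor product Hermite polynomial `H_ν`. -/
noncomputable def hermiteProd (ν : ι →₀ ℕ) (y : ι → ℝ) : ℝ :=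
  ∏ j ∈ ν.support, hermiteFn (ν j) (y j)

theorem hermiteProd_eq {ν : ι →₀ ℕ} {J : Finset ι} (hJ : ν.support ⊆ J) (y : ι → ℝ) :
    hermiteProd ν y = ∏ j ∈ J, hermiteFn (ν j) (y j) := by
  refine Finset.prod_subset hJ fun j _ hj => ?_
  rw [Finsupp.notMem_support_iff.1 hj, hermiteFn_zero]

@[simp] theorem hermiteProd_zero (y : ι → ℝ) : hermiteProd 0 y = 1 := by simp [hermiteProd]

theorem memLp_hermiteProd (ν : ι →₀ ℕ) : MemLp (hermiteProd ν) 2 (gauss ι) :=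
  memLp_prod_gauss ν.support fun j => memLp_hermiteFn (ν j)

theorem integral_hermiteProd_mul (ν μ : ι →₀ ℕ) [Decidable (ν = μ)] :
    ∫ y, hermiteProd ν y * hermiteProd μ y ∂(gauss ι) = if ν = μ then 1 else 0 := by
  classical
  have h1 : ν.support ⊆ ν.support ∪ μ.support := Finset.subset_union_left
  have h2 : μ.support ⊆ ν.support ∪ μ.support := Finset.subset_union_right
  simp_rw [hermiteProd_eq h1, hermiteProd_eq h2, ← Finset.prod_mul_distrib]
  rw [integral_prod_gauss _ (u := fun j t => hermiteFn (ν j) t * hermiteFn (μ j) t)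
    fun j => (memLp_hermiteFn (ν j)).integrable_mul (memLp_hermiteFn (μ j))]
  simp_rw [integral_hermiteFn_mul]
  split_ifs with h
  · simp [h]
  · rw [Finset.prod_eq_zero_iff]
    obtain ⟨j, hj⟩ := DFunLike.ne_iff.1 h
    refine ⟨j, ?_, if_neg hj⟩
    rw [Finset.mem_union, Finsupp.mem_support_iff, Finsupp.mem_support_iff]
    by_contra! h'
    exact hj (h'.1.trans h'.2.symm)

theorem integrable_smul_of_memLp {u : (ι → ℝ) → ℝ} {h : (ι → ℝ) → S} (hu : MemLp u 2 (gauss ι))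
    (hh : MemLp h 2 (gauss ι)) : Integrable (fun y => u y • h y) (gauss ι) :=
  memLp_one_iff_integrable.1 (hh.smul (p := 2) (q := 2) (r := 1) hu)

/-! ### Integration by parts against Hermite polynomials -/

theorem mul_hermiteFn_sub_deriv (n : ℕ) (t : ℝ) :
    t * hermiteFn n t - deriv (hermiteFn n) t = √((n : ℝ) + 1) * hermiteFn (n + 1) t := by
  rw [← mul_hermiteFn_sub, ← Polynomial.deriv]
  simp [eval_hermitePoly]

theorem memLp_deriv_hermiteFn (n : ℕ) : MemLp (deriv (hermiteFn n)) 2 (gaussianReal 0 1) := by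
  have : deriv (hermiteFn n) = fun t => (Polynomial.derivative (hermitePoly n)).eval t := by
    ext t
    rw [← Polynomial.deriv]
    simp [eval_hermitePoly]
  rw [this]
  exact memLp_polynomial _

theorem memLp_id_mul_hermiteFn (n : ℕ) :
    MemLp (fun t => t * hermiteFn n t) 2 (gaussianReal 0 1) := by
  have e : (fun t => t * hermiteFn n t) =
      fun t => (Polynomial.X * hermitePoly n).eval t := by
    ext t
    rw [Polynomial.eval_mul, Polynomial.eval_X, eval_hermitePoly]
  rw [e]
  exact memLp_polynomial _

/-- Smooth cutoffs on the line with uniformly bounded derivatives. -/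
theorem exists_cutoff : ∃ (c : ℕ → ℝ → ℝ) (C : ℝ), 0 ≤ C ∧
    (∀ N, ContDiff ℝ (⊤ : ℕ∞) (c N)) ∧ (∀ N, HasCompactSupport (c N)) ∧
    (∀ N t, |c N t| ≤ 1) ∧ (∀ N t, |deriv (c N) t| ≤ C) ∧
    ∀ t : ℝ, ∀ᶠ N in atTop, c N =ᶠ[𝓝 t] 1 := by
  let η : ContDiffBump (0 : ℝ) := ⟨1, 2, one_pos, one_lt_two⟩
  have hη : ContDiff ℝ (⊤ : ℕ∞) η := η.contDiff
  obtain ⟨C, hC⟩ := (hη.continuous_deriv (by simp)).bounded_above_of_compact_support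
    η.hasCompactSupport.deriv
  have hpos : ∀ N : ℕ, (0 : ℝ) < N + 1 := fun N => by positivity
  refine ⟨fun N t => η (t * ((N : ℝ) + 1)⁻¹), C, (norm_nonneg _).trans (hC 0), fun N => ?_,
    fun N => ?_, fun N t => ?_, fun N t => ?_, fun t => ?_⟩
  · exact hη.comp (contDiff_id.mul contDiff_const)
  · exact η.hasCompactSupport.comp_homeomorph
      (Homeomorph.mulRight₀ ((N : ℝ) + 1)⁻¹ (inv_ne_zero (hpos N).ne'))
  · rw [abs_of_nonneg η.nonneg]
    exact η.le_one
  · have hd : HasDerivAt (fun t => η (t * ((N : ℝ) + 1)⁻¹))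
        (deriv η (t * ((N : ℝ) + 1)⁻¹) * ((N : ℝ) + 1)⁻¹) t := by
      have h1 : HasDerivAt η (deriv η (t * ((N : ℝ) + 1)⁻¹)) (t * ((N : ℝ) + 1)⁻¹) :=
        (hη.differentiable (by simp) _).hasDerivAt
      have h2 := h1.comp t ((hasDerivAt_id t).mul_const ((N : ℝ) + 1)⁻¹)
      simpa using! h2
    rw [hd.deriv, abs_mul]
    have h1 := hC (t * ((N : ℝ) + 1)⁻¹)
    rw [Real.norm_eq_abs] at h1
    have h2 : |((N : ℝ) + 1)⁻¹| ≤ 1 := by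
      rw [abs_of_pos (inv_pos.2 (hpos N))]
      exact inv_le_one_of_one_le₀ (by linarith [Nat.cast_nonneg (α := ℝ) N])
    calc _ ≤ C * 1 := by gcongr; exact (norm_nonneg _).trans (hC 0)
      _ = C := mul_one C
  · filter_upwards [eventually_ge_atTop ⌈|t|⌉₊] with N hN
    have h1 : |t| < N + 1 := by
      have := Nat.ceil_le.1 hN
      linarith
    have h2 : ∀ᶠ x in 𝓝 t, |x| < (N : ℝ) + 1 := continuous_abs.continuousAt.eventually_lt
      continuousAt_const h1
    filter_upwards [h2] with x hx
    apply η.one_of_mem_closedBall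
    rw [mem_closedBall_zero_iff, Real.norm_eq_abs, abs_mul, abs_of_pos (inv_pos.2 (hpos N)),
      ← div_eq_mul_inv, div_le_one (hpos N)]
    exact hx.le

theorem partialDeriv_prod {s : Finset ι} {j : ι} [DecidableEq ι] (hj : j ∈ s) (g : ι → ℝ → ℝ)
    (y : ι → ℝ) :
    partialDeriv j (fun y => ∏ i ∈ s, g i (y i)) y =
      deriv (g j) (y j) * ∏ i ∈ s.erase j, g i (y i) := by
  have e : ∀ t, (∏ i ∈ s, g i (Function.update y j t i)) =
      g j t * ∏ i ∈ s.erase j, g i (y i) := by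
    intro t
    rw [← Finset.mul_prod_erase s _ hj, Function.update_self]
    congr 1
    refine Finset.prod_congr rfl fun i hi => ?_
    rw [Function.update_of_ne (Finset.ne_of_mem_erase hi)]
  rw [← deriv_mul_const_field, partialDeriv]
  congr 1
  funext t
  convert e t

theorem isTest_prod (s : Finset ι) {g : ι → ℝ → ℝ} (hg : ∀ i, ContDiff ℝ (⊤ : ℕ∞) (g i))
    (hs : ∀ i, HasCompactSupport (g i)) : IsTest fun y : ι → ℝ => ∏ i ∈ s, g i (y i) := by
  refine ⟨s, fun z => ∏ i : s, g i (z i), ?_, ?_, ?_⟩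
  · exact contDiff_prod fun i _ => (hg i).comp (contDiff_apply ℝ ℝ i)
  · refine HasCompactSupport.intro (K := Set.univ.pi fun i : s => tsupport (g i))
      (isCompact_univ_pi fun i => hs i) fun z hz => ?_
    simp only [Set.mem_pi, Set.mem_univ, forall_const, not_forall] at hz
    obtain ⟨i, hi⟩ := hz
    exact Finset.prod_eq_zero (Finset.mem_univ i) (image_eq_zero_of_notMem_tsupport hi)
  · funext y
    exact (Finset.prod_coe_sort s fun i => g i (y i)).symm

/-- This is integration by parts with y_j H − ∂_j H = √(κ_j + 1) times the raised Hermite product.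
Hermite polynomials are not admissible test functions, so each factor is multiplied by a cutoff and
the cutoffs are removed by dominated convergence. -/
theorem integral_hermiteProd_smul_weakPartial {j : ι} {h g : (ι → ℝ) → S}
    (hh : MemLp h 2 (gauss ι)) (hg : MemLp g 2 (gauss ι)) (hw : IsWeakPartial j h g)
    (κ : ι →₀ ℕ) :
    ∫ y, hermiteProd κ y • g y ∂(gauss ι) =
      √((κ j : ℝ) + 1) • ∫ y, hermiteProd (κ + Finsupp.single j 1) y • h y ∂(gauss ι) := by
  classical
  obtain ⟨c, C, hC0, hcd, hcs, hc1, hcC, hlim⟩ := exists_cutoff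
  set s := insert j κ.support with hs
  have hjs : j ∈ s := Finset.mem_insert_self _ _
  have hκs : κ.support ⊆ s := Finset.subset_insert _ _
  let G : ℕ → ι → ℝ → ℝ := fun N i t => hermiteFn (κ i) t * c N t
  have hGd : ∀ N i, ContDiff ℝ (⊤ : ℕ∞) (G N i) := fun N i =>
    (contDiff_hermiteFn (κ i)).mul (hcd N)
  have hGs : ∀ N i, HasCompactSupport (G N i) := fun N i => (hcs N).mul_left
  have hGle : ∀ N i t, |G N i t| ≤ |hermiteFn (κ i) t| := fun N i t => by
    rw [abs_mul]
    exact mul_le_of_le_one_right (abs_nonneg _) (hc1 N t)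
  have hGev : ∀ i t, ∀ᶠ N in atTop, G N i =ᶠ[𝓝 t] hermiteFn (κ i) := fun i t => by
    filter_upwards [hlim t] with N hN
    filter_upwards [hN] with x hx
    simp [G, hx]
  have hG' : ∀ N t, |deriv (G N j) t| ≤ |deriv (hermiteFn (κ j)) t| + C * |hermiteFn (κ j) t| := by
    intro N t
    have h1 : DifferentiableAt ℝ (hermiteFn (κ j)) t :=
      (contDiff_hermiteFn (κ j) (k := 1)).differentiable one_ne_zero t
    have h2 : DifferentiableAt ℝ (c N) t := (hcd N).differentiable (by simp) t
    have h3 : deriv (G N j) t = deriv (hermiteFn (κ j)) t * c N t +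
        hermiteFn (κ j) t * deriv (c N) t := deriv_fun_mul h1 h2
    rw [h3]
    refine (abs_add_le _ _).trans (add_le_add ?_ ?_)
    · rw [abs_mul]
      exact mul_le_of_le_one_right (abs_nonneg _) (hc1 N t)
    · rw [abs_mul, mul_comm]
      gcongr
      exact hcC N t
  have hEq : ∀ N, ∫ y, (∏ i ∈ s, G N i (y i)) • g y ∂(gauss ι) =
      ∫ y, ((y j * G N j (y j) - deriv (G N j) (y j)) * ∏ i ∈ s.erase j, G N i (y i)) • h y
        ∂(gauss ι) := by
    intro N
    rw [hw _ (isTest_prod s (hGd N) (hGs N))]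
    congr 1 with y
    rw [partialDeriv_prod hjs, ← Finset.mul_prod_erase s _ hjs]
    congr 1
    ring
  -- A square-integrable product majorant, uniform in the cutoff parameter; the constant C bounds
  -- the derivatives of the cutoffs.
  let U : ι → ℝ → ℝ := fun i t => if i = j then
    |t * hermiteFn (κ j) t| + (|deriv (hermiteFn (κ j)) t| + C * |hermiteFn (κ j) t|)
    else |hermiteFn (κ i) t|
  have hU : ∀ i, MemLp (U i) 2 (gaussianReal 0 1) := by
    intro i
    by_cases hi : i = j
    · simp only [U, if_pos hi]
      exact (memLp_id_mul_hermiteFn _).norm.add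
        ((memLp_deriv_hermiteFn _).norm.add ((memLp_hermiteFn _).norm.const_mul C))
    · simp only [U, if_neg hi]
      exact (memLp_hermiteFn _).norm
  have T1 : Tendsto (fun N => ∫ y, (∏ i ∈ s, G N i (y i)) • g y ∂(gauss ι)) atTop
      (𝓝 (∫ y, hermiteProd κ y • g y ∂(gauss ι))) := by
    refine tendsto_integral_of_dominated_convergence
      (fun y => ‖hermiteProd κ y • g y‖) (fun N => ?_) ?_ (fun N => ?_) ?_
    · refine AEStronglyMeasurable.smul ?_ hg.1
      refine Measurable.aestronglyMeasurable ?_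
      exact Finset.measurable_prod _ fun i _ =>
        (hGd N i).continuous.measurable.comp (measurable_pi_apply i)
    · exact (integrable_smul_of_memLp (memLp_hermiteProd κ) hg).norm
    · refine Eventually.of_forall fun y => ?_
      rw [norm_smul, norm_smul, hermiteProd_eq hκs, Real.norm_eq_abs, Real.norm_eq_abs,
        Finset.abs_prod, Finset.abs_prod]
      exact mul_le_mul_of_nonneg_right (Finset.prod_le_prod (fun _ _ => abs_nonneg _)
        fun i _ => hGle N i (y i)) (norm_nonneg _)
    · refine Eventually.of_forall fun y => Tendsto.smul_const ?_ _
      rw [hermiteProd_eq hκs]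
      refine tendsto_finsetProd _ fun i _ => ?_
      refine tendsto_const_nhds.congr' ?_
      filter_upwards [hGev i (y i)] with N hN
      exact hN.eq_of_nhds.symm
  have T2 : Tendsto (fun N => ∫ y, ((y j * G N j (y j) - deriv (G N j) (y j)) *
      ∏ i ∈ s.erase j, G N i (y i)) • h y ∂(gauss ι)) atTop
      (𝓝 (∫ y, (√((κ j : ℝ) + 1) * hermiteProd (κ + Finsupp.single j 1) y) • h y
        ∂(gauss ι))) := by
    refine tendsto_integral_of_dominated_convergence
      (fun y => ‖(∏ i ∈ s, U i (y i)) • h y‖) (fun N => ?_) ?_ (fun N => ?_) ?_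
    · refine AEStronglyMeasurable.smul ?_ hh.1
      refine Measurable.aestronglyMeasurable ?_
      refine Measurable.mul ?_ (Finset.measurable_prod _ fun i _ =>
        (hGd N i).continuous.measurable.comp (measurable_pi_apply i))
      exact ((measurable_pi_apply j).mul
        ((hGd N j).continuous.measurable.comp (measurable_pi_apply j))).sub
        ((measurable_deriv _).comp (measurable_pi_apply j))
    · exact (integrable_smul_of_memLp (memLp_prod_gauss s hU) hh).norm
    · refine Eventually.of_forall fun y => ?_
      rw [norm_smul, norm_smul, Real.norm_eq_abs, Real.norm_eq_abs, abs_mul, Finset.abs_prod,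
        Finset.abs_prod, ← Finset.mul_prod_erase s _ hjs]
      refine mul_le_mul_of_nonneg_right (mul_le_mul ?_ (Finset.prod_le_prod
        (fun _ _ => abs_nonneg _) fun i hi => ?_) (Finset.prod_nonneg fun _ _ => abs_nonneg _)
        (abs_nonneg _)) (norm_nonneg _)
      · simp only [U, if_true]
        refine le_trans ?_ (le_abs_self _)
        refine (abs_sub _ _).trans (add_le_add ?_ (hG' N _))
        rw [abs_mul, abs_mul (y j) (hermiteFn _ _)]
        exact mul_le_mul_of_nonneg_left (hGle N j (y j)) (abs_nonneg _)
      · simp only [U, if_neg (Finset.ne_of_mem_erase hi), abs_abs]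
        exact hGle N i (y i)
    · refine Eventually.of_forall fun y => Tendsto.smul_const ?_ _
      have hsub : (κ + Finsupp.single j 1).support ⊆ s := by
        refine Finsupp.support_add.trans (Finset.union_subset hκs ?_)
        exact Finsupp.support_single_subset.trans (by simpa using hjs)
      rw [hermiteProd_eq hsub, ← Finset.mul_prod_erase s _ hjs, ← mul_assoc]
      have e1 : (κ + Finsupp.single j 1 : ι →₀ ℕ) j = κ j + 1 := by simp
      rw [e1, ← mul_hermiteFn_sub_deriv]
      refine Tendsto.mul ?_ (tendsto_finsetProd _ fun i hi => ?_)
      · refine tendsto_const_nhds.congr' ?_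
        filter_upwards [hGev j (y j)] with N hN
        rw [hN.eq_of_nhds, hN.deriv_eq]
      · have e2 : (κ + Finsupp.single j 1 : ι →₀ ℕ) i = κ i := by
          simp [(Finset.ne_of_mem_erase hi).symm]
        rw [e2]
        refine tendsto_const_nhds.congr' ?_
        filter_upwards [hGev i (y i)] with N hN
        exact hN.eq_of_nhds.symm
  simp only [hEq] at T1
  rw [tendsto_nhds_unique T1 T2]
  simp_rw [mul_smul]
  exact integral_smul _ _

end ProductMeasure

end SparseQuad
namespace SparseQuad

open Filter Topology

section Completeness

variable {ι : Type*}

/-! ### Completeness of the Hermite polynomials -/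

/-- For n = 0 the truncated index n − 1 is harmless because its factor √n vanishes. -/
theorem id_mul_hermiteFn (n : ℕ) (t : ℝ) :
    t * hermiteFn n t = √((n : ℝ) + 1) * hermiteFn (n + 1) t +
      √(n : ℝ) * hermiteFn (n - 1) t := by
  cases n with
  | zero => simp
  | succ n =>
    have h := hermiteFn_succ_succ n t
    have e : ((n + 1 : ℕ) : ℝ) + 1 = n + 2 := by push_cast; ring
    rw [e, h]
    push_cast
    ring

theorem integrable_mul_hermiteProd_mul {g : (ι → ℝ) → ℝ} (hg : MemLp g 2 (gauss ι)) {j : ι}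
    {ν : ι →₀ ℕ} (hν : ν j = 0) {w : ℝ → ℝ} (hw : MemLp w 2 (gaussianReal 0 1)) {s : Finset ι}
    {A : ι → Set ℝ} (hA : ∀ i, MeasurableSet (A i)) :
    Integrable (fun y => w (y j) *
      ((∏ i ∈ s, (A i).indicator 1 (y i)) * (hermiteProd ν y * g y))) (gauss ι) := by
  classical
  let U : ι → ℝ → ℝ := fun i => if i = j then w else hermiteFn (ν i)
  have hU : ∀ i, MemLp (U i) 2 (gaussianReal 0 1) := by
    intro i
    by_cases hi : i = j
    · simpa only [U, if_pos hi] using hw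
    · simpa only [U, if_neg hi] using memLp_hermiteFn (ν i)
  have hj : j ∉ ν.support := by simpa using hν
  have h1 := (memLp_prod_gauss (insert j ν.support) hU).integrable_mul hg
  have hm : Measurable fun y : ι → ℝ => ∏ i ∈ s, (A i).indicator (1 : ℝ → ℝ) (y i) :=
    Finset.measurable_prod _ fun i _ =>
      (measurable_one.indicator (hA i)).comp (measurable_pi_apply i)
  refine (h1.bdd_mul (c := 1) hm.aestronglyMeasurable (Eventually.of_forall fun y => ?_)).congr
    (Eventually.of_forall fun y => ?_)
  · rw [Real.norm_eq_abs, Finset.abs_prod]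
    refine Finset.prod_le_one (fun _ _ => abs_nonneg _) fun i _ => ?_
    by_cases h : y i ∈ A i <;> simp [h]
  · simp only [Pi.mul_apply]
    rw [Finset.prod_insert hj]
    have e : ∏ i ∈ ν.support, U i (y i) = hermiteProd ν y := by
      refine Finset.prod_congr rfl fun i hi => ?_
      have : i ≠ j := fun h => hj (h ▸ hi)
      simp only [U, if_neg this]
    rw [e]
    simp only [U, if_true]
    ring

theorem memLp_pow_mul_hermiteFn (n m : ℕ) :
    MemLp (fun t => t ^ n * hermiteFn m t) 2 (gaussianReal 0 1) := by
  have e : (fun t => t ^ n * hermiteFn m t) =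
      fun t => (Polynomial.X ^ n * hermitePoly m).eval t := by
    ext t
    rw [Polynomial.eval_mul, Polynomial.eval_pow, Polynomial.eval_X, eval_hermitePoly]
  rw [e]
  exact memLp_polynomial _

theorem memLp_exp_mul (t : ℝ) :
    MemLp (fun x : ℝ => Real.exp (t * x)) 2 (gaussianReal 0 1) := by
  rw [memLp_two_iff_integrable_sq (by fun_prop)]
  refine (integrable_exp_mul_gaussianReal (μ := 0) (v := 1) (2 * t)).congr
    (Eventually.of_forall fun x => ?_)
  simp only [← Real.exp_nat_mul]
  congr 1
  push_cast
  ring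

theorem hermiteProd_add_single {ν : ι →₀ ℕ} {j : ι} (hν : ν j = 0) (n : ℕ) (y : ι → ℝ) :
    hermiteProd (ν + Finsupp.single j n) y = hermiteFn n (y j) * hermiteProd ν y := by
  classical
  have hj : j ∉ ν.support := by simpa using hν
  have hsub : (ν + Finsupp.single j n).support ⊆ insert j ν.support := by
    refine Finsupp.support_add.trans (Finset.union_subset (Finset.subset_insert _ _) ?_)
    exact Finsupp.support_single_subset.trans (by simp)
  rw [hermiteProd_eq hsub, Finset.prod_insert hj]
  congr 1
  · simp [hν]
  · refine Finset.prod_congr rfl fun i hi => ?_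
    have : i ≠ j := fun h => hj (h ▸ hi)
    simp [this]

/-- Coordinates pass one at a time from polynomials to indicators. If the claim holds for s, then G
= (indicators over s) · H_ν · g is orthogonal to every polynomial in a further coordinate y_j.
Moment determinacy then makes it orthogonal to every indicator in y_j. -/
theorem integral_indicator_prod_mul_hermiteProd_mul_eq_zero {g : (ι → ℝ) → ℝ}
    (hg : MemLp g 2 (gauss ι)) (h0 : ∀ ν : ι →₀ ℕ, ∫ y, hermiteProd ν y * g y ∂(gauss ι) = 0)
    {A : ι → Set ℝ} (hA : ∀ i, MeasurableSet (A i)) (s : Finset ι) :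
    ∀ ν : ι →₀ ℕ, (∀ i ∈ s, ν i = 0) →
      ∫ y, (∏ i ∈ s, (A i).indicator 1 (y i)) * (hermiteProd ν y * g y) ∂(gauss ι) = 0 := by
  classical
  induction s using Finset.induction_on with
  | empty => intro ν _; simpa using h0 ν
  | insert j s hj ih =>
    intro ν hν
    have hνj : ν j = 0 := hν j (Finset.mem_insert_self _ _)
    set G : (ι → ℝ) → ℝ := fun y =>
      (∏ i ∈ s, (A i).indicator 1 (y i)) * (hermiteProd ν y * g y) with hG
    have hherm : ∀ m, ∫ y, hermiteFn m (y j) * G y ∂(gauss ι) = 0 := by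
      intro m
      have h := ih (ν + Finsupp.single j m) fun i hi => by
        have : i ≠ j := fun h => hj (h ▸ hi)
        simp [this, hν i (Finset.mem_insert_of_mem hi)]
      rw [← h]
      refine integral_congr_ae (Eventually.of_forall fun y => ?_)
      simp only [hG, hermiteProd_add_single hνj]
      ring
    have hmom : ∀ n m : ℕ, ∫ y, (y j ^ n * hermiteFn m (y j)) * G y ∂(gauss ι) = 0 := by
      intro n
      induction n with
      | zero => simpa using hherm
      | succ n ihn =>
        intro m
        have e : ∀ y : ι → ℝ, (y j ^ (n + 1) * hermiteFn m (y j)) * G y =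
            √((m : ℝ) + 1) * ((y j ^ n * hermiteFn (m + 1) (y j)) * G y) +
            √(m : ℝ) * ((y j ^ n * hermiteFn (m - 1) (y j)) * G y) := by
          intro y
          linear_combination (y j ^ n * G y) * id_mul_hermiteFn m (y j)
        simp_rw [e]
        rw [integral_add, integral_const_mul, integral_const_mul, ihn, ihn]
        · simp
        · exact (integrable_mul_hermiteProd_mul hg hνj (memLp_pow_mul_hermiteFn n _) hA).const_mul _
        · exact (integrable_mul_hermiteProd_mul hg hνj (memLp_pow_mul_hermiteFn n _) hA).const_mul _
    have hGi : Integrable G (gauss ι) := by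
      simpa using integrable_mul_hermiteProd_mul (s := s) hg hνj (memLp_hermiteFn 0) hA
    have h := integral_indicator_mul_eq_zero (X := fun y : ι → ℝ => y j) (measurable_pi_apply j)
      hGi (fun t => integrable_mul_hermiteProd_mul hg hνj (memLp_exp_mul t) hA)
      (fun n => by simpa using hmom n 0) (hA j)
    rw [← h]
    refine integral_congr_ae (Eventually.of_forall fun y => ?_)
    simp only [hG, Finset.prod_insert hj]
    ring

/-- A square integrable function orthogonal to all Hermite polynomials vanishes. -/
theorem ae_eq_zero_of_forall_integral_hermiteProd {g : (ι → ℝ) → ℝ} (hg : MemLp g 2 (gauss ι))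
    (h0 : ∀ ν : ι →₀ ℕ, ∫ y, hermiteProd ν y * g y ∂(gauss ι) = 0) : g =ᵐ[gauss ι] 0 := by
  have hgi : Integrable g (gauss ι) := hg.integrable one_le_two
  have hall : ∫ y, g y ∂(gauss ι) = 0 := by simpa using h0 0
  -- The sets with vanishing integral include the cylinders with measurable sides, a π-system that
  -- generates the σ-algebra.
  have key : ∀ B : Set (ι → ℝ), MeasurableSet B → ∫ y in B, g y ∂(gauss ι) = 0 := by
    intro B hB
    induction B, hB using MeasurableSpace.induction_on_inter
      (generateFrom_squareCylinders (α := fun _ : ι => ℝ)).symm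
      (isPiSystem_squareCylinders (fun _ => MeasurableSpace.isPiSystem_measurableSet)
        (by simp)) with
    | empty => simp
    | basic t ht =>
      obtain ⟨s, A, hA, rfl⟩ := ht
      have hA' : ∀ i, MeasurableSet (A i) := fun i => hA i (Set.mem_univ i)
      have h := integral_indicator_prod_mul_hermiteProd_mul_eq_zero hg h0 hA' s 0 (by simp)
      rw [← integral_indicator (MeasurableSet.pi s.countable_toSet fun i _ => hA' i), ← h]
      refine integral_congr_ae (Eventually.of_forall fun y => ?_)
      simp only [hermiteProd_zero, one_mul]
      by_cases hy : y ∈ (s : Set ι).pi A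
      · rw [Set.indicator_of_mem hy, Finset.prod_eq_one, one_mul]
        intro i hi
        rw [Set.indicator_of_mem (hy i hi), Pi.one_apply]
      · rw [Set.indicator_of_notMem hy]
        simp only [Set.mem_pi, not_forall] at hy
        obtain ⟨i, hi, hyi⟩ := hy
        rw [Finset.prod_eq_zero (i := i) hi (Set.indicator_of_notMem hyi _), zero_mul]
    | compl t ht h =>
      rw [setIntegral_compl ht hgi, h, hall, sub_zero]
    | iUnion f hd hf h =>
      rw [integral_iUnion hf hd hgi.integrableOn]
      simp [h]
  exact hgi.ae_eq_zero_of_forall_setIntegral_eq_zero fun B hB _ => key B hB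

theorem inner_toLp {u v : (ι → ℝ) → ℝ} (hu : MemLp u 2 (gauss ι)) (hv : MemLp v 2 (gauss ι)) :
    inner ℝ (hu.toLp u) (hv.toLp v) = ∫ y, u y * v y ∂(gauss ι) := by
  rw [L2.inner_def]
  refine integral_congr_ae ?_
  filter_upwards [hu.coeFn_toLp, hv.coeFn_toLp] with y h1 h2
  rw [h1, h2]
  simp [mul_comm]

theorem orthonormal_hermiteProd :
    Orthonormal ℝ fun ν : ι →₀ ℕ => (memLp_hermiteProd ν).toLp (hermiteProd ν) := by
  classical
  rw [orthonormal_iff_ite]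
  intro ν μ
  rw [inner_toLp, integral_hermiteProd_mul]

/-- Bessel's inequality for Hermite expansions. -/
theorem sum_integral_hermiteProd_mul_sq_le {h : (ι → ℝ) → ℝ} (hh : MemLp h 2 (gauss ι))
    (s : Finset (ι →₀ ℕ)) :
    ∑ ν ∈ s, (∫ y, hermiteProd ν y * h y ∂(gauss ι)) ^ 2 ≤ ∫ y, h y ^ 2 ∂(gauss ι) := by
  have h1 := (orthonormal_hermiteProd (ι := ι)).sum_inner_products_le (hh.toLp h) (s := s)
  simp only [inner_toLp, Real.norm_eq_abs, sq_abs] at h1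
  refine h1.trans_eq ?_
  rw [← real_inner_self_eq_norm_sq, inner_toLp]
  simp only [sq]

/-- Parseval's identity for Hermite expansions. -/
theorem hasSum_integral_hermiteProd {φ h : (ι → ℝ) → ℝ} (hφ : MemLp φ 2 (gauss ι))
    (hh : MemLp h 2 (gauss ι)) :
    HasSum (fun ν => (∫ y, φ y * hermiteProd ν y ∂(gauss ι)) *
      ∫ y, hermiteProd ν y * h y ∂(gauss ι)) (∫ y, φ y * h y ∂(gauss ι)) := by
  have hbot : (Submodule.span ℝ (Set.range fun ν : ι →₀ ℕ =>
      (memLp_hermiteProd ν).toLp (hermiteProd ν)))ᗮ = ⊥ := by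
    rw [Submodule.eq_bot_iff]
    intro v hv
    have hv2 : MemLp v 2 (gauss ι) := Lp.memLp v
    have e : hv2.toLp v = v := Lp.toLp_coeFn v hv2
    have h0 := ae_eq_zero_of_forall_integral_hermiteProd hv2 fun ν => by
      rw [← inner_toLp (memLp_hermiteProd ν) hv2, e]
      exact hv _ (Submodule.subset_span ⟨ν, rfl⟩)
    exact (Lp.eq_zero_iff_ae_eq_zero).2 h0
  have h1 := (HilbertBasis.mkOfOrthogonalEqBot orthonormal_hermiteProd
    hbot).hasSum_inner_mul_inner (hφ.toLp φ) (hh.toLp h)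
  simpa only [HilbertBasis.coe_mkOfOrthogonalEqBot, inner_toLp] using h1

end Completeness

end SparseQuad
namespace SparseQuad

open Filter Topology

section PointEvaluation

variable {ι : Type*}

/-! ### Point evaluation through Hermite expansions -/

theorem measureReal_ne_zero {Ω : Type*} [MeasurableSpace Ω] {μ : Measure Ω} [IsFiniteMeasure μ]
    {s : Set Ω} (h : μ s ≠ 0) : μ.real s ≠ 0 :=
  (measureReal_ne_zero_iff (measure_ne_top _ _)).2 h

theorem ne_zero_of_pi_ne_zero {A : ι → Set ℝ} (hA : ∀ j, MeasurableSet (A j))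
    (h0 : gauss ι (Set.univ.pi A) ≠ 0) (j : ι) : gaussianReal 0 1 (A j) ≠ 0 := by
  intro h
  apply h0
  refine measure_mono_null (t := Set.pi ({j} : Finset ι) A) (fun y hy i _ => hy i trivial) ?_
  rw [gauss, Measure.infinitePi_pi _ (fun i _ => hA i), Finset.prod_singleton, h]

/-- Jensen's inequality and ∫ H_n² = 1. The bound does not depend on n, so it can be used in
coordinates where the box has not been shrunk. -/
theorem sq_setAverage_hermiteFn_le (n : ℕ) {A : Set ℝ} (h0 : gaussianReal 0 1 A ≠ 0) :
    (⨍ t in A, hermiteFn n t ∂(gaussianReal 0 1)) ^ 2 ≤ ((gaussianReal 0 1).real A)⁻¹ := by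
  have h := (even_two.convexOn_pow (𝕜 := ℝ)).map_set_average_le (t := A)
    (f := hermiteFn n) (μ := gaussianReal 0 1) (continuous_pow 2).continuousOn isClosed_univ h0
    (measure_ne_top _ _) (by simp) ((memLp_hermiteFn n).integrable one_le_two).integrableOn
    (memLp_hermiteFn n).integrable_sq.integrableOn
  refine h.trans ?_
  rw [setAverage_eq, smul_eq_mul]
  refine mul_le_of_le_one_right (inv_nonneg.2 measureReal_nonneg) ?_
  have h1 : ∫ t in A, hermiteFn n t ^ 2 ∂(gaussianReal 0 1) ≤
      ∫ t, hermiteFn n t ^ 2 ∂(gaussianReal 0 1) :=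
    setIntegral_le_integral (memLp_hermiteFn n).integrable_sq
      (Eventually.of_forall fun _ => sq_nonneg _)
  refine h1.trans_eq ?_
  have := integral_hermiteFn_mul n n
  simpa [sq] using this

theorem gaussianReal_Icc_ne_zero {a b : ℝ} (h : a < b) :
    gaussianReal 0 1 (Set.Icc a b) ≠ 0 := by
  intro h0
  have := gaussianReal_absolutelyContinuous' 0 (one_ne_zero (α := NNReal)) h0
  rw [Real.volume_Icc, ENNReal.ofReal_eq_zero] at this
  linarith

theorem integrable_hermiteFn (n : ℕ) : Integrable (hermiteFn n) (gaussianReal 0 1) :=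
  (memLp_hermiteFn n).integrable one_le_two

/-- The box lies in the cylinder over T, so positive measure of the infinite box bounds these
products uniformly in T. -/
theorem prod_inv_measureReal_le {A : ι → Set ℝ} (hA : ∀ j, MeasurableSet (A j))
    (h0 : gauss ι (Set.univ.pi A) ≠ 0) (T : Finset ι) :
    ∏ j ∈ T, ((gaussianReal 0 1).real (A j))⁻¹ ≤ ((gauss ι).real (Set.univ.pi A))⁻¹ := by
  rw [Finset.prod_inv_distrib]
  have h1 : gauss ι (Set.univ.pi A) ≤ ∏ j ∈ T, gaussianReal 0 1 (A j) := by
    rw [gauss, ← Measure.infinitePi_pi _ (fun i _ => hA i)]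
    exact measure_mono fun y hy i _ => hy i trivial
  have h2 : (gauss ι).real (Set.univ.pi A) ≤ ∏ j ∈ T, (gaussianReal 0 1).real (A j) := by
    simp only [measureReal_def]
    rw [← ENNReal.toReal_prod]
    exact ENNReal.toReal_mono (ENNReal.prod_ne_top fun j _ => measure_ne_top _ _) h1
  have h3 : 0 < (gauss ι).real (Set.univ.pi A) :=
    lt_of_le_of_ne measureReal_nonneg (measureReal_ne_zero h0).symm
  exact inv_anti₀ h3 h2

variable [Countable ι]

theorem tendsto_integral_pi {A : ι → Set ℝ} (hA : ∀ j, MeasurableSet (A j))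
    (J : Finset ι) {u : ι → ℝ → ℝ} (hu : ∀ j, Integrable (u j) (gaussianReal 0 1)) :
    Tendsto (fun T : Finset ι => ∫ y, (∏ i ∈ T, (A i).indicator 1 (y i)) *
        ∏ j ∈ J, u j (y j) ∂(gauss ι)) atTop
      (𝓝 (∫ y in Set.univ.pi A, ∏ j ∈ J, u j (y j) ∂(gauss ι))) := by
  rw [← integral_indicator (MeasurableSet.univ_pi hA)]
  have hi := integrable_prod_gauss J hu
  refine tendsto_integral_filter_of_dominated_convergence
    (fun y => ‖∏ j ∈ J, u j (y j)‖) (Eventually.of_forall fun T => ?_)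
    (Eventually.of_forall fun T => Eventually.of_forall fun y => ?_) hi.norm
    (Eventually.of_forall fun y => ?_)
  · refine AEStronglyMeasurable.mul ?_ hi.aestronglyMeasurable
    exact (Finset.measurable_prod _ fun i _ =>
      (measurable_one.indicator (hA i)).comp (measurable_pi_apply i)).aestronglyMeasurable
  · rw [norm_mul, Real.norm_eq_abs, Finset.abs_prod]
    refine mul_le_of_le_one_left (norm_nonneg _) ?_
    refine Finset.prod_le_one (fun _ _ => abs_nonneg _) fun i _ => ?_
    by_cases h : y i ∈ A i <;> simp [h]
  · refine tendsto_const_nhds.congr' ?_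
    by_cases hy : y ∈ Set.univ.pi A
    · refine Eventually.of_forall fun T => ?_
      have e : ∏ i ∈ T, (A i).indicator (1 : ℝ → ℝ) (y i) = 1 := Finset.prod_eq_one fun i _ => by
        rw [Set.indicator_of_mem (hy i trivial), Pi.one_apply]
      simp only [e, one_mul]
      rw [Set.indicator_of_mem hy]
    · have hy' := hy
      simp only [Set.mem_pi, not_forall] at hy'
      obtain ⟨i, _, hi⟩ := hy'
      filter_upwards [eventually_ge_atTop ({i} : Finset ι)] with T hT
      rw [Set.indicator_of_notMem hy,
        Finset.prod_eq_zero (Finset.singleton_subset_iff.1 hT) (Set.indicator_of_notMem hi _),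
        zero_mul]

/-- For cylinders over finite T ⊇ J the integral factorizes by independence, and the sides outside J
contribute only their measures. Letting T grow gives the infinite box. -/
theorem setIntegral_pi {A : ι → Set ℝ} (hA : ∀ j, MeasurableSet (A j))
    (h0 : gauss ι (Set.univ.pi A) ≠ 0) (J : Finset ι) {u : ι → ℝ → ℝ}
    (hu : ∀ j, Integrable (u j) (gaussianReal 0 1)) :
    ∫ y in Set.univ.pi A, ∏ j ∈ J, u j (y j) ∂(gauss ι) =
      (gauss ι).real (Set.univ.pi A) * ∏ j ∈ J, ⨍ t in A j, u j t ∂(gaussianReal 0 1) := by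
  classical
  have h1 := tendsto_integral_pi hA J hu
  have h2 := (tendsto_integral_pi hA ∅ (u := fun _ _ => 1) (fun _ => integrable_const _)).mul_const
    (∏ j ∈ J, ⨍ t in A j, u j t ∂(gaussianReal 0 1))
  have e2 : ∫ y in Set.univ.pi A, ∏ j ∈ (∅ : Finset ι), (fun _ _ => 1 : ι → ℝ → ℝ) j (y j)
      ∂(gauss ι) = (gauss ι).real (Set.univ.pi A) := by simp
  rw [e2] at h2
  refine tendsto_nhds_unique (h1.congr' ?_) h2
  filter_upwards [eventually_ge_atTop J] with T hT
  have hind : ∀ j, Integrable ((A j).indicator (1 : ℝ → ℝ)) (gaussianReal 0 1) := fun j =>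
    (integrable_const (1 : ℝ)).indicator (hA j)
  let v : ι → ℝ → ℝ := fun j t => (A j).indicator 1 t * (if j ∈ J then u j t else 1)
  have hv : ∀ j t, v j t = (A j).indicator (if j ∈ J then u j else 1) t := by
    intro j t
    by_cases ht : t ∈ A j <;> by_cases hj : j ∈ J <;> simp [v, ht, hj]
  have hvi : ∀ j, Integrable (v j) (gaussianReal 0 1) := by
    intro j
    have : v j = (A j).indicator (if j ∈ J then u j else 1) := funext (hv j)
    rw [this]
    refine Integrable.indicator ?_ (hA j)
    split_ifs
    · exact hu j
    · exact integrable_const _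
  have e1 : ∀ y : ι → ℝ, (∏ i ∈ T, (A i).indicator 1 (y i)) * ∏ j ∈ J, u j (y j) =
      ∏ j ∈ T, v j (y j) := by
    intro y
    rw [Finset.prod_mul_distrib, Finset.prod_ite_mem, Finset.inter_eq_right.2 hT]
  simp_rw [e1]
  rw [integral_prod_gauss T hvi]
  simp only [Finset.prod_empty, mul_one]
  rw [integral_prod_gauss T hind]
  have e3 : ∀ j, ∫ t, v j t ∂(gaussianReal 0 1) =
      (∫ t, (A j).indicator 1 t ∂(gaussianReal 0 1)) *
        (if j ∈ J then ⨍ t in A j, u j t ∂(gaussianReal 0 1) else 1) := by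
    intro j
    simp_rw [hv]
    rw [integral_indicator (hA j), integral_indicator_one (hA j)]
    split_ifs with hj
    · rw [setAverage_eq, smul_eq_mul, mul_inv_cancel_left₀]
      exact measureReal_ne_zero (ne_zero_of_pi_ne_zero hA h0 j)
    · simp
  simp_rw [e3]
  rw [Finset.prod_mul_distrib, Finset.prod_ite_mem, Finset.inter_eq_right.2 hT]

theorem setAverage_hermiteProd {A : ι → Set ℝ} (hA : ∀ j, MeasurableSet (A j))
    (h0 : gauss ι (Set.univ.pi A) ≠ 0) (ν : ι →₀ ℕ) :
    ⨍ y in Set.univ.pi A, hermiteProd ν y ∂(gauss ι) =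
      ∏ j ∈ ν.support, ⨍ t in A j, hermiteFn (ν j) t ∂(gaussianReal 0 1) := by
  have h := setIntegral_pi hA h0 ν.support (u := fun j => hermiteFn (ν j))
    (fun j => (memLp_hermiteFn (ν j)).integrable one_le_two)
  rw [setAverage_eq]
  unfold hermiteProd
  rw [h, smul_eq_mul, inv_mul_cancel_left₀]
  exact measureReal_ne_zero h0

/-- Shrinking finitely many sides multiplies the measure by the finitely many ratios γ(A'_j)/γ(A_j),
all positive. -/
theorem gauss_pi_ne_zero_of_subset {A A' : ι → Set ℝ} (hA : ∀ j, MeasurableSet (A j))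
    (hA' : ∀ j, MeasurableSet (A' j)) (h0 : gauss ι (Set.univ.pi A) ≠ 0) (J : Finset ι)
    (hsub : ∀ j, A' j ⊆ A j) (heq : ∀ j, j ∉ J → A' j = A j)
    (hpos : ∀ j ∈ J, gaussianReal 0 1 (A' j) ≠ 0) : gauss ι (Set.univ.pi A') ≠ 0 := by
  have h := setIntegral_pi hA h0 J (u := fun j => (A' j).indicator 1)
    (fun j => (integrable_const (1 : ℝ)).indicator (hA' j))
  have e : ∫ y in Set.univ.pi A, ∏ j ∈ J, (A' j).indicator (1 : ℝ → ℝ) (y j) ∂(gauss ι) =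
      (gauss ι).real (Set.univ.pi A') := by
    rw [← integral_indicator (MeasurableSet.univ_pi hA),
      ← integral_indicator_one (MeasurableSet.univ_pi hA')]
    refine integral_congr_ae (Eventually.of_forall fun y => ?_)
    by_cases hy : y ∈ Set.univ.pi A'
    · rw [Set.indicator_of_mem hy, Set.indicator_of_mem
        (show y ∈ Set.univ.pi A from fun j hj => hsub j (hy j hj)),
        Finset.prod_eq_one, Pi.one_apply]
      intro j _
      rw [Set.indicator_of_mem (hy j trivial), Pi.one_apply]
    · rw [Set.indicator_of_notMem hy]
      by_cases hy2 : y ∈ Set.univ.pi A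
      · rw [Set.indicator_of_mem hy2]
        simp only [Set.mem_pi, not_forall] at hy
        obtain ⟨j, _, hj⟩ := hy
        refine Finset.prod_eq_zero (i := j) ?_ (Set.indicator_of_notMem hj _)
        by_contra hjJ
        exact hj (heq j hjJ ▸ hy2 j trivial)
      · rw [Set.indicator_of_notMem hy2]
  rw [e] at h
  refine fun hz => absurd (congrArg ENNReal.toReal hz) ?_
  rw [← measureReal_def, h, ENNReal.toReal_zero]
  refine mul_ne_zero (measureReal_ne_zero h0) (Finset.prod_ne_zero_iff.2 fun j hj => ?_)
  rw [setAverage_eq, integral_indicator_one (hA' j), measureReal_restrict_apply (hA' j),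
    Set.inter_eq_left.2 (hsub j)]
  exact mul_ne_zero (inv_ne_zero (measureReal_ne_zero (ne_zero_of_pi_ne_zero hA h0 j)))
    (measureReal_ne_zero (hpos j hj))

/-- The Hermite expansion of a box continuous function converges to it at finitely supported
points, if its coefficients decay fast enough. -/
theorem hasSum_hermiteProd_of_boxContinuousAt {h : (ι → ℝ) → ℝ} (hh : MemLp h 2 (gauss ι))
    {y₀ : ι → ℝ} (hy₀ : (Function.support y₀).Finite) (hbox : BoxContinuousAt h y₀)
    (hs : ∀ K : ℝ, 1 ≤ K → Summable fun ν : ι →₀ ℕ =>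
      |∫ y, hermiteProd ν y * h y ∂(gauss ι)| * √(∏ j ∈ ν.support, K * ((ν j : ℝ) + 1))) :
    HasSum (fun ν => (∫ y, hermiteProd ν y * h y ∂(gauss ι)) * hermiteProd ν y₀) (h y₀) := by
  classical
  set c : (ι →₀ ℕ) → ℝ := fun ν => ∫ y, hermiteProd ν y * h y ∂(gauss ι) with hc
  obtain ⟨Y, hY⟩ : ∃ Y : ℝ, ∀ j, |y₀ j| ≤ Y := by
    refine ⟨∑ j ∈ hy₀.toFinset, |y₀ j|, fun j => ?_⟩
    by_cases hj : j ∈ hy₀.toFinset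
    · exact Finset.single_le_sum (f := fun j => |y₀ j|) (fun _ _ => abs_nonneg _) hj
    · have : y₀ j = 0 := by simpa using hj
      rw [this, abs_zero]
      exact Finset.sum_nonneg fun _ _ => abs_nonneg _
  -- The shrunk sides have half-width at most 1, so they stay in [−Y − 1, Y + 1].
  obtain ⟨K, hK1, hK⟩ := exists_hermiteFn_sq_le (Y + 1)
  have hK0 : 0 ≤ K := zero_le_one.trans hK1
  have hKn : ∀ n : ℕ, 0 ≤ K * ((n : ℝ) + 1) := fun n => by positivity
  have hsum : Summable fun ν => c ν * hermiteProd ν y₀ := by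
    refine Summable.of_norm_bounded (hs K hK1) fun ν => ?_
    rw [norm_mul, Real.norm_eq_abs, Real.norm_eq_abs]
    refine mul_le_mul_of_nonneg_left (Real.abs_le_sqrt ?_) (abs_nonneg _)
    rw [hermiteProd, ← Finset.prod_pow]
    exact Finset.prod_le_prod (fun _ _ => sq_nonneg _) fun j _ =>
      hK _ _ ((hY j).trans (by linarith))
  suffices e : ∑' ν, c ν * hermiteProd ν y₀ = h y₀ by
    rw [← e]
    exact hsum.hasSum
  refine eq_of_forall_dist_le fun ε hε => ?_
  obtain ⟨w, hw0, hwpos, hwε⟩ := hbox ε hε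
  let A : ι → Set ℝ := fun j => Set.Icc (y₀ j - w j) (y₀ j + w j)
  have hA : ∀ j, MeasurableSet (A j) := fun j => measurableSet_Icc
  have hAbox : {y : ι → ℝ | ∀ j, |y j - y₀ j| ≤ w j} = Set.univ.pi A := by
    ext y
    simp only [Set.mem_ofPred_eq, Set.mem_pi, Set.mem_univ, forall_const, A, Set.mem_Icc, abs_le]
    refine forall_congr' fun j => ?_
    constructor <;> rintro ⟨h1, h2⟩ <;> constructor <;> linarith
  rw [hAbox] at hwpos
  let d : ι → ℕ → ℝ := fun j n => min (w j) (1 / ((n : ℝ) + 1))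
  have hd0 : ∀ j n, 0 < d j n := fun j n => lt_min (hw0 j) (by positivity)
  let I : ι → ℕ → Set ℝ := fun j n => Set.Icc (y₀ j - d j n) (y₀ j + d j n)
  have hIpos : ∀ j n, gaussianReal 0 1 (I j n) ≠ 0 := fun j n =>
    gaussianReal_Icc_ne_zero (by linarith [hd0 j n])
  have hIabs : ∀ {j n t}, t ∈ I j n → |t - y₀ j| ≤ d j n := by
    intro j n t ht
    rw [abs_le]
    constructor <;> linarith [ht.1, ht.2]
  have hIA : ∀ j n, I j n ⊆ A j := by
    intro j n t ht
    have := min_le_left (w j) (1 / ((n : ℝ) + 1))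
    exact ⟨by linarith [ht.1], by linarith [ht.2]⟩
  -- Only finitely many sides are shrunk at a time: shrinking all of them could give a null set in
  -- infinite dimension.
  let B : Finset ι × ℕ → ι → Set ℝ := fun p j => if j ∈ p.1 then I j p.2 else A j
  have hBm : ∀ p j, MeasurableSet (B p j) := by
    intro p j
    simp only [B]
    split_ifs <;> exact measurableSet_Icc
  have hBA : ∀ p j, B p j ⊆ A j := by
    intro p j
    simp only [B]
    split_ifs
    exacts [hIA j _, subset_rfl]
  have hB0 : ∀ p, gauss ι (Set.univ.pi (B p)) ≠ 0 := fun p =>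
    gauss_pi_ne_zero_of_subset hA (hBm p) hwpos.ne' p.1 (hBA p)
      (fun j hj => by simp only [B, if_neg hj])
      fun j hj => by simpa only [B, if_pos hj] using hIpos j p.2
  have hBms : ∀ p, MeasurableSet (Set.univ.pi (B p)) := fun p => MeasurableSet.univ_pi (hBm p)
  -- the averages over the boxes, expanded by Parseval's identity
  have hpars : ∀ p, HasSum (fun ν => c ν * ⨍ y in Set.univ.pi (B p), hermiteProd ν y ∂(gauss ι))
      (⨍ y in Set.univ.pi (B p), h y ∂(gauss ι)) := by
    intro p
    have h1 := hasSum_integral_hermiteProd (φ := (Set.univ.pi (B p)).indicator 1)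
      ((memLp_const (1 : ℝ)).indicator (hBms p)) hh
    have e : ∀ g : (ι → ℝ) → ℝ, ∫ y, (Set.univ.pi (B p)).indicator 1 y * g y ∂(gauss ι) =
        ∫ y in Set.univ.pi (B p), g y ∂(gauss ι) := by
      intro g
      rw [← integral_indicator (hBms p)]
      refine integral_congr_ae (Eventually.of_forall fun y => ?_)
      by_cases hy : y ∈ Set.univ.pi (B p)
      · simp only [Set.indicator_of_mem hy, Pi.one_apply, one_mul]
      · simp only [Set.indicator_of_notMem hy, zero_mul]
    simp only [e] at h1
    have h2 := h1.mul_left ((gauss ι).real (Set.univ.pi (B p)))⁻¹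
    simp only [setAverage_eq, smul_eq_mul]
    have e3 : ∀ a b : (ι →₀ ℕ) → ℝ, (fun ν => b ν * (((gauss ι).real (Set.univ.pi (B p)))⁻¹ * a ν)) =
        fun ν => ((gauss ι).real (Set.univ.pi (B p)))⁻¹ * (a ν * b ν) := fun a b => by
      funext ν
      ring
    rw [e3]
    exact h2
  have hclose : ∀ p, dist (⨍ y in Set.univ.pi (B p), h y ∂(gauss ι)) (h y₀) ≤ ε := by
    intro p
    refine (convex_closedBall (h y₀) ε).set_average_mem Metric.isClosed_closedBall (hB0 p)
      (measure_ne_top _ _) ?_ (hh.integrable one_le_two).integrableOn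
    refine (ae_restrict_iff' (hBms p)).2 (Eventually.of_forall fun y hy => ?_)
    rw [Metric.mem_closedBall, dist_eq_norm]
    refine hwε y fun j => ?_
    have := hBA p j (hy j trivial)
    rw [abs_le]
    constructor <;> linarith [this.1, this.2]
  set M := √((gauss ι).real (Set.univ.pi A))⁻¹ with hM
  have hIK : ∀ j n m, ∀ t ∈ I j n, hermiteFn m t ^ 2 ≤ K * ((m : ℝ) + 1) := by
    intro j n m t ht
    refine hK m t ?_
    have h1 := hIabs ht
    have h2 : d j n ≤ 1 := (min_le_right _ _).trans (by
      rw [div_le_one (by positivity)]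
      linarith [Nat.cast_nonneg (α := ℝ) n])
    have h3 := abs_add_le (t - y₀ j) (y₀ j)
    rw [sub_add_cancel] at h3
    linarith [hY j]
  -- A majorant uniform in p. A shrunk coordinate contributes K(ν_j + 1) to the squared average by
  -- the locally uniform Hermite bound, an unshrunk one at most 1/γ(A_j) by Jensen. The factors
  -- 1/γ(A_j) multiply to at most 1/γ(A) = M².
  have hbound : ∀ p ν, ‖c ν * ⨍ y in Set.univ.pi (B p), hermiteProd ν y ∂(gauss ι)‖ ≤
      |c ν| * √(∏ j ∈ ν.support, K * ((ν j : ℝ) + 1)) * M := by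
    intro p ν
    rw [norm_mul, Real.norm_eq_abs, Real.norm_eq_abs, mul_assoc]
    refine mul_le_mul_of_nonneg_left ?_ (abs_nonneg _)
    rw [hM, ← Real.sqrt_mul (Finset.prod_nonneg fun j _ => hKn _)]
    refine Real.abs_le_sqrt ?_
    rw [setAverage_hermiteProd (hBm p) (hB0 p), ← Finset.prod_pow]
    refine le_trans ?_ (mul_le_mul_of_nonneg_left
      (prod_inv_measureReal_le hA hwpos.ne' ν.support) (Finset.prod_nonneg fun j _ => hKn _))
    rw [← Finset.prod_mul_distrib]
    refine Finset.prod_le_prod (fun _ _ => sq_nonneg _) fun j _ => ?_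
    have hA1 : 1 ≤ ((gaussianReal 0 1).real (A j))⁻¹ := by
      refine (one_le_inv₀ ?_).2 measureReal_le_one
      exact lt_of_le_of_ne measureReal_nonneg
        (measureReal_ne_zero (ne_zero_of_pi_ne_zero hA hwpos.ne' j)).symm
    by_cases hj : j ∈ p.1
    · simp only [B, if_pos hj]
      refine le_trans ?_ (le_mul_of_one_le_right (hKn _) hA1)
      have h1 : ⨍ t in I j p.2, hermiteFn (ν j) t ∂(gaussianReal 0 1) ∈
          Metric.closedBall 0 √(K * ((ν j : ℝ) + 1)) := by
        refine (convex_closedBall _ _).set_average_mem Metric.isClosed_closedBall (hIpos j p.2)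
          (measure_ne_top _ _) ?_ (integrable_hermiteFn (ν j)).integrableOn
        refine (ae_restrict_iff' measurableSet_Icc).2 (Eventually.of_forall fun t ht => ?_)
        rw [mem_closedBall_zero_iff, Real.norm_eq_abs]
        exact Real.abs_le_sqrt (hIK j p.2 (ν j) t ht)
      rw [mem_closedBall_zero_iff, Real.norm_eq_abs] at h1
      calc _ = |⨍ t in I j p.2, hermiteFn (ν j) t ∂(gaussianReal 0 1)| ^ 2 := (sq_abs _).symm
        _ ≤ √(K * ((ν j : ℝ) + 1)) ^ 2 := by gcongr
        _ = K * ((ν j : ℝ) + 1) := Real.sq_sqrt (hKn _)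
    · simp only [B, if_neg hj]
      refine (sq_setAverage_hermiteFn_le (ν j) (ne_zero_of_pi_ne_zero hA hwpos.ne' j)).trans ?_
      refine le_mul_of_one_le_left (by linarith) ?_
      nlinarith [Nat.cast_nonneg (α := ℝ) (ν j)]
  have hlim1 : ∀ j m, Tendsto (fun n => ⨍ t in I j n, hermiteFn m t ∂(gaussianReal 0 1)) atTop
      (𝓝 (hermiteFn m (y₀ j))) := by
    intro j m
    rw [Metric.tendsto_atTop']
    intro η hη
    obtain ⟨δ, hδ, hδη⟩ := Metric.continuous_iff.1 (continuous_hermiteFn m) (y₀ j) (η / 2)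
      (half_pos hη)
    obtain ⟨n₀, hn₀⟩ := exists_nat_one_div_lt hδ
    refine ⟨n₀, fun n hn => lt_of_le_of_lt ?_ (half_lt_self hη)⟩
    refine (convex_closedBall (hermiteFn m (y₀ j)) (η / 2)).set_average_mem
      Metric.isClosed_closedBall (hIpos j n) (measure_ne_top _ _) ?_
      (integrable_hermiteFn m).integrableOn
    refine (ae_restrict_iff' measurableSet_Icc).2 (Eventually.of_forall fun t ht => ?_)
    refine (hδη t ?_).le
    rw [Real.dist_eq]
    refine (hIabs ht).trans_lt ((min_le_right _ _).trans_lt (lt_of_le_of_lt ?_ hn₀))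
    exact Nat.one_div_le_one_div hn.le
  have hlim2 : ∀ ν, Tendsto (fun p => c ν * ⨍ y in Set.univ.pi (B p), hermiteProd ν y ∂(gauss ι))
      (atTop ×ˢ atTop) (𝓝 (c ν * hermiteProd ν y₀)) := by
    intro ν
    refine Tendsto.const_mul _ ?_
    have h1 : Tendsto (fun p : Finset ι × ℕ => ∏ j ∈ ν.support,
        ⨍ t in I j p.2, hermiteFn (ν j) t ∂(gaussianReal 0 1)) (atTop ×ˢ atTop)
        (𝓝 (hermiteProd ν y₀)) :=
      tendsto_finsetProd _ fun j _ => (hlim1 j (ν j)).comp tendsto_snd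
    refine h1.congr' ?_
    filter_upwards [tendsto_fst.eventually (eventually_ge_atTop ν.support)] with p hp
    rw [setAverage_hermiteProd (hBm p) (hB0 p)]
    refine Finset.prod_congr rfl fun j hj => ?_
    simp only [B, if_pos (hp hj)]
  have hlim := tendsto_tsum_of_dominated_convergence ((hs K hK1).mul_right M) hlim2
    (Eventually.of_forall fun p ν => hbound p ν)
  -- Every box average of h is within ε of h y₀, and these averages converge to the Hermite series
  -- at y₀.
  refine le_of_tendsto (hlim.dist tendsto_const_nhds) (Eventually.of_forall fun p => ?_)
  rw [(hpars p).tsum_eq]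
  exact hclose p

end PointEvaluation

end SparseQuad
namespace SparseQuad

open Filter Topology

section Weights

variable {ι : Type*}

/-! ### Sums of products over multi-indices -/

theorem sum_finsupp_prod {R : Type*} [CommSemiring R] (s : Finset ι) (t : ι → Finset ℕ)
    (g : ι → ℕ → R) :
    ∑ ν ∈ s.finsupp t, ∏ j ∈ s, g j (ν j) = ∏ j ∈ s, ∑ n ∈ t j, g j n := by
  classical
  rw [Finset.prod_sum, Finset.finsupp, Finset.sum_map]
  refine Finset.sum_congr rfl fun p _ => ?_
  rw [← Finset.prod_attach]
  refine Finset.prod_congr rfl fun x _ => ?_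
  simp [Finsupp.indicator_of_mem x.2]

/-- A finite partial sum lies in a box of multi-indices, where it factorizes into ∏ (1 + ∑_{n ≥ 1}
a_j(n)). Each factor is at most exp(u_j ∑ v), so the product is at most exp(∑ u · ∑ v). -/
theorem summable_prod_finsupp {a : ι → ℕ → ℝ} {u : ι → ℝ} {v : ℕ → ℝ}
    (ha : ∀ j n, 0 ≤ a j n) (hu0 : ∀ j, 0 ≤ u j) (hv0 : ∀ n, 0 ≤ v n)
    (hle : ∀ j n, n ≠ 0 → a j n ≤ u j * v n) (hu : Summable u) (hv : Summable v) :
    Summable fun ν : ι →₀ ℕ => ∏ j ∈ ν.support, a j (ν j) := by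
  classical
  refine summable_of_sum_le (c := Real.exp ((∑' j, u j) * ∑' n, v n))
    (fun ν => Finset.prod_nonneg fun j _ => ha j _) fun F => ?_
  set s := F.sup Finsupp.support with hs
  set N := F.sup (fun ν => ν.support.sup fun j => ν j) with hN
  have hsub : ∀ ν ∈ F, ν.support ⊆ s := fun ν hν => Finset.le_sup (f := Finsupp.support) hν
  let a' : ι → ℕ → ℝ := fun j n => if n = 0 then 1 else a j n
  have ha' : ∀ j n, 0 ≤ a' j n := fun j n => by
    simp only [a']
    split_ifs
    exacts [zero_le_one, ha j n]
  have hFs : F ⊆ s.finsupp fun _ => Finset.range (N + 1) := by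
    intro ν hν
    refine Finset.mem_finsupp_iff.2 ⟨hsub ν hν, fun j _ => ?_⟩
    rw [Finset.mem_range, Nat.lt_succ_iff]
    by_cases hj : j ∈ ν.support
    · exact (Finset.le_sup (f := fun j => ν j) hj).trans
        (Finset.le_sup (f := fun ν : ι →₀ ℕ => ν.support.sup fun j => ν j) hν)
    · rw [Finsupp.notMem_support_iff.1 hj]
      exact Nat.zero_le _
  have hV : 0 ≤ ∑' n, v n := tsum_nonneg hv0
  calc ∑ ν ∈ F, ∏ j ∈ ν.support, a j (ν j) = ∑ ν ∈ F, ∏ j ∈ s, a' j (ν j) := by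
        refine Finset.sum_congr rfl fun ν hν => ?_
        have h1 : ∏ j ∈ ν.support, a j (ν j) = ∏ j ∈ ν.support, a' j (ν j) :=
          Finset.prod_congr rfl fun j hj => by
            simp only [a', if_neg (Finsupp.mem_support_iff.1 hj)]
        rw [h1]
        refine Finset.prod_subset (hsub ν hν) fun j _ hj => ?_
        simp only [a', if_pos (Finsupp.notMem_support_iff.1 hj)]
    _ ≤ ∑ ν ∈ s.finsupp fun _ => Finset.range (N + 1), ∏ j ∈ s, a' j (ν j) :=
        Finset.sum_le_sum_of_subset_of_nonneg hFs fun ν _ _ =>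
          Finset.prod_nonneg fun j _ => ha' j _
    _ = ∏ j ∈ s, ∑ n ∈ Finset.range (N + 1), a' j n := sum_finsupp_prod _ _ _
    _ ≤ ∏ j ∈ s, Real.exp (u j * ∑' n, v n) := by
        refine Finset.prod_le_prod (fun j _ => Finset.sum_nonneg fun n _ => ha' j n)
          fun j _ => ?_
        rw [Finset.sum_range_succ']
        have h1 : ∑ n ∈ Finset.range N, a' j (n + 1) ≤ u j * ∑' n, v n := by
          calc _ ≤ ∑ n ∈ Finset.range N, u j * v (n + 1) := by
                refine Finset.sum_le_sum fun n _ => ?_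
                simp only [a', if_neg n.succ_ne_zero]
                exact hle j _ n.succ_ne_zero
            _ = u j * ∑ n ∈ Finset.range N, v (n + 1) := by rw [Finset.mul_sum]
            _ ≤ u j * ∑' n, v n := by
                refine mul_le_mul_of_nonneg_left ?_ (hu0 j)
                refine le_trans ?_ (hv.sum_le_tsum (Finset.range (N + 1)) fun n _ => hv0 n)
                rw [Finset.sum_range_succ' v]
                linarith [hv0 0]
        have h2 : a' j 0 = 1 := by simp [a']
        rw [h2]
        exact (add_le_add_left h1 1).trans (Real.add_one_le_exp _)
    _ = Real.exp ((∑ j ∈ s, u j) * ∑' n, v n) := by rw [← Real.exp_sum, Finset.sum_mul]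
    _ ≤ _ := by
        rw [Real.exp_le_exp]
        exact mul_le_mul_of_nonneg_right (hu.sum_le_tsum s fun j _ => hu0 j) hV

/-! ### The weights `b_ν` -/

/-- The univariate factor of `b_ν`. -/
noncomputable def bFactor (t : ℝ) (r n : ℕ) : ℝ :=
  ∑ k ∈ Finset.range (r + 1), (n.choose k : ℝ) * t ^ (2 * k)

theorem bWeight_eq_prod (τ : ι → ℝ) (r : ℕ) (ν : ι →₀ ℕ) :
    bWeight τ r ν = ∏ j ∈ ν.support, bFactor (τ j) r (ν j) := by
  classical
  have e : ∀ j, bFactor (τ j) r (ν j) = ∑ k ∈ Finset.range (min (ν j) r + 1),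
      ((ν j).choose k : ℝ) * τ j ^ (2 * k) := by
    intro j
    symm
    refine Finset.sum_subset (Finset.range_mono (by omega)) fun k hk hk' => ?_
    rw [Finset.mem_range] at hk hk'
    rw [Nat.choose_eq_zero_of_lt (by omega)]
    simp
  simp_rw [e]
  rw [← sum_finsupp_prod ν.support (fun j => Finset.range (min (ν j) r + 1))
    (fun j k => ((ν j).choose k : ℝ) * τ j ^ (2 * k)), bWeight]
  refine Finset.sum_congr ?_ fun _ _ => rfl
  ext μ
  rw [Finset.mem_filter, Finset.mem_Iic, Finset.mem_finsupp_iff]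
  constructor
  · rintro ⟨h1, h2⟩
    refine ⟨fun j hj => ?_, fun j _ => ?_⟩
    · rw [Finsupp.mem_support_iff] at hj ⊢
      have := h1 j
      omega
    · rw [Finset.mem_range]
      have := h1 j
      have := h2 j
      omega
  · rintro ⟨h1, h2⟩
    have h3 : ∀ j, μ j ≤ min (ν j) r := by
      intro j
      by_cases hj : j ∈ ν.support
      · exact Nat.lt_succ_iff.1 (Finset.mem_range.1 (h2 j hj))
      · rw [Finsupp.notMem_support_iff.1 fun h => hj (h1 h)]
        exact Nat.zero_le _
    exact ⟨fun j => (h3 j).trans (min_le_left _ _), fun j => (h3 j).trans (min_le_right _ _)⟩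

theorem bFactor_mono {t : ℝ} (ht : 0 ≤ t) (r : ℕ) {m n : ℕ} (h : m ≤ n) :
    bFactor t r m ≤ bFactor t r n := by
  refine Finset.sum_le_sum fun k _ => ?_
  have : (m.choose k : ℝ) ≤ n.choose k := by exact_mod_cast Nat.choose_le_choose k h
  gcongr

theorem bFactor_zero (t : ℝ) (r : ℕ) : bFactor t r 0 = 1 := by
  rw [bFactor, Finset.sum_range_succ']
  simp

theorem one_le_bFactor {t : ℝ} (ht : 0 ≤ t) (r n : ℕ) : 1 ≤ bFactor t r n := by
  rw [← bFactor_zero t r]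
  exact bFactor_mono ht r (Nat.zero_le n)

theorem bWeight_eq_prod_of_subset {τ : ι → ℝ} {r : ℕ} {ν : ι →₀ ℕ} {s : Finset ι}
    (hs : ν.support ⊆ s) : bWeight τ r ν = ∏ j ∈ s, bFactor (τ j) r (ν j) := by
  rw [bWeight_eq_prod]
  refine Finset.prod_subset hs fun j _ hj => ?_
  rw [Finsupp.notMem_support_iff.1 hj, bFactor_zero]

theorem one_le_bWeight {τ : ι → ℝ} (hτ : ∀ j, 0 < τ j) (r : ℕ) (ν : ι →₀ ℕ) :
    1 ≤ bWeight τ r ν := by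
  rw [bWeight_eq_prod]
  exact Finset.one_le_prod fun j _ => one_le_bFactor (hτ j).le r _

theorem bWeight_mono {τ : ι → ℝ} (hτ : ∀ j, 0 < τ j) (r : ℕ) {μ ν : ι →₀ ℕ} (h : μ ≤ ν) :
    bWeight τ r μ ≤ bWeight τ r ν := by
  rw [bWeight_eq_prod_of_subset (Finsupp.support_mono h), bWeight_eq_prod]
  exact Finset.prod_le_prod (fun j _ => zero_le_one.trans (one_le_bFactor (hτ j).le r _))
    fun j _ => bFactor_mono (hτ j).le r (h j)

/-- A lower bound for the growth of `bFactor` in both variables. -/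
noncomputable def theta (r : ℕ) (t : ℝ) : ℝ := if 1 ≤ t then t ^ 2 else t ^ (2 * r)

theorem theta_pos (r : ℕ) {t : ℝ} (ht : 0 < t) : 0 < theta r t := by
  unfold theta
  split_ifs <;> positivity

theorem theta_le_pow {r k : ℕ} (hk1 : 1 ≤ k) (hkr : k ≤ r) {t : ℝ} (ht : 0 < t) :
    theta r t ≤ t ^ (2 * k) := by
  unfold theta
  split_ifs with h
  · exact pow_le_pow_right₀ h (by omega)
  · exact pow_le_pow_of_le_one ht.le (by linarith) (by omega)

theorem le_choose {r n : ℕ} (hr : 1 ≤ r) (hn : r ≤ n) :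
    (n : ℝ) ^ r / ((r : ℝ) ^ r * r.factorial) ≤ n.choose r := by
  refine le_trans ?_ (Nat.pow_le_choose r n)
  rw [← div_div, ← div_pow]
  have hr0 : (0 : ℝ) < r := by exact_mod_cast hr
  gcongr
  rw [div_le_iff₀ hr0]
  have h1 : ((n + 1 - r : ℕ) : ℝ) = n - r + 1 := by
    rw [Nat.cast_sub (by omega)]
    push_cast
    ring
  rw [h1]
  have h2 : (1 : ℝ) ≤ r := by exact_mod_cast hr
  have h3 : (r : ℝ) ≤ n := by exact_mod_cast hn
  nlinarith

/-- A single term suffices: k = r when n ≥ r, and k = 1 when 0 < n < r, where the constant in front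
of θ is at most 1. -/
theorem le_bFactor {r n : ℕ} (hr : 1 ≤ r) (hn : n ≠ 0) {t : ℝ} (ht : 0 < t) :
    (n : ℝ) ^ r / ((r : ℝ) ^ r * r.factorial) * theta r t ≤ bFactor t r n := by
  have hr0 : (0 : ℝ) < r := by exact_mod_cast hr
  have hf : (1 : ℝ) ≤ r.factorial := by exact_mod_cast r.factorial_pos
  have hth := theta_pos r ht
  have hsingle : ∀ k ≤ r, (n.choose k : ℝ) * t ^ (2 * k) ≤ bFactor t r n := fun k hk =>
    Finset.single_le_sum (f := fun k => (n.choose k : ℝ) * t ^ (2 * k))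
      (fun _ _ => by positivity) (Finset.mem_range.2 (by omega))
  rcases le_or_gt r n with h | h
  · refine le_trans ?_ (hsingle r le_rfl)
    have := le_choose hr h
    have := theta_le_pow hr le_rfl ht
    gcongr
  · refine le_trans ?_ (hsingle 1 hr)
    have h1 : (n : ℝ) ^ r / ((r : ℝ) ^ r * r.factorial) ≤ 1 := by
      rw [div_le_one (by positivity)]
      have h2 : (n : ℝ) ^ r ≤ (r : ℝ) ^ r := by gcongr
      nlinarith [pow_pos hr0 r]
    have h2 : (1 : ℝ) ≤ n.choose 1 := by
      rw [Nat.choose_one_right]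
      exact_mod_cast Nat.one_le_iff_ne_zero.2 hn
    have := theta_le_pow le_rfl hr ht
    exact mul_le_mul (h1.trans h2) this hth.le (by positivity)

/-- Only finitely many τ_j are below 1, and for all others θ(τ_j)^{-q/2} is exactly τ_j^{-q}. -/
theorem summable_theta {τ : ι → ℝ} (hτ : ∀ j, 0 < τ j) {q : ℝ} (hq : 0 < q)
    (hτq : Summable fun j => (τ j)⁻¹ ^ q) (r : ℕ) :
    Summable fun j => theta r (τ j) ^ (-(q / 2)) := by
  refine hτq.congr_cofinite ?_
  have h1 := hτq.tendsto_cofinite_zero.eventually (gt_mem_nhds zero_lt_one)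
  filter_upwards [h1] with j hj
  have h2 : 1 ≤ τ j := by
    by_contra! h
    refine absurd hj (not_lt.2 ?_)
    exact Real.one_le_rpow ((one_le_inv₀ (hτ j)).2 h.le) hq.le
  rw [theta, if_pos h2, ← Real.rpow_natCast, ← Real.rpow_mul (hτ j).le,
    Real.inv_rpow (hτ j).le, ← Real.rpow_neg (hτ j).le]
  congr 1
  push_cast
  ring

/-- The weighted summability behind all convergence rates. -/
theorem summable_bWeight_rpow {τ : ι → ℝ} (hτ : ∀ j, 0 < τ j) {q : ℝ} (hq : 0 < q)
    (hτq : Summable fun j => (τ j)⁻¹ ^ q) {r : ℕ} (hr : 14 / q < (r : ℝ)) {c : ℝ} (hc : 0 ≤ c) :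
    Summable fun ν : ι →₀ ℕ =>
      bWeight τ r ν ^ (-(q / 2)) * ∏ j ∈ ν.support, c * (ν j : ℝ) ^ 6 := by
  have hr1 : 1 ≤ r := by
    have : (0 : ℝ) < r := lt_trans (by positivity) hr
    exact_mod_cast this
  -- The source of the constant 14: ∑ n^{6 − rq/2} must converge, and 6 is twice the exponent 3 in
  -- the bound for the quadrature of H_n.
  have hrq : 7 < r * q / 2 := by
    rw [div_lt_iff₀ hq] at hr
    linarith
  set κ : ℝ := ((r : ℝ) ^ r * r.factorial) with hκ
  have hκ0 : 0 < κ := by positivity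
  have h := summable_prod_finsupp
    (a := fun j n => bFactor (τ j) r n ^ (-(q / 2)) * (c * (n : ℝ) ^ 6))
    (u := fun j => theta r (τ j) ^ (-(q / 2)))
    (v := fun n => c * κ ^ (q / 2) * (n : ℝ) ^ (6 - r * q / 2))
    (fun j n => by
      have := zero_le_one.trans (one_le_bFactor (hτ j).le r n)
      positivity)
    (fun j => (Real.rpow_pos_of_pos (theta_pos r (hτ j)) _).le)
    (fun n => by positivity)
    (fun j n hn => by
      have hn0 : (0 : ℝ) < n := by exact_mod_cast Nat.pos_of_ne_zero hn
      have h1 := le_bFactor hr1 hn (hτ j)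
      have hth := theta_pos r (hτ j)
      have h2 : bFactor (τ j) r n ^ (-(q / 2)) ≤
          ((n : ℝ) ^ r / κ * theta r (τ j)) ^ (-(q / 2)) :=
        Real.rpow_le_rpow_of_nonpos (by positivity) h1 (by linarith)
      have h3 : ((n : ℝ) ^ r / κ * theta r (τ j)) ^ (-(q / 2)) =
          (n : ℝ) ^ (-(r * q / 2)) * κ ^ (q / 2) * theta r (τ j) ^ (-(q / 2)) := by
        rw [Real.mul_rpow (by positivity) hth.le, Real.div_rpow (by positivity) hκ0.le,
          ← Real.rpow_natCast, ← Real.rpow_mul hn0.le, Real.rpow_neg hκ0.le, div_inv_eq_mul]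
        congr 3
        ring
      calc bFactor (τ j) r n ^ (-(q / 2)) * (c * (n : ℝ) ^ 6)
          ≤ (n : ℝ) ^ (-(r * q / 2)) * κ ^ (q / 2) * theta r (τ j) ^ (-(q / 2)) *
            (c * (n : ℝ) ^ 6) := by
            rw [← h3]
            gcongr
        _ = theta r (τ j) ^ (-(q / 2)) * (c * κ ^ (q / 2) *
            ((n : ℝ) ^ (6 : ℝ) * (n : ℝ) ^ (-(r * q / 2)))) := by
            have h6 : (n : ℝ) ^ (6 : ℝ) = (n : ℝ) ^ 6 := by
              rw [← Real.rpow_natCast]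
              norm_num
            rw [h6]
            ring
        _ = _ := by rw [← Real.rpow_add hn0, ← sub_eq_add_neg])
    (summable_theta hτ hq hτq r)
    ((Real.summable_nat_rpow.2 (by linarith)).mul_left _)
  refine h.congr fun ν => ?_
  rw [bWeight_eq_prod, ← Real.finsetProd_rpow _ _
    (fun j _ => zero_le_one.trans (one_le_bFactor (hτ j).le r _)), ← Finset.prod_mul_distrib]

/-- Only finitely many weights lie below a given bound. -/
theorem finite_bWeight_le {τ : ι → ℝ} (hτ : ∀ j, 0 < τ j) {q : ℝ} (hq : 0 < q)
    (hτq : Summable fun j => (τ j)⁻¹ ^ q) {r : ℕ} (hr : 14 / q < (r : ℝ)) (B : ℝ) :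
    {ν : ι →₀ ℕ | bWeight τ r ν ≤ B}.Finite := by
  rcases lt_or_ge B 1 with hB | hB
  · convert Set.finite_empty
    ext ν
    simp only [Set.mem_ofPred_eq, Set.mem_empty_iff_false, iff_false, not_le]
    exact hB.trans_le (one_le_bWeight hτ r ν)
  have h := (summable_bWeight_rpow hτ hq hτq hr zero_le_one).tendsto_cofinite_zero
  have hB0 : 0 < B ^ (-(q / 2)) := Real.rpow_pos_of_pos (zero_lt_one.trans_le hB) _
  refine (Filter.eventually_cofinite.1 (h.eventually (gt_mem_nhds hB0))).subset fun ν hν => ?_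
  simp only [Set.mem_ofPred_eq, not_lt, one_mul] at hν ⊢
  have hb := zero_lt_one.trans_le (one_le_bWeight hτ r ν)
  have h1 : B ^ (-(q / 2)) ≤ bWeight τ r ν ^ (-(q / 2)) :=
    Real.rpow_le_rpow_of_nonpos hb hν (by linarith)
  refine h1.trans (le_mul_of_one_le_right (Real.rpow_pos_of_pos hb _).le ?_)
  refine Finset.one_le_prod fun j hj => one_le_pow₀ ?_
  exact_mod_cast Nat.one_le_iff_ne_zero.2 (Finsupp.mem_support_iff.1 hj)

/-! ### Admissible sets of smallest weights -/

theorem exists_admissible_isSmallest [Nonempty ι] {τ : ι → ℝ} {r : ℕ} (hτ : ∀ j, 0 < τ j)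
    (hfin : ∀ B, {ν : ι →₀ ℕ | bWeight τ r ν ≤ B}.Finite) (N : ℕ) :
    ∃ Λ : Finset (ι →₀ ℕ), Admissible Λ ∧ IsSmallest τ r N Λ := by
  classical
  induction N with
  | zero => exact ⟨∅, by simp [Admissible], by simp [IsSmallest]⟩
  | succ N ih =>
    obtain ⟨Λ, hadm, hcard, hsm⟩ := ih
    obtain ⟨ν₀, hν₀⟩ := Infinite.exists_notMem_finset Λ
    have hfin1 : ({ν : ι →₀ ℕ | bWeight τ r ν ≤ bWeight τ r ν₀} \ Λ).Finite :=
      (hfin _).subset Set.sdiff_subset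
    obtain ⟨ν₁, hν₁, hmin₁⟩ := hfin1.exists_minimalFor (bWeight τ r) _ ⟨ν₀, by simp [hν₀]⟩
    have hmin : ∀ ν ∉ Λ, bWeight τ r ν₁ ≤ bWeight τ r ν := by
      intro ν hν
      rcases le_total (bWeight τ r ν) (bWeight τ r ν₀) with h | h
      · rcases le_total (bWeight τ r ν₁) (bWeight τ r ν) with h' | h'
        · exact h'
        · exact hmin₁ ⟨h, hν⟩ h'
      · exact hν₁.1.trans h
    have hfin2 : ({ν : ι →₀ ℕ | bWeight τ r ν ≤ bWeight τ r ν₁} \ Λ).Finite :=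
      (hfin _).subset Set.sdiff_subset
    -- Among the remaining indices of smallest weight a coordinatewise minimal one is taken. As b is
    -- monotone, anything strictly below it must already lie in Λ, so the enlarged set stays
    -- admissible.
    obtain ⟨ν₂, hν₂, hmin₂⟩ := hfin2.exists_minimalFor id _ ⟨ν₁, le_refl (bWeight τ r ν₁), hν₁.2⟩
    have hν₂' : ∀ ν ∉ Λ, bWeight τ r ν₂ ≤ bWeight τ r ν := fun ν hν => hν₂.1.trans (hmin ν hν)
    have hν₂Λ : ν₂ ∉ Λ := hν₂.2
    refine ⟨insert ν₂ Λ, ?_, ?_, ?_⟩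
    · intro ν hν μ hμ
      rcases Finset.mem_insert.1 hν with rfl | hν
      · by_contra hμΛ
        rw [Finset.mem_insert, not_or] at hμΛ
        have h1 : bWeight τ r μ ≤ bWeight τ r ν₁ := (bWeight_mono hτ r hμ).trans hν₂.1
        have h2 : ν ≤ μ := hmin₂ ⟨h1, hμΛ.2⟩ hμ
        exact hμΛ.1 (le_antisymm hμ h2)
      · exact Finset.mem_insert_of_mem (hadm ν hν μ hμ)
    · rw [Finset.card_insert_of_notMem hν₂Λ, hcard]
    · intro μ hμ ν hν
      rw [Finset.mem_insert, not_or] at hν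
      rcases Finset.mem_insert.1 hμ with rfl | hμ
      · exact hν₂' ν hν.2
      · exact hsm μ hμ ν hν.2

/-! ### The number of quadrature points -/

/-- The grid has at most ∏ (ν_j + 1) points, which is the number of μ ≤ ν, and admissibility puts
all of these in Λ. -/
theorem card_grid_le {Λ : Finset (ι →₀ ℕ)} (hΛ : Admissible Λ) {ν : ι →₀ ℕ} (hν : ν ∈ Λ) :
    (grid ν).card ≤ Λ.card := by
  classical
  calc (grid ν).card ≤ ∏ j : ν.support, (nodes (ν j)).card := by
        refine Finset.card_image_le.trans_eq ?_
        rw [Fintype.card_piFinset]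
    _ = ∏ j ∈ ν.support, (Finset.Iic (ν j)).card := by
        rw [Finset.prod_coe_sort ν.support fun j => (nodes (ν j)).card]
        simp [card_nodes]
    _ = (Finset.Iic ν).card := (Finsupp.card_Iic ν).symm
    _ ≤ Λ.card := Finset.card_le_card fun μ hμ => hΛ ν hν μ (Finset.mem_Iic.1 hμ)

theorem numPoints_le {Λ : Finset (ι →₀ ℕ)} (hΛ : Admissible Λ) :
    numPoints Λ ≤ Λ.card ^ 2 := by
  classical
  calc numPoints Λ ≤ ∑ ν ∈ Λ, (grid ν).card := Finset.card_biUnion_le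
    _ ≤ ∑ ν ∈ Λ, Λ.card := Finset.sum_le_sum fun ν hν => card_grid_le hΛ hν
    _ = Λ.card ^ 2 := by rw [Finset.sum_const, smul_eq_mul, sq]

theorem grid_zero : (grid (0 : ι →₀ ℕ)).Nonempty := by
  classical
  unfold grid
  rw [Finset.image_nonempty]
  have h : ∀ j : ι, j ∉ (0 : ι →₀ ℕ).support := fun j => by simp
  exact ⟨fun j => absurd j.2 (h j), Fintype.mem_piFinset.2 fun j => absurd j.2 (h j)⟩

theorem numPoints_pos {Λ : Finset (ι →₀ ℕ)} (h : (0 : ι →₀ ℕ) ∈ Λ) : 0 < numPoints Λ := by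
  classical
  obtain ⟨y, hy⟩ := grid_zero (ι := ι)
  exact Finset.card_pos.2 ⟨y, Finset.mem_biUnion.2 ⟨0, h, hy⟩⟩

end Weights

end SparseQuad
namespace SparseQuad

open Filter Topology

section TensorQuadrature

variable {ι : Type*}

/-! ### The sparse quadrature of Hermite polynomials -/

/-- The difference operators on the univariate Hermite polynomials. -/
noncomputable def diffHermite (l n : ℕ) : ℝ :=
  Finsupp.linearCombination ℝ (hermiteFn n) (diffQuad l)

theorem diffHermite_zero_left (n : ℕ) : diffHermite 0 n = hermiteFn n 0 := by
  simp [diffHermite, diffQuad_zero]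

theorem tensorApply_hermiteProd (J : Finset ι) (q : ι → (ℝ →₀ ℝ)) (μ : ι →₀ ℕ)
    [DecidableEq ι] :
    tensorApply J q (hermiteProd μ) =
      (∏ j ∈ J, Finsupp.linearCombination ℝ (hermiteFn (μ j)) (q j)) *
        ∏ j ∈ μ.support \ J, hermiteFn (μ j) 0 := by
  have e : ∀ k : J → ℝ, hermiteProd μ (extendZero J k) =
      (∏ j : J, hermiteFn (μ j) (k j)) * ∏ j ∈ μ.support \ J, hermiteFn (μ j) 0 := by
    intro k
    have h1 : μ.support ⊆ J ∪ μ.support \ J := by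
      intro j hj
      by_cases h : j ∈ J <;> simp [h, Finsupp.mem_support_iff.1 hj]
    rw [hermiteProd_eq h1, Finset.prod_union Finset.disjoint_sdiff, ← Finset.prod_coe_sort J]
    congr 1
    · refine Finset.prod_congr rfl fun j _ => ?_
      simp [extendZero]
    · refine Finset.prod_congr rfl fun j hj => ?_
      simp [extendZero, (Finset.mem_sdiff.1 hj).2]
  simp only [tensorApply, e, smul_eq_mul, ← mul_assoc]
  rw [← Finset.sum_mul]
  congr 1
  simp_rw [← Finset.prod_mul_distrib]
  rw [← Finset.prod_coe_sort J]
  simp only [Finsupp.linearCombination_apply, Finsupp.sum, smul_eq_mul]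
  rw [Finset.prod_univ_sum]
  refine Finset.sum_congr ?_ fun _ _ => rfl
  congr!

/-- The rule of level 0 is evaluation at 0, so setting the coordinates outside supp ν to 0 is the
same as applying the level-0 difference there. -/
theorem tensorDiff_hermiteProd (ν μ : ι →₀ ℕ) {s : Finset ι} (hν : ν.support ⊆ s)
    (hμ : μ.support ⊆ s) :
    tensorDiff ν (hermiteProd μ) = ∏ j ∈ s, diffHermite (ν j) (μ j) := by
  classical
  rw [tensorDiff, tensorApply_hermiteProd]
  have h1 : ∏ j ∈ s, diffHermite (ν j) (μ j) = ∏ j ∈ ν.support ∪ μ.support \ ν.support,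
      diffHermite (ν j) (μ j) := by
    rw [Finset.union_sdiff_self_eq_union]
    symm
    refine Finset.prod_subset (Finset.union_subset hν hμ) fun j _ hj => ?_
    rw [Finset.mem_union, not_or, Finsupp.notMem_support_iff, Finsupp.notMem_support_iff] at hj
    rw [hj.1, hj.2, diffHermite_zero_left, hermiteFn_zero]
  rw [h1, Finset.prod_union Finset.disjoint_sdiff]
  congr 1
  refine Finset.prod_congr rfl fun j hj => ?_
  rw [Finsupp.notMem_support_iff.1 (Finset.mem_sdiff.1 hj).2, diffHermite_zero_left]

theorem tensorDiff_hermiteProd_of_not_le {ν μ : ι →₀ ℕ} (h : ¬ν ≤ μ) :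
    tensorDiff ν (hermiteProd μ) = 0 := by
  classical
  rw [tensorDiff_hermiteProd ν μ Finset.subset_union_left Finset.subset_union_right]
  rw [Finsupp.le_def, not_forall] at h
  obtain ⟨j, hj⟩ := h
  rw [not_le] at hj
  refine Finset.prod_eq_zero (i := j) ?_ (diffQuad_hermiteFn_of_lt hj)
  refine Finset.mem_union_left _ (Finsupp.mem_support_iff.2 ?_)
  omega

theorem mem_finsupp_range_iff_le (ν μ : ι →₀ ℕ) :
    ν ∈ μ.support.finsupp (fun j => Finset.range (μ j + 1)) ↔ ν ≤ μ := by
  rw [Finset.mem_finsupp_iff]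
  constructor
  · rintro ⟨h1, h2⟩ j
    by_cases hj : j ∈ μ.support
    · exact Nat.lt_succ_iff.1 (Finset.mem_range.1 (h2 j hj))
    · rw [Finsupp.notMem_support_iff.1 fun h => hj (h1 h)]
      exact Nat.zero_le _
  · intro h
    exact ⟨Finsupp.support_mono h, fun j _ => Finset.mem_range.2 (Nat.lt_succ_iff.2 (h j))⟩

/-- Sparse quadrature is exact on `H_μ`, `μ ∈ Λ`. -/
theorem sparseQuad_hermiteProd_of_mem {Λ : Finset (ι →₀ ℕ)} (hΛ : Admissible Λ) {μ : ι →₀ ℕ}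
    (hμ : μ ∈ Λ) [Decidable (μ = 0)] :
    sparseQuad Λ (hermiteProd μ) = if μ = 0 then 1 else 0 := by
  classical
  -- Only ν ≤ μ contribute, and Λ contains all of them. The sum then factorizes, and in each
  -- coordinate the differences telescope to Q_{μ_j} H_{μ_j}, which is exact.
  have hsub : μ.support.finsupp (fun j => Finset.range (μ j + 1)) ⊆ Λ := fun ν hν =>
    hΛ μ hμ ν ((mem_finsupp_range_iff_le ν μ).1 hν)
  rw [sparseQuad, ← Finset.sum_subset hsub fun ν _ hν => tensorDiff_hermiteProd_of_not_le fun h =>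
    hν ((mem_finsupp_range_iff_le ν μ).2 h)]
  rw [Finset.sum_congr rfl fun ν hν => tensorDiff_hermiteProd ν μ
    (Finset.mem_finsupp_iff.1 hν).1 subset_rfl]
  rw [sum_finsupp_prod μ.support _ fun j l => diffHermite l (μ j)]
  simp only [diffHermite, sum_diffQuad_hermiteFn]
  split_ifs with h
  · simp [h]
  · obtain ⟨j, hj⟩ := Finsupp.support_nonempty_iff.2 h
    exact Finset.prod_eq_zero hj (if_neg (Finsupp.mem_support_iff.1 hj))

/-- Differences with ν not below μ vanish. The absolute values over all ν ≤ μ, whether in Λ or not,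
factorize into univariate sums, so the bound does not depend on Λ. -/
theorem abs_sparseQuad_hermiteProd_le (Λ : Finset (ι →₀ ℕ)) (μ : ι →₀ ℕ) :
    |sparseQuad Λ (hermiteProd μ)| ≤ ∏ j ∈ μ.support, 16 * (μ j : ℝ) ^ 3 := by
  classical
  set I := μ.support.finsupp (fun j => Finset.range (μ j + 1)) with hI
  have h1 : sparseQuad Λ (hermiteProd μ) = ∑ ν ∈ Λ ∩ I, tensorDiff ν (hermiteProd μ) := by
    rw [sparseQuad]
    symm
    refine Finset.sum_subset Finset.inter_subset_left fun ν hν hν' => ?_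
    exact tensorDiff_hermiteProd_of_not_le fun h =>
      hν' (Finset.mem_inter.2 ⟨hν, (mem_finsupp_range_iff_le ν μ).2 h⟩)
  calc |sparseQuad Λ (hermiteProd μ)|
      ≤ ∑ ν ∈ Λ ∩ I, |tensorDiff ν (hermiteProd μ)| := by
        rw [h1]
        exact Finset.abs_sum_le_sum_abs _ _
    _ ≤ ∑ ν ∈ I, |tensorDiff ν (hermiteProd μ)| :=
        Finset.sum_le_sum_of_subset_of_nonneg Finset.inter_subset_right fun _ _ _ => abs_nonneg _
    _ = ∑ ν ∈ I, ∏ j ∈ μ.support, |diffHermite (ν j) (μ j)| := by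
        refine Finset.sum_congr rfl fun ν hν => ?_
        rw [tensorDiff_hermiteProd ν μ (Finset.mem_finsupp_iff.1 hν).1 subset_rfl,
          Finset.abs_prod]
    _ = ∏ j ∈ μ.support, ∑ l ∈ Finset.range (μ j + 1), |diffHermite l (μ j)| :=
        sum_finsupp_prod μ.support _ fun j l => |diffHermite l (μ j)|
    _ ≤ ∏ j ∈ μ.support, 16 * (μ j : ℝ) ^ 3 :=
        Finset.prod_le_prod (fun _ _ => Finset.sum_nonneg fun _ _ => abs_nonneg _) fun j hj =>
          sum_abs_diffQuad_hermiteFn_le _ (Finsupp.mem_support_iff.1 hj)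

theorem finite_support_extendZero (J : Finset ι) (k : J → ℝ) :
    (Function.support (extendZero J k)).Finite := by
  refine J.finite_toSet.subset fun j hj => ?_
  by_contra h
  exact hj (dif_neg h)

/-- Sparse quadrature acts termwise on series that converge at finitely supported points. -/
theorem hasSum_sparseQuad (Λ : Finset (ι →₀ ℕ)) {α : Type*} {c : α → ℝ}
    {H : α → (ι → ℝ) → ℝ} {h : (ι → ℝ) → ℝ}
    (hs : ∀ y : ι → ℝ, (Function.support y).Finite → HasSum (fun a => c a * H a y) (h y)) :
    HasSum (fun a => c a * sparseQuad Λ (H a)) (sparseQuad Λ h) := by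
  simp only [sparseQuad, tensorDiff, tensorApply, Finset.mul_sum]
  refine hasSum_sum fun ν _ => hasSum_sum fun k _ => ?_
  have h1 := (hs _ (finite_support_extendZero ν.support k)).const_smul
    (∏ j : ν.support, diffQuad (ν j) (k j))
  simp only [smul_eq_mul] at h1 ⊢
  simpa only [mul_left_comm] using h1

theorem map_sparseQuad {S : Type*} [NormedAddCommGroup S] [NormedSpace ℝ S]
    (L : S →L[ℝ] ℝ) (Λ : Finset (ι →₀ ℕ)) (f : (ι → ℝ) → S) :
    L (sparseQuad Λ f) = sparseQuad Λ fun y => L (f y) := by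
  simp only [sparseQuad, tensorDiff, tensorApply, map_sum, map_smul]

end TensorQuadrature

section Derivatives

variable {ι : Type*} {S : Type*} [NormedAddCommGroup S] [NormedSpace ℝ S]

/-! ### Hermite coefficients of mixed derivatives -/

/-- The factorial `ν! = ∏ ν_j!` of a multi-index. -/
noncomputable def multiFactorial (ν : ι →₀ ℕ) : ℝ := ν.prod fun _ n => (n.factorial : ℝ)

theorem multiFactorial_pos (ν : ι →₀ ℕ) : 0 < multiFactorial ν :=
  Finset.prod_pos fun j _ => by positivity

theorem multiFactorial_eq {ν : ι →₀ ℕ} {s : Finset ι} (hs : ν.support ⊆ s) :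
    multiFactorial ν = ∏ j ∈ s, ((ν j).factorial : ℝ) :=
  Finsupp.prod_of_support_subset ν hs _ (by simp)

theorem multiFactorial_add_single (ν : ι →₀ ℕ) (j : ι) :
    multiFactorial (ν + Finsupp.single j 1) = multiFactorial ν * ((ν j : ℝ) + 1) := by
  classical
  have hj : j ∈ insert j ν.support := Finset.mem_insert_self _ _
  have hsub : (ν + Finsupp.single j 1).support ⊆ insert j ν.support := by
    refine Finsupp.support_add.trans (Finset.union_subset (Finset.subset_insert _ _) ?_)
    exact Finsupp.support_single_subset.trans (by simp)
  rw [multiFactorial_eq hsub, multiFactorial_eq (Finset.subset_insert j ν.support),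
    ← Finset.mul_prod_erase _ _ hj, ← Finset.mul_prod_erase _ _ hj]
  have e : ∏ i ∈ (insert j ν.support).erase j, (((ν + Finsupp.single j 1 : ι →₀ ℕ) i).factorial : ℝ)
      = ∏ i ∈ (insert j ν.support).erase j, ((ν i).factorial : ℝ) := by
    refine Finset.prod_congr rfl fun i hi => ?_
    simp [Finset.ne_of_mem_erase hi]
  rw [e]
  simp only [Finsupp.coe_add, Pi.add_apply, Finsupp.single_eq_same, Nat.factorial_succ]
  push_cast
  ring

variable [CompleteSpace S] {r : ℕ} {f : (ι → ℝ) → S} {D : (ι →₀ ℕ) → (ι → ℝ) → S}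

theorem integral_hermiteProd_mul_map (L : S →L[ℝ] ℝ) {h : (ι → ℝ) → S}
    (hh : MemLp h 2 (gauss ι)) (κ : ι →₀ ℕ) :
    ∫ y, hermiteProd κ y * L (h y) ∂(gauss ι) = L (∫ y, hermiteProd κ y • h y ∂(gauss ι)) := by
  rw [← L.integral_comp_comm (integrable_smul_of_memLp (memLp_hermiteProd κ) hh)]
  simp

/-- The Hermite coefficients of the mixed derivatives in terms of those of `f`. -/
theorem multiFactorial_mul_integral_sq (hD : IsMixedDerivs r f D) (L : S →L[ℝ] ℝ) (n : ℕ) :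
    ∀ μ : ι →₀ ℕ, μ.degree = n → (∀ j, μ j ≤ r) → ∀ κ : ι →₀ ℕ,
      multiFactorial κ * (∫ y, hermiteProd κ y * L (D μ y) ∂(gauss ι)) ^ 2 =
        multiFactorial (κ + μ) *
          (∫ y, hermiteProd (κ + μ) y * L (f y) ∂(gauss ι)) ^ 2 := by
  classical
  induction n with
  | zero =>
    intro μ hμ _ κ
    rw [Finsupp.degree_eq_zero_iff] at hμ
    rw [hμ, add_zero, hD.zero]
  | succ n ih =>
    intro μ hμ hμr κ
    obtain ⟨j, hj⟩ : ∃ j, μ j ≠ 0 := by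
      by_contra! h
      have : μ = 0 := Finsupp.ext h
      rw [this, map_zero] at hμ
      omega
    obtain ⟨μ', rfl⟩ : ∃ μ', μ = μ' + Finsupp.single j 1 :=
      ⟨μ - Finsupp.single j 1, (tsub_add_cancel_of_le
        (Finsupp.single_le_iff.2 (Nat.one_le_iff_ne_zero.2 hj))).symm⟩
    have hμ' : ∀ i, μ' i ≤ r := fun i => by
      have := hμr i
      simp only [Finsupp.coe_add, Pi.add_apply] at this
      omega
    have hdeg : μ'.degree = n := by
      rw [map_add, Finsupp.degree_single] at hμ
      omega
    have hibp := integral_hermiteProd_smul_weakPartial (hD.memLp μ' hμ') (hD.memLp _ hμr)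
      (hD.succ μ' j hμr) κ
    have h1 := congrArg (fun x => L x ^ 2) hibp
    simp only [map_smul, smul_eq_mul, mul_pow] at h1
    rw [Real.sq_sqrt (by positivity)] at h1
    have h2 := ih μ' hdeg hμ' (κ + Finsupp.single j 1)
    rw [integral_hermiteProd_mul_map L (hD.memLp _ hμ')] at h2
    rw [integral_hermiteProd_mul_map L (hD.memLp _ hμr), h1, ← mul_assoc,
      ← multiFactorial_add_single, h2, add_assoc κ, add_comm (Finsupp.single j 1) μ']

theorem prod_choose_mul (τ : ι → ℝ) {μ ν : ι →₀ ℕ} (h : μ ≤ ν) :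
    ∏ j ∈ ν.support, ((ν j).choose (μ j) : ℝ) * τ j ^ (2 * μ j) =
      (μ.prod (fun j n => τ j ^ (2 * n)) / μ.prod (fun _ n => (n.factorial : ℝ))) *
        (multiFactorial ν / multiFactorial (ν - μ)) := by
  have hs := Finsupp.support_mono h
  have hs2 : (ν - μ).support ⊆ ν.support := Finsupp.support_mono tsub_le_self
  rw [multiFactorial_eq hs2, multiFactorial_eq (subset_refl ν.support),
    Finsupp.prod_of_support_subset μ hs _ (by simp),
    Finsupp.prod_of_support_subset μ hs _ (by simp), ← Finset.prod_div_distrib,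
    ← Finset.prod_div_distrib, ← Finset.prod_mul_distrib]
  refine Finset.prod_congr rfl fun j _ => ?_
  rw [Nat.cast_choose ℝ (h j), Finsupp.tsub_apply]
  have h1 : ((μ j).factorial : ℝ) ≠ 0 := by positivity
  have h2 : ((ν j - μ j).factorial : ℝ) ≠ 0 := by positivity
  field_simp

/-- The weighted square sum of the Hermite coefficients is bounded by the weighted norms of
the mixed derivatives. -/
theorem sum_bWeight_mul_sq_le (hD : IsMixedDerivs r f D) {τ : ι → ℝ} (hτ : ∀ j, 0 < τ j)
    (hsum : Summable (fun μ : {μ : ι →₀ ℕ // ∀ j, μ j ≤ r} =>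
      (μ.1.prod (fun j n => τ j ^ (2 * n)) / μ.1.prod (fun _ n => (n.factorial : ℝ))) *
        ∫ y, ‖D μ.1 y‖ ^ 2 ∂(gauss ι)))
    (L : S →L[ℝ] ℝ) (F : Finset (ι →₀ ℕ)) :
    ∑ ν ∈ F, bWeight τ r ν * (∫ y, hermiteProd ν y * L (f y) ∂(gauss ι)) ^ 2 ≤
      ‖L‖ ^ 2 * ∑' μ : {μ : ι →₀ ℕ // ∀ j, μ j ≤ r},
        (μ.1.prod (fun j n => τ j ^ (2 * n)) / μ.1.prod (fun _ n => (n.factorial : ℝ))) *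
          ∫ y, ‖D μ.1 y‖ ^ 2 ∂(gauss ι) := by
  classical
  set wt : (ι →₀ ℕ) → ℝ := fun μ =>
    μ.prod (fun j n => τ j ^ (2 * n)) / μ.prod (fun _ n => (n.factorial : ℝ)) with hwt
  have hwt0 : ∀ μ, 0 ≤ wt μ := fun μ => div_nonneg
    (Finset.prod_nonneg fun j _ => pow_nonneg (hτ j).le _) (multiFactorial_pos μ).le
  let T : (ι →₀ ℕ) → Finset (ι →₀ ℕ) := fun ν => (Finset.Iic ν).filter fun μ => ∀ j, μ j ≤ r
  have hT : ∀ μ ν, μ ∈ T ν ↔ μ ≤ ν ∧ ∀ j, μ j ≤ r := fun μ ν => by simp [T]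
  -- The factor ν!/(ν−μ)! in binom(ν, μ) is exactly what converts the squared coefficient of f at ν
  -- into that of ∂^μ f at ν − μ.
  have hterm : ∀ ν, bWeight τ r ν * (∫ y, hermiteProd ν y * L (f y) ∂(gauss ι)) ^ 2 =
      ∑ μ ∈ T ν, wt μ * (∫ y, hermiteProd (ν - μ) y * L (D μ y) ∂(gauss ι)) ^ 2 := by
    intro ν
    rw [bWeight, Finset.sum_mul]
    refine Finset.sum_congr (by ext; simp [T]) fun μ hμ => ?_
    obtain ⟨h1, h2⟩ := (hT μ ν).1 hμ
    have h3 := multiFactorial_mul_integral_sq hD L _ μ rfl h2 (ν - μ)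
    rw [tsub_add_cancel_of_le h1] at h3
    have h4 := (multiFactorial_pos (ν - μ)).ne'
    rw [prod_choose_mul τ h1, mul_assoc, div_mul_eq_mul_div (multiFactorial ν), ← h3,
      mul_div_cancel_left₀ _ h4]
  -- For fixed μ the shift ν ↦ ν − μ is injective on ν ≥ μ, so Bessel's inequality for L ∘ ∂^μ f
  -- applies.
  have hbessel : ∀ μ, (∀ j, μ j ≤ r) → ∀ G : Finset (ι →₀ ℕ), (∀ ν ∈ G, μ ≤ ν) →
      ∑ ν ∈ G, (∫ y, hermiteProd (ν - μ) y * L (D μ y) ∂(gauss ι)) ^ 2 ≤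
        ‖L‖ ^ 2 * ∫ y, ‖D μ y‖ ^ 2 ∂(gauss ι) := by
    intro μ hμ G hG
    have hm : MemLp (fun y => L (D μ y)) 2 (gauss ι) := L.comp_memLp' (hD.memLp μ hμ)
    have hinj : Set.InjOn (fun ν => ν - μ) (G : Set (ι →₀ ℕ)) := fun a ha b hb hab => by
      have := congrArg (· + μ) hab
      simpa [tsub_add_cancel_of_le (hG a ha), tsub_add_cancel_of_le (hG b hb)] using this
    rw [← Finset.sum_image (f := fun κ => (∫ y, hermiteProd κ y * L (D μ y) ∂(gauss ι)) ^ 2) hinj]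
    refine (sum_integral_hermiteProd_mul_sq_le hm _).trans ?_
    rw [← integral_const_mul]
    refine integral_mono hm.integrable_sq
      (((hD.memLp μ hμ).integrable_norm_pow two_ne_zero).const_mul _) fun y => ?_
    have := L.le_opNorm (D μ y)
    rw [Real.norm_eq_abs] at this
    calc L (D μ y) ^ 2 = |L (D μ y)| ^ 2 := (sq_abs _).symm
      _ ≤ (‖L‖ * ‖D μ y‖) ^ 2 := by gcongr
      _ = _ := mul_pow _ _ _
  have hswap : ∑ ν ∈ F, ∑ μ ∈ T ν, wt μ *
      (∫ y, hermiteProd (ν - μ) y * L (D μ y) ∂(gauss ι)) ^ 2 =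
      ∑ μ ∈ F.biUnion T, ∑ ν ∈ F.filter (fun ν => μ ∈ T ν), wt μ *
        (∫ y, hermiteProd (ν - μ) y * L (D μ y) ∂(gauss ι)) ^ 2 := by
    refine Finset.sum_comm' fun ν μ => ?_
    simp only [Finset.mem_filter, Finset.mem_biUnion]
    exact ⟨fun h => ⟨h, ν, h⟩, fun h => h.1⟩
  simp_rw [hterm]
  rw [hswap]
  have hle : ∀ μ ∈ F.biUnion T, ∀ j, μ j ≤ r := by
    intro μ hμ
    obtain ⟨ν, _, hν⟩ := Finset.mem_biUnion.1 hμ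
    exact ((hT μ ν).1 hν).2
  calc _ ≤ ∑ μ ∈ F.biUnion T, ‖L‖ ^ 2 * (wt μ * ∫ y, ‖D μ y‖ ^ 2 ∂(gauss ι)) := by
        refine Finset.sum_le_sum fun μ hμ => ?_
        rw [← Finset.mul_sum, mul_left_comm]
        refine mul_le_mul_of_nonneg_left (hbessel μ (hle μ hμ) _ fun ν hν => ?_) (hwt0 μ)
        exact ((hT μ ν).1 (Finset.mem_filter.1 hν).2).1
    _ = ‖L‖ ^ 2 * ∑ μ ∈ F.biUnion T, wt μ * ∫ y, ‖D μ y‖ ^ 2 ∂(gauss ι) := by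
        rw [Finset.mul_sum]
    _ ≤ _ := by
        refine mul_le_mul_of_nonneg_left ?_ (sq_nonneg _)
        rw [← Finset.sum_subtype_of_mem (fun μ => wt μ * ∫ y, ‖D μ y‖ ^ 2 ∂(gauss ι)) hle]
        exact hsum.sum_le_tsum _ fun μ _ => mul_nonneg (hwt0 μ.1)
          (integral_nonneg fun y => sq_nonneg _)

end Derivatives

end SparseQuad

namespace SparseQuad

/-! ### Decay of the weights outside Λ and summability of the coefficients. -/

section Convergence

variable {ι : Type*} {S : Type*} [NormedAddCommGroup S] [NormedSpace ℝ S]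

theorem BoxContinuousAt.clm_comp {f : (ι → ℝ) → S} {y₀ : ι → ℝ} (hf : BoxContinuousAt f y₀)
    (L : S →L[ℝ] ℝ) : BoxContinuousAt (fun y => L (f y)) y₀ := by
  intro ε hε
  have hL : 0 < ‖L‖ + 1 := by positivity
  obtain ⟨w, hw, hpos, hb⟩ := hf (ε / (‖L‖ + 1)) (div_pos hε hL)
  refine ⟨w, hw, hpos, fun y hy => ?_⟩
  rw [← map_sub]
  calc ‖L (f y - f y₀)‖ ≤ ‖L‖ * ‖f y - f y₀‖ := L.le_opNorm _
    _ ≤ (‖L‖ + 1) * (ε / (‖L‖ + 1)) := by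
        gcongr
        · linarith
        · exact hb y hy
    _ = ε := mul_div_cancel₀ _ hL.ne'

/-- Multi-indices outside a set of `N` smallest ones have a weight that is large in `N`. -/
theorem inv_bWeight_le {τ : ι → ℝ} (hτ : ∀ j, 0 < τ j) {q : ℝ} (hq0 : 0 < q) (hq2 : q < 2)
    {r N : ℕ} (hN : 1 ≤ N) {V : ℝ} (hV : ∀ F : Finset (ι →₀ ℕ), ∑ ν ∈ F,
      bWeight τ r ν ^ (-(q / 2)) ≤ V) {Λ : Finset (ι →₀ ℕ)} (hΛ : IsSmallest τ r N Λ)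
    {ν : ι →₀ ℕ} (hν : ν ∉ Λ) :
    (bWeight τ r ν)⁻¹ ≤ bWeight τ r ν ^ (-(q / 2)) * (V / N) ^ (2 * (1 / q - 1 / 2)) := by
  have hb : ∀ μ, 0 < bWeight τ r μ := fun μ => zero_lt_one.trans_le (one_le_bWeight hτ r μ)
  have hN0 : (0 : ℝ) < N := by exact_mod_cast hN
  have hs : 0 ≤ 2 * (1 / q - 1 / 2) := by
    have : 1 / 2 ≤ 1 / q := one_div_le_one_div_of_le hq0 hq2.le
    linarith
  -- Stechkin's argument: each of the N indices in Λ has weight at most b_ν, so each contributes at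
  -- least b_ν^{-q/2} to a sum bounded by V.
  have h1 : N * bWeight τ r ν ^ (-(q / 2)) ≤ V := by
    refine le_trans ?_ (hV Λ)
    rw [← hΛ.1, ← nsmul_eq_mul]
    exact Finset.card_nsmul_le_sum _ _ _ fun μ hμ =>
      Real.rpow_le_rpow_of_nonpos (hb μ) (hΛ.2 μ hμ ν hν) (by linarith)
  have h2 : bWeight τ r ν ^ (-(q / 2)) ≤ V / N := by
    rw [le_div_iff₀ hN0, mul_comm]
    exact h1
  -- The exponents match because q/2 + (q/2) · 2(1/q − 1/2) = 1.
  calc (bWeight τ r ν)⁻¹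
      = bWeight τ r ν ^ (-(q / 2)) * (bWeight τ r ν ^ (-(q / 2))) ^ (2 * (1 / q - 1 / 2)) := by
        rw [← Real.rpow_mul (hb ν).le, ← Real.rpow_add (hb ν), ← Real.rpow_neg_one]
        congr 1
        field_simp
        ring
    _ ≤ _ := by
        refine mul_le_mul_of_nonneg_left ?_ (Real.rpow_nonneg (hb ν).le _)
        exact Real.rpow_le_rpow (Real.rpow_nonneg (hb ν).le _) h2 hs

theorem one_le_prod_support (ν : ι →₀ ℕ) {c : ℝ} (hc : 1 ≤ c) :
    1 ≤ ∏ j ∈ ν.support, c * (ν j : ℝ) ^ 6 := by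
  have h : ∏ j ∈ ν.support, (1 : ℝ) ≤ ∏ j ∈ ν.support, c * (ν j : ℝ) ^ 6 := by
    refine Finset.prod_le_prod (fun _ _ => zero_le_one) fun j hj => ?_
    have hn : (1 : ℝ) ≤ ν j := by
      exact_mod_cast Nat.one_le_iff_ne_zero.2 (Finsupp.mem_support_iff.1 hj)
    exact one_le_mul_of_one_le_of_one_le hc (one_le_pow₀ hn)
  rwa [Finset.prod_const_one] at h

/-- Weighted square-summable coefficients are summable against square roots of products of
linear factors. -/
theorem summable_coeff_mul_sqrt {q : ℝ} {b c : (ι →₀ ℕ) → ℝ} (hb : ∀ ν, 1 ≤ b ν)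
    (hq2 : q < 2) (hbc : Summable fun ν => b ν * c ν ^ 2)
    (hbs : ∀ a : ℝ, 0 ≤ a → Summable fun ν => b ν ^ (-(q / 2)) *
      ∏ j ∈ ν.support, a * (ν j : ℝ) ^ 6) {K : ℝ} (hK : 1 ≤ K) :
    Summable fun ν : ι →₀ ℕ => |c ν| * √(∏ j ∈ ν.support, K * ((ν j : ℝ) + 1)) := by
  have hK0 : 0 ≤ K := zero_le_one.trans hK
  refine Summable.of_nonneg_of_le (fun ν => by positivity) (fun ν => ?_)
    (hbc.add (hbs (2 * K) (by positivity)))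
  have hb0 : 0 < b ν := zero_lt_one.trans_le (hb ν)
  set P := ∏ j ∈ ν.support, K * ((ν j : ℝ) + 1) with hP
  have hP0 : 0 ≤ P := Finset.prod_nonneg fun j _ => by positivity
  have h1 : P ≤ ∏ j ∈ ν.support, 2 * K * (ν j : ℝ) ^ 6 := by
    refine Finset.prod_le_prod (fun j _ => by positivity) fun j hj => ?_
    have hn : (1 : ℝ) ≤ ν j := by
      exact_mod_cast Nat.one_le_iff_ne_zero.2 (Finsupp.mem_support_iff.1 hj)
    have h6 : (ν j : ℝ) ≤ (ν j : ℝ) ^ 6 := le_self_pow₀ hn (by norm_num)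
    rw [mul_comm 2 K, mul_assoc]
    gcongr
    linarith
  have h2 : (b ν)⁻¹ ≤ b ν ^ (-(q / 2)) := by
    rw [← Real.rpow_neg_one]
    exact Real.rpow_le_rpow_of_exponent_le (hb ν) (by linarith)
  -- Arithmetic–geometric mean inequality with the weight split as √b · 1/√b; both terms on the
  -- right are summable over ν.
  have h3 : |c ν| * √P ≤ b ν * c ν ^ 2 + (b ν)⁻¹ * P := by
    have hsb : √(b ν) ≠ 0 := (Real.sqrt_pos.2 hb0).ne'
    have h4 := two_mul_le_add_sq (√(b ν) * |c ν|) ((√(b ν))⁻¹ * √P)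
    rw [mul_pow, mul_pow, inv_pow, Real.sq_sqrt hb0.le, Real.sq_sqrt hP0, sq_abs] at h4
    have h5 : 2 * (√(b ν) * |c ν|) * ((√(b ν))⁻¹ * √P) = 2 * (|c ν| * √P) := by
      field_simp
    have h6 : 0 ≤ |c ν| * √P := by positivity
    linarith
  exact h3.trans (add_le_add_right (mul_le_mul h2 h1 hP0 (Real.rpow_nonneg hb0.le _)) _)

end Convergence

/-! ### The error estimate. -/

section Main

variable {ι : Type*} [Countable ι] {S : Type*} [NormedAddCommGroup S] [NormedSpace ℝ S]
  [CompleteSpace S] {q : ℝ} {τ : ι → ℝ} {r : ℕ} {f : (ι → ℝ) → S}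
  {D : (ι →₀ ℕ) → (ι → ℝ) → S}

/-- Error of the sparse quadrature, tested with a continuous linear functional. -/
theorem abs_map_integral_sub_sparseQuad_le (hq0 : 0 < q) (hq2 : q < 2) (hτ : ∀ j, 0 < τ j)
    (hτq : Summable fun j => (τ j)⁻¹ ^ q) (hr : 14 / q < (r : ℝ))
    (hf : ∀ y₀ : ι → ℝ, (Function.support y₀).Finite → BoxContinuousAt f y₀)
    (hD : IsMixedDerivs r f D)
    (hsum : Summable (fun μ : {μ : ι →₀ ℕ // ∀ j, μ j ≤ r} =>
      (μ.1.prod (fun j n => τ j ^ (2 * n)) / μ.1.prod (fun _ n => (n.factorial : ℝ))) *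
        ∫ y, ‖D μ.1 y‖ ^ 2 ∂(gauss ι)))
    {N : ℕ} (hN : 1 ≤ N) {Λ : Finset (ι →₀ ℕ)} (hadm : Admissible Λ)
    (hΛ : IsSmallest τ r N Λ) (L : S →L[ℝ] ℝ) {V : ℝ}
    (hV : ∀ F : Finset (ι →₀ ℕ), ∑ ν ∈ F,
      bWeight τ r ν ^ (-(q / 2)) * ∏ j ∈ ν.support, 256 * (ν j : ℝ) ^ 6 ≤ V) :
    |L ((∫ y, f y ∂(gauss ι)) - sparseQuad Λ f)| ≤
      √(‖L‖ ^ 2 * ∑' μ : {μ : ι →₀ ℕ // ∀ j, μ j ≤ r},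
        (μ.1.prod (fun j n => τ j ^ (2 * n)) / μ.1.prod (fun _ n => (n.factorial : ℝ))) *
          ∫ y, ‖D μ.1 y‖ ^ 2 ∂(gauss ι)) * √(V * (V / N) ^ (2 * (1 / q - 1 / 2))) := by
  classical
  have hf2 : MemLp f 2 (gauss ι) := hD.zero ▸ hD.memLp 0 fun j => by simp
  have hh : MemLp (fun y => L (f y)) 2 (gauss ι) := L.comp_memLp' hf2
  set c : (ι →₀ ℕ) → ℝ := fun ν => ∫ y, hermiteProd ν y * L (f y) ∂(gauss ι) with hc
  have hb1 : ∀ ν, 1 ≤ bWeight τ r ν := one_le_bWeight hτ r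
  have hb : ∀ ν, 0 < bWeight τ r ν := fun ν => zero_lt_one.trans_le (hb1 ν)
  have hcoeff := sum_bWeight_mul_sq_le hD hτ hsum L
  set M := ‖L‖ ^ 2 * ∑' μ : {μ : ι →₀ ℕ // ∀ j, μ j ≤ r},
        (μ.1.prod (fun j n => τ j ^ (2 * n)) / μ.1.prod (fun _ n => (n.factorial : ℝ))) *
          ∫ y, ‖D μ.1 y‖ ^ 2 ∂(gauss ι) with hM
  have hexp : ∀ y₀ : ι → ℝ, (Function.support y₀).Finite →
      HasSum (fun ν => c ν * hermiteProd ν y₀) (L (f y₀)) := fun y₀ hy₀ =>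
    hasSum_hermiteProd_of_boxContinuousAt hh hy₀ ((hf y₀ hy₀).clm_comp L) fun K hK =>
      summable_coeff_mul_sqrt hb1 hq2
        (summable_of_sum_le (fun ν => mul_nonneg (hb ν).le (sq_nonneg _)) hcoeff)
        (fun a ha => summable_bWeight_rpow hτ hq0 hτq hr ha) hK
  have hint : ∫ y, L (f y) ∂(gauss ι) = c 0 := by simp [hc]
  -- The integral is the coefficient c_0, and sparse quadrature uses only finitely many finitely
  -- supported points, where the expansion converges to L ∘ f.
  have herr : HasSum (fun ν => c ν * ((if ν = 0 then 1 else 0) - sparseQuad Λ (hermiteProd ν)))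
      (L ((∫ y, f y ∂(gauss ι)) - sparseQuad Λ f)) := by
    rw [map_sub, map_sparseQuad, ← L.integral_comp_comm (hf2.integrable (by norm_num)), hint]
    have h0 : HasSum (fun ν : ι →₀ ℕ => c ν * (if ν = 0 then (1 : ℝ) else 0)) (c 0) := by
      convert hasSum_ite_eq (0 : ι →₀ ℕ) (c 0) using 2 with ν
      split_ifs with h
      · rw [h, mul_one]
      · rw [mul_zero]
    simpa only [mul_sub] using h0.sub (hasSum_sparseQuad Λ hexp)
  have h0Λ : (0 : ι →₀ ℕ) ∈ Λ := by
    obtain ⟨ν, hν⟩ := Finset.card_pos.1 (hΛ.1 ▸ hN : 0 < Λ.card)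
    exact hadm ν hν 0 zero_le
  have hV' : ∀ F : Finset (ι →₀ ℕ), ∑ ν ∈ F, bWeight τ r ν ^ (-(q / 2)) ≤ V := fun F =>
    (Finset.sum_le_sum fun ν _ => le_mul_of_one_le_right (Real.rpow_nonneg (hb ν).le _)
      (one_le_prod_support ν (by norm_num))).trans (hV F)
  have hV0 : 0 ≤ V := by simpa using hV ∅
  refine le_of_tendsto herr.abs (Filter.Eventually.of_forall fun F => ?_)
  -- Inside Λ the left side is 0 by exactness. Outside, ν ≠ 0 because 0 ∈ Λ, and the squared
  -- quadrature bound 16² ν_j⁶ = 256 ν_j⁶ meets the Stechkin bound for b_ν^{-1}.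
  have hT : ∀ ν, ((if ν = 0 then 1 else 0) - sparseQuad Λ (hermiteProd ν)) ^ 2 *
      (bWeight τ r ν)⁻¹ ≤ (bWeight τ r ν ^ (-(q / 2)) * ∏ j ∈ ν.support, 256 * (ν j : ℝ) ^ 6) *
        (V / N) ^ (2 * (1 / q - 1 / 2)) := by
    intro ν
    have hP0 : 0 ≤ ∏ j ∈ ν.support, 256 * (ν j : ℝ) ^ 6 :=
      Finset.prod_nonneg fun j _ => by positivity
    by_cases hν : ν ∈ Λ
    · rw [sparseQuad_hermiteProd_of_mem hadm hν, sub_self, zero_pow two_ne_zero, zero_mul]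
      exact mul_nonneg (mul_nonneg (Real.rpow_nonneg (hb ν).le _) hP0)
        (Real.rpow_nonneg (by positivity) _)
    · have hν0 : ν ≠ 0 := fun h => hν (h ▸ h0Λ)
      rw [if_neg hν0, zero_sub, neg_sq, mul_comm _ (_ ^ (2 * (1 / q - 1 / 2))), ← mul_assoc,
        mul_comm _ (bWeight τ r ν ^ _), mul_comm]
      refine mul_le_mul (inv_bWeight_le hτ hq0 hq2 hN hV' hΛ hν) ?_ (sq_nonneg _)
        (mul_nonneg (Real.rpow_nonneg (hb ν).le _) (Real.rpow_nonneg (by positivity) _))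
      rw [← sq_abs]
      refine (pow_le_pow_left₀ (abs_nonneg _) (abs_sparseQuad_hermiteProd_le Λ ν) 2).trans_eq ?_
      rw [← Finset.prod_pow]
      exact Finset.prod_congr rfl fun j _ => by ring
  -- Cauchy–Schwarz on a finite partial sum, with √b_ν moved to the coefficients and 1/√b_ν to the
  -- quadrature errors.
  have hcs := Finset.sum_mul_sq_le_sq_mul_sq F (fun ν => √(bWeight τ r ν) * c ν)
    (fun ν => ((if ν = 0 then 1 else 0) - sparseQuad Λ (hermiteProd ν)) * (√(bWeight τ r ν))⁻¹)
  have hprod : ∀ ν, √(bWeight τ r ν) * c ν *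
      (((if ν = 0 then 1 else 0) - sparseQuad Λ (hermiteProd ν)) * (√(bWeight τ r ν))⁻¹) =
      c ν * ((if ν = 0 then 1 else 0) - sparseQuad Λ (hermiteProd ν)) := by
    intro ν
    have : √(bWeight τ r ν) ≠ 0 := (Real.sqrt_pos.2 (hb ν)).ne'
    field_simp
  simp_rw [hprod, mul_pow, inv_pow, Real.sq_sqrt (hb _).le] at hcs
  have hM0 : 0 ≤ M := by simpa using hcoeff ∅
  rw [← Real.sqrt_mul hM0]
  refine Real.abs_le_sqrt (hcs.trans ?_)
  refine mul_le_mul (hcoeff F) ?_ (Finset.sum_nonneg fun ν _ =>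
    mul_nonneg (sq_nonneg _) (inv_nonneg.2 (hb ν).le)) hM0
  refine (Finset.sum_le_sum fun ν _ => hT ν).trans ?_
  rw [← Finset.sum_mul]
  exact mul_le_mul_of_nonneg_right (hV F) (Real.rpow_nonneg (by positivity) _)

end Main

end SparseQuad

theorem corollary3p7 {ι : Type*} [Countable ι] [Nonempty ι]
    {S : Type*} [NormedAddCommGroup S] [NormedSpace ℝ S] [CompleteSpace S]
    (q : ℝ) (hq0 : 0 < q) (hq2 : q < 2)
    (τ : ι → ℝ) (hτ : ∀ j, 0 < τ j) (hτq : Summable (fun j => (τ j)⁻¹ ^ q))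
    (r : ℕ) (hr : IsLeast {n : ℕ | 14 / q < (n : ℝ)} r)
    (f : (ι → ℝ) → S)
    (hf : ∀ y₀ : ι → ℝ, (Function.support y₀).Finite → SparseQuad.BoxContinuousAt f y₀)
    (D : (ι →₀ ℕ) → (ι → ℝ) → S) (hD : SparseQuad.IsMixedDerivs r f D)
    (hsum : Summable (fun μ : {μ : ι →₀ ℕ // ∀ j, μ j ≤ r} =>
      (μ.1.prod (fun j n => τ j ^ (2 * n)) / μ.1.prod (fun _ n => (n.factorial : ℝ))) *
        ∫ y, ‖D μ.1 y‖ ^ 2 ∂(SparseQuad.gauss ι))) :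
    (∀ N : ℕ, ∃ Λ : Finset (ι →₀ ℕ),
      SparseQuad.Admissible Λ ∧ SparseQuad.IsSmallest τ r N Λ) ∧
    ∃ C : ℝ, ∀ N : ℕ, 1 ≤ N → ∀ Λ : Finset (ι →₀ ℕ),
      SparseQuad.Admissible Λ → SparseQuad.IsSmallest τ r N Λ →
      ‖(∫ y, f y ∂(SparseQuad.gauss ι)) - SparseQuad.sparseQuad Λ f‖ ≤
        C * (SparseQuad.numPoints Λ : ℝ) ^ (-((1 / q - 1 / 2) / 2)) := by
  have hr' : 14 / q < (r : ℝ) := hr.1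
  refine ⟨SparseQuad.exists_admissible_isSmallest hτ
    (SparseQuad.finite_bWeight_le hτ hq0 hτq hr'), ?_⟩
  have hVs := SparseQuad.summable_bWeight_rpow hτ hq0 hτq hr' (c := 256) (by norm_num)
  have hpos : ∀ ν : ι →₀ ℕ, 0 ≤ SparseQuad.bWeight τ r ν ^ (-(q / 2)) *
      ∏ j ∈ ν.support, 256 * (ν j : ℝ) ^ 6 := fun ν => mul_nonneg
    (Real.rpow_nonneg (zero_le_one.trans (SparseQuad.one_le_bWeight hτ r ν)) _)
    (Finset.prod_nonneg fun j _ => by positivity)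
  have hV := fun F : Finset (ι →₀ ℕ) => hVs.sum_le_tsum F fun ν _ => hpos ν
  have hV0 := tsum_nonneg (L := .unconditional _) hpos
  set V := ∑' ν : ι →₀ ℕ, SparseQuad.bWeight τ r ν ^ (-(q / 2)) *
      ∏ j ∈ ν.support, 256 * (ν j : ℝ) ^ 6
  have hM0 : 0 ≤ ∑' μ : {μ : ι →₀ ℕ // ∀ j, μ j ≤ r},
      (μ.1.prod (fun j n => τ j ^ (2 * n)) / μ.1.prod (fun _ n => (n.factorial : ℝ))) *
        ∫ y, ‖D μ.1 y‖ ^ 2 ∂(SparseQuad.gauss ι) := tsum_nonneg fun μ =>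
    mul_nonneg (div_nonneg (Finset.prod_nonneg fun j _ => pow_nonneg (hτ j).le _)
      (SparseQuad.multiFactorial_pos μ.1).le) (integral_nonneg fun y => sq_nonneg _)
  set M := ∑' μ : {μ : ι →₀ ℕ // ∀ j, μ j ≤ r},
      (μ.1.prod (fun j n => τ j ^ (2 * n)) / μ.1.prod (fun _ n => (n.factorial : ℝ))) *
        ∫ y, ‖D μ.1 y‖ ^ 2 ∂(SparseQuad.gauss ι) with hM
  have hs : 0 ≤ 1 / q - 1 / 2 := sub_nonneg.2 (one_div_le_one_div_of_le hq0 hq2.le)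
  refine ⟨√M * (√V * V ^ (1 / q - 1 / 2)), fun N hN Λ hadm hΛ => ?_⟩
  have hN0 : (0 : ℝ) < N := by exact_mod_cast hN
  -- Hahn–Banach: a functional of norm at most 1 that attains the norm of the error. It depends on
  -- Λ, but the scalar bound depends on it only through ‖L‖.
  obtain ⟨L, hL1, hL⟩ := exists_dual_vector'' ℝ
    ((∫ y, f y ∂(SparseQuad.gauss ι)) - SparseQuad.sparseQuad Λ f)
  have h1 := (le_abs_self _).trans (SparseQuad.abs_map_integral_sub_sparseQuad_le hq0 hq2 hτ hτq
    hr' hf hD hsum hN hadm hΛ L hV)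
  rw [hL, ← hM] at h1
  refine h1.trans ?_
  have h2 : √(‖L‖ ^ 2 * M) ≤ √M := by
    refine Real.sqrt_le_sqrt (mul_le_of_le_one_left hM0 ?_)
    exact pow_le_one₀ (norm_nonneg _) hL1
  have h3 : √(V * (V / N) ^ (2 * (1 / q - 1 / 2))) =
      √V * V ^ (1 / q - 1 / 2) * (N : ℝ) ^ (-(1 / q - 1 / 2)) := by
    rw [Real.sqrt_mul hV0, mul_comm 2 (1 / q - 1 / 2), Real.rpow_mul (by positivity),
      Real.rpow_two, Real.sqrt_sq (by positivity), Real.div_rpow hV0 hN0.le, Real.rpow_neg hN0.le,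
      div_eq_mul_inv, mul_assoc]
  have h0 : (0 : ι →₀ ℕ) ∈ Λ := by
    obtain ⟨ν, hν⟩ := Finset.card_pos.1 (hΛ.1 ▸ hN : 0 < Λ.card)
    exact hadm ν hν 0 zero_le
  have hp0 : (0 : ℝ) < SparseQuad.numPoints Λ := by exact_mod_cast SparseQuad.numPoints_pos h0
  have hp : (SparseQuad.numPoints Λ : ℝ) ≤ (N : ℝ) ^ (2 : ℝ) := by
    rw [Real.rpow_two, ← hΛ.1]
    exact_mod_cast SparseQuad.numPoints_le hadm
  -- Here N_p ≤ N² costs the factor 1/2 in the exponent; N_p > 0 is needed because the power is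
  -- negative.
  have h4 : (N : ℝ) ^ (-(1 / q - 1 / 2)) ≤
      (SparseQuad.numPoints Λ : ℝ) ^ (-((1 / q - 1 / 2) / 2)) := by
    refine le_trans (le_of_eq ?_) (Real.rpow_le_rpow_of_nonpos hp0 hp (by linarith))
    rw [← Real.rpow_mul hN0.le]
    congr 1
    ring
  rw [h3, mul_assoc (√M)]
  exact mul_le_mul h2 (mul_le_mul_of_nonneg_left h4 (by positivity)) (by positivity)
    (Real.sqrt_nonneg _)
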